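/- Let $\Omega$ be a star graph with edges $[0,\ell_i]$, $\ell_i>0$ ($1\le i\le n$), whose endpoints $0$ are identified, and let $V_i\in L^1(0,\ell_i)$ be real-valued. Let $\alpha_1,\alpha_2,\beta_1,\beta_2\in\mathbb C^{n\times n}$ with $\operatorname{rank}[\alpha_1\ \alpha_2]=\operatorname{rank}[\beta_1\ \beta_2]=n$, $\alpha_1\alpha_2^*=\alpha_2\alpha_1^*$, $\beta_1\beta_2^*=\beta_2\beta_1^*$, and $\beta_1,\beta_2$ diagonal. Let $H^\Omega_\Gamma$ be the operator $(u_i)_i\mapsto(-u_i''+V_iu_i)_i$ in $L^2(\Omega)=\bigoplus_iL^2(0,\ell_i)$ whose domain consists of all $\vec u\in L^2(\Omega)$ with $u_i,u_i'$ absolutely continuous on $[0,\ell_i]$, $-u_i''+V_iu_i\in L^2(0,\ell_i)$, and $$\Gamma:\qquad \alpha_1\vec u(0)+\alpha_2\vec u'(0)=0,\qquad \beta_1\vec u(\ell)+\beta_2\vec u'(\ell)=0 .$$ Fix an edge $j$ and a point $s\in(0,\ell_j)$ on it. Let $\Omega_1$ be the interval $[s,\ell_j]$ of that edge, and let $\Omega_2$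 be the star graph that remains when the $j$-th edge is shortened to $[0,s]$. For $k=1,2$ let $\Gamma_k$ be the boundary conditions on $\Omega_k$ that agree with $\Gamma$ at the vertices of $\Omega$ in $\Omega_k$ and impose the Dirichlet condition at $s$, and let $H^{\Omega_k}_{\Gamma_k}$ be the corresponding operator in $L^2(\Omega_k)$, defined in the same way. For $z$ in the resolvent set of $H^{\Omega_1}_{\Gamma_1}$ and $f\in\mathbb C$, put $M_1(z)f=-u'(s)$, where $u$ is the solution of $-u''+V_ju=zu$ on $\Omega_1$ with $u(s)=f$ that satisfies the $\Gamma_1$ condition at $\ell_j$. For $z$ in the resolvent set of $H^{\Omega_2}_{\Gamma_2}$ and $f\in\mathbb C$, put $M_2(z)f=u_j'(s)$, where $\vec u$ is the solution of $-u_i''+V_iu_i=zu_i$ ($1\le i\le n$) on $\Omega_2$ with $u_j(s)=f$ that satisfies all other $\Gamma_2$ conditions. Then these solutions exist and are unique, $M_1(z)$ and $M_2(z)$ are linear maps $\mathbb C\to\mathbb C$, that is, multiplications by complex numbers, and $M_1+M_2$ is a meromorphic function on $\mathbb C$ that is not identically zero. For real $\lambda$ let $\mathcal N_X(\lambda)$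 be the number of eigenvalues of $X$ in $(-\infty,\lambda]$, counted with multiplicity, and let $N(\lambda)$ be the number of zeros minus the number of poles of $M_1+M_2$ in $(-\infty,\lambda]$, counted with multiplicity. Then for every $\lambda\in\mathbb R$ all these numbers are finite and $$\mathcal N_{H^\Omega_\Gamma}(\lambda)=\mathcal N_{H^{\Omega_1}_{\Gamma_1}}(\lambda)+\mathcal N_{H^{\Omega_2}_{\Gamma_2}}(\lambda)+N(\lambda).$$ -/

import Mathlib

namespace QuantumStar

open MeasureTheory Set

/-! ### Counting eigenvalues, zeros and poles -/

section Counting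

variable {E : Type*} [NormedAddCommGroup E] [NormedSpace ℂ E]

/-- The eigenspace `ker (T - z)` of an unbounded operator `T`, as a subspace of the ambient space. -/
def eigenspace (T : E →ₗ.[ℂ] E) (z : ℂ) : Submodule ℂ E where
  carrier := {x | ∃ h : x ∈ T.domain, T ⟨x, h⟩ = z • x}
  zero_mem' := ⟨T.domain.zero_mem, T.map_zero.trans (smul_zero z).symm⟩
  add_mem' := by
    rintro x y ⟨hx, ex⟩ ⟨hy, ey⟩
    refine ⟨T.domain.add_mem hx hy, ?_⟩
    have h := T.map_add ⟨x, hx⟩ ⟨y, hy⟩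
    rw [ex, ey, ← smul_add] at h
    exact h
  smul_mem' := by
    rintro c x ⟨hx, ex⟩
    refine ⟨T.domain.smul_mem c hx, ?_⟩
    have h := T.map_smul c ⟨x, hx⟩
    rw [ex, smul_comm] at h
    exact h

/-- The resolvent set of an unbounded operator `T`: those `z` for which `T - z`, from its domain
to the whole space, has a bounded two-sided inverse. -/
def resolventSet (T : E →ₗ.[ℂ] E) : Set ℂ :=
  {z | ∃ R : E →L[ℂ] E,
    (∀ y, ∃ h : R y ∈ T.domain, T ⟨R y, h⟩ - z • R y = y) ∧
    ∀ x : T.domain, R (T x - z • (x : E)) = x}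

/-- `T` has only finitely many eigenvalues in `(-∞, Λ]`, each of finite multiplicity. -/
def FinitelyManyEigenvalues (T : E →ₗ.[ℂ] E) (Λ : ℝ) : Prop :=
  {μ : ℝ | μ ≤ Λ ∧ eigenspace T (μ : ℂ) ≠ ⊥}.Finite ∧
    ∀ μ : ℝ, μ ≤ Λ → FiniteDimensional ℂ (eigenspace T (μ : ℂ))

/-- The number of eigenvalues of `T` in `(-∞, Λ]`, each counted with its multiplicity. -/
noncomputable def eigenvalueCount (T : E →ₗ.[ℂ] E) (Λ : ℝ) : ℕ :=
  ∑ᶠ μ ∈ Iic Λ, Module.finrank ℂ (eigenspace T ((μ : ℝ) : ℂ))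

end Counting

/-- The order of the zero of the meromorphic function `f` at `z` (`0` if `z` is no zero). -/
noncomputable def zeroOrder (f : ℂ → ℂ) (z : ℂ) : ℕ :=
  (meromorphicOrderAt f z).untop₀.toNat

/-- The order of the pole of the meromorphic function `f` at `z` (`0` if `z` is no pole). -/
noncomputable def poleOrder (f : ℂ → ℂ) (z : ℂ) : ℕ :=
  (-(meromorphicOrderAt f z).untop₀).toNat

/-- The number of zeros of `f` in `(-∞, Λ]`, with multiplicity. -/
noncomputable def zeroCount (f : ℂ → ℂ) (Λ : ℝ) : ℕ :=
  ∑ᶠ μ ∈ Iic Λ, zeroOrder f ((μ : ℝ) : ℂ)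

/-- The number of poles of `f` in `(-∞, Λ]`, with multiplicity. -/
noncomputable def poleCount (f : ℂ → ℂ) (Λ : ℝ) : ℕ :=
  ∑ᶠ μ ∈ Iic Λ, poleOrder f ((μ : ℝ) : ℂ)

/-! ### Schrödinger operators on star graphs -/

/-- `u` is absolutely continuous on `[a, b]` with (weak) derivative `p ∈ L¹(a, b)`. -/
def HasACDeriv (a b : ℝ) (u p : ℝ → ℂ) : Prop :=
  IntervalIntegrable p volume a b ∧ ∀ x ∈ Icc a b, u x = u a + ∫ t in a..x, p t

/-- The data of a Schrödinger operator on a star graph with edges indexed by `ι`. The edge `i` is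
the interval `[left i, right i]`, where `left i` is the central vertex and `right i` the outer one;
`V i` is the potential on that edge, and the boundary conditions are
`α₁ u(left) + α₂ u'(left) = 0` and `β₁ u(right) + β₂ u'(right) = 0`. -/
structure StarData (ι : Type*) where
  left : ι → ℝ
  right : ι → ℝ
  V : ι → ℝ → ℝ
  α₁ : Matrix ι ι ℂ
  α₂ : Matrix ι ι ℂ
  β₁ : Matrix ι ι ℂ
  β₂ : Matrix ι ι ℂ

namespace StarData

variable {ι : Type*} [Fintype ι]

/-- The boundary conditions are of self-adjoint type, and those at the outer vertices are local. -/
structure SelfAdjointBC [DecidableEq ι] (P : StarData ι) : Prop where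
  rank_α : (Matrix.fromCols P.α₁ P.α₂).rank = Fintype.card ι
  rank_β : (Matrix.fromCols P.β₁ P.β₂).rank = Fintype.card ι
  symm_α : P.α₁ * P.α₂.conjTranspose = P.α₂ * P.α₁.conjTranspose
  symm_β : P.β₁ * P.β₂.conjTranspose = P.β₂ * P.β₁.conjTranspose
  diag_β₁ : P.β₁.IsDiag
  diag_β₂ : P.β₂.IsDiag

/-- The boundary trace of a function `u` on the graph with derivative `p`; the first block belongs
to the outer vertices, the second one to the central vertex. -/
def trace (P : StarData ι) (u p : ι → ℝ → ℂ) : ι ⊕ ι → ℂ :=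
  Sum.elim
    (P.β₁.mulVec (fun i => u i (P.right i)) + P.β₂.mulVec (fun i => p i (P.right i)))
    (P.α₁.mulVec (fun i => u i (P.left i)) + P.α₂.mulVec (fun i => p i (P.left i)))

/-- The Hilbert space `L²(Ω) = ⨁ᵢ L²(leftᵢ, rightᵢ)`. -/
abbrev L2 (P : StarData ι) : Type _ :=
  PiLp 2 (fun i : ι => Lp ℂ 2 (volume.restrict (Ioc (P.left i) (P.right i))))

/-- `(u, p, q)` consists of a function on the graph with its first and second derivatives. -/
def IsTwiceDiff (P : StarData ι) (u p q : ι → ℝ → ℂ) : Prop :=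
  ∀ i, HasACDeriv (P.left i) (P.right i) (u i) (p i) ∧
    HasACDeriv (P.left i) (P.right i) (p i) (q i)

end StarData

theorem HasACDeriv.zero (a b : ℝ) : HasACDeriv a b 0 0 := by
  refine ⟨?_, fun x _ => ?_⟩
  · exact intervalIntegrable_const (c := (0 : ℂ))
  · simp

theorem HasACDeriv.add {a b : ℝ} {u p v q : ℝ → ℂ} (h : HasACDeriv a b u p)
    (k : HasACDeriv a b v q) : HasACDeriv a b (u + v) (p + q) := by
  refine ⟨h.1.add k.1, fun x hx => ?_⟩
  have hs : uIcc a x ⊆ uIcc a b := uIcc_subset_uIcc left_mem_uIcc (Icc_subset_uIcc hx)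
  simp only [Pi.add_apply]
  rw [intervalIntegral.integral_add (h.1.mono_set hs) (k.1.mono_set hs), h.2 x hx, k.2 x hx]
  ring

theorem HasACDeriv.smul {a b : ℝ} {u p : ℝ → ℂ} (c : ℂ) (h : HasACDeriv a b u p) :
    HasACDeriv a b (c • u) (c • p) := by
  refine ⟨h.1.smul c, fun x hx => ?_⟩
  simp only [Pi.smul_apply]
  rw [intervalIntegral.integral_smul, h.2 x hx, smul_add]

/-- The derivative of a function that vanishes almost everywhere vanishes almost everywhere. -/
theorem HasACDeriv.ae_eq_zero {a b : ℝ} {u p : ℝ → ℂ} (h : HasACDeriv a b u p)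
    (hu : u =ᵐ[volume.restrict (Ioc a b)] 0) : p =ᵐ[volume.restrict (Ioc a b)] 0 := by
  rcases le_or_gt b a with hab | hab
  · rw [Ioc_eq_empty (not_lt.mpr hab), Measure.restrict_empty, Filter.EventuallyEq, ae_zero]
    exact Filter.eventually_bot
  have hu' : ∀ x ∈ Ioo a b, u x = 0 := by
    have hc : ContinuousOn (fun x => u a + ∫ t in a..x, p t) (Ioo a b) := by
      have := intervalIntegral.continuousOn_primitive_interval' h.1 (left_mem_uIcc)
      rw [uIcc_of_le hab.le] at this
      exact (continuousOn_const.add this).mono Ioo_subset_Icc_self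
    have hcu : ContinuousOn u (Ioo a b) :=
      hc.congr fun x hx => h.2 x (Ioo_subset_Icc_self hx)
    have hae : u =ᵐ[volume.restrict (Ioo a b)] 0 :=
      ae_restrict_of_ae_restrict_of_subset Ioo_subset_Ioc_self hu
    exact Measure.eqOn_open_of_ae_eq hae isOpen_Ioo hcu continuousOn_const
  have hD := h.1.ae_hasDerivAt_integral
  rw [uIcc_of_le hab.le] at hD
  rw [← Measure.restrict_congr_set (Ioo_ae_eq_Ioc (μ := volume) (a := a) (b := b))]
  rw [Filter.EventuallyEq, ae_restrict_iff' measurableSet_Ioo]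
  filter_upwards [hD] with x hx hxI
  have h1 := hx (Ioo_subset_Icc_self hxI) a (left_mem_Icc.2 hab.le)
  have h2 : HasDerivAt (fun y => ∫ t in a..y, p t) 0 x := by
    refine (hasDerivAt_const x (-u a)).congr_of_eventuallyEq ?_
    filter_upwards [isOpen_Ioo.mem_nhds hxI] with y hy
    have := h.2 y (Ioo_subset_Icc_self hy)
    rw [hu' y hy] at this
    exact (neg_eq_of_add_eq_zero_right this.symm).symm
  exact h1.unique h2

namespace StarData

variable {ι : Type*} [Fintype ι]

theorem trace_zero (P : StarData ι) : P.trace 0 0 = 0 := by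
  funext i
  rcases i with i | i <;>
    simp [trace, Matrix.mulVec, dotProduct]

theorem trace_add (P : StarData ι) (u p v q : ι → ℝ → ℂ) :
    P.trace (u + v) (p + q) = P.trace u p + P.trace v q := by
  funext i
  rcases i with i | i <;>
    simp only [trace, Matrix.mulVec, dotProduct, Sum.elim_inl, Sum.elim_inr, Pi.add_apply,
      mul_add, Finset.sum_add_distrib] <;> ring

theorem trace_smul (P : StarData ι) (c : ℂ) (u p : ι → ℝ → ℂ) :
    P.trace (c • u) (c • p) = c • P.trace u p := by
  funext i
  rcases i with i | i <;>
    simp only [trace, Matrix.mulVec, dotProduct, Sum.elim_inl, Sum.elim_inr, Pi.add_apply,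
      Pi.smul_apply, smul_eq_mul, mul_add, Finset.mul_sum] <;>
    congr 1 <;> exact Finset.sum_congr rfl fun _ _ => by ring

/-- The graph of the operator `u ↦ -u'' + V u`: pairs `(f, g)` of elements of `L²(Ω)` such that `f`
is the class of some `u` with `u`, `u'` absolutely continuous on every edge, `u` satisfies the
boundary conditions, and `g` is the class of `-u'' + V u`. -/
def operatorGraph (P : StarData ι) : Submodule ℂ (P.L2 × P.L2) where
  carrier := {x | ∃ u p q : ι → ℝ → ℂ, P.IsTwiceDiff u p q ∧ P.trace u p = 0 ∧
    ∀ i, (x.1 i : ℝ → ℂ) =ᵐ[volume.restrict (Ioc (P.left i) (P.right i))] u i ∧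
      (x.2 i : ℝ → ℂ) =ᵐ[volume.restrict (Ioc (P.left i) (P.right i))]
        fun t => -q i t + (P.V i t : ℂ) * u i t}
  zero_mem' := by
    refine ⟨0, 0, 0, fun i => ⟨HasACDeriv.zero _ _, HasACDeriv.zero _ _⟩, P.trace_zero,
      fun i => ⟨?_, ?_⟩⟩
    · exact Lp.coeFn_zero _ _ _
    · refine (Lp.coeFn_zero _ _ _).trans (Filter.EventuallyEq.of_eq ?_)
      funext t
      simp
  add_mem' := by
    rintro ⟨f, g⟩ ⟨f', g'⟩ ⟨u, p, q, hd, ht, he⟩ ⟨u', p', q', hd', ht', he'⟩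
    refine ⟨u + u', p + p', q + q',
      fun i => ⟨(hd i).1.add (hd' i).1, (hd i).2.add (hd' i).2⟩, ?_, fun i => ⟨?_, ?_⟩⟩
    · rw [trace_add, ht, ht', add_zero]
    · refine (Lp.coeFn_add (f i) (f' i)).trans ?_
      filter_upwards [(he i).1, (he' i).1] with t h1 h2
      simpa using congrArg₂ (· + ·) h1 h2
    · refine (Lp.coeFn_add (g i) (g' i)).trans ?_
      filter_upwards [(he i).2, (he' i).2] with t h1 h2
      refine (congrArg₂ (· + ·) h1 h2).trans ?_
      simp only [Pi.add_apply]
      ring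
  smul_mem' := by
    rintro c ⟨f, g⟩ ⟨u, p, q, hd, ht, he⟩
    refine ⟨c • u, c • p, c • q, fun i => ⟨(hd i).1.smul c, (hd i).2.smul c⟩, ?_,
      fun i => ⟨?_, ?_⟩⟩
    · rw [trace_smul, ht, smul_zero]
    · refine (Lp.coeFn_smul c (f i)).trans ?_
      filter_upwards [(he i).1] with t h1
      simpa using congrArg (c • ·) h1
    · refine (Lp.coeFn_smul c (g i)).trans ?_
      filter_upwards [(he i).2] with t h1
      refine (congrArg (c • ·) h1).trans ?_
      simp only [Pi.smul_apply, smul_eq_mul]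
      ring

/-- The relation `operatorGraph` is single-valued, so it is the graph of an operator. -/
theorem operatorGraph_functional (P : StarData ι) :
    ∀ x ∈ P.operatorGraph, x.1 = 0 → x.2 = 0 := by
  rintro ⟨f, g⟩ ⟨u, p, q, hd, -, he⟩ hf
  simp only at hf
  subst hf
  ext1 i
  have hu : u i =ᵐ[volume.restrict (Ioc (P.left i) (P.right i))] 0 :=
    (he i).1.symm.trans (Lp.coeFn_zero _ _ _)
  have hq := (hd i).2.ae_eq_zero ((hd i).1.ae_eq_zero hu)
  refine Lp.ext (((he i).2.trans ?_).trans (Lp.coeFn_zero _ _ _).symm)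
  filter_upwards [hu, hq] with t h1 h2
  simp [h1, h2]

/-- The Schrödinger operator `u ↦ -u'' + V u` in `L²(Ω)`. Its domain consists of all `u` in `L²(Ω)`
with `u`, `u'` absolutely continuous on every edge and `-u'' + V u` in `L²(Ω)` that satisfy the
boundary conditions. -/
noncomputable def operator (P : StarData ι) : P.L2 →ₗ.[ℂ] P.L2 :=
  P.operatorGraph.toLinearPMap

theorem operator_graph (P : StarData ι) : P.operator.graph = P.operatorGraph :=
  Submodule.toLinearPMap_graph_eq _ P.operatorGraph_functional

/-- `u`, with derivative `p`, solves `-u'' + V u = z u` on every edge, and its boundary trace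
is `w`. -/
def Solves (P : StarData ι) (z : ℂ) (w : ι ⊕ ι → ℂ) (u p : ι → ℝ → ℂ) : Prop :=
  P.IsTwiceDiff u p (fun i t => ((P.V i t : ℂ) - z) * u i t) ∧ P.trace u p = w

/-- The boundary value problem `Solves` has exactly one solution (as a function on the graph). -/
def UniquelySolvable (P : StarData ι) (z : ℂ) (w : ι ⊕ ι → ℂ) : Prop :=
  ∃ u p, P.Solves z w u p ∧ ∀ u' p', P.Solves z w u' p' →
    ∀ i, EqOn (u' i) (u i) (Icc (P.left i) (P.right i)) ∧
      EqOn (p' i) (p i) (Icc (P.left i) (P.right i))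

/-- The part `Ω₁` of the graph that is cut off at the point `s` of the edge `j`: the single edge
`[s, right j]`, with the old condition at `right j` and a Dirichlet condition at `s`. -/
def outerPart (P : StarData ι) (j : ι) (s : ℝ) : StarData (Fin 1) where
  left := fun _ => s
  right := fun _ => P.right j
  V := fun _ => P.V j
  α₁ := 1
  α₂ := 0
  β₁ := fun _ _ => P.β₁ j j
  β₂ := fun _ _ => P.β₂ j j

variable [DecidableEq ι]

/-- The part `Ω₂` of the graph that remains after cutting at the point `s` of the edge `j`: the
`j`-th edge now ends at `s`, where a Dirichlet condition is imposed; all other boundary conditions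
are the old ones. -/
def innerPart (P : StarData ι) (j : ι) (s : ℝ) : StarData ι where
  left := P.left
  right := Function.update P.right j s
  V := P.V
  α₁ := P.α₁
  α₂ := P.α₂
  β₁ := P.β₁.updateRow j (Pi.single j 1)
  β₂ := P.β₂.updateRow j 0

/-- Boundary values on `Ω₁` that are `f` at the cutting point and `0` at the other vertex. -/
def outerValue (f : ℂ) : Fin 1 ⊕ Fin 1 → ℂ := Pi.single (Sum.inr 0) f

/-- Boundary values on `Ω₂` that are `f` at the cutting point and `0` in all other places. -/
def innerValue (j : ι) (f : ℂ) : ι ⊕ ι → ℂ := Pi.single (Sum.inl j) f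

/-- The one-sided map `M₁(z) f = -u'(s)`, where `u` solves `(H - z) u = 0` on `Ω₁` with `u(s) = f`
and satisfies the other boundary condition (a junk value if there is no solution). -/
noncomputable def M₁ (P : StarData ι) (j : ι) (s : ℝ) (z f : ℂ) : ℂ :=
  Classical.epsilon fun c =>
    ∃ u p, (P.outerPart j s).Solves z (outerValue f) u p ∧ c = -p 0 s

/-- The one-sided map `M₂(z) f = u_j'(s)`, where `u` solves `(H - z) u = 0` on `Ω₂` with
`u_j(s) = f` and satisfies all other boundary conditions (a junk value if there is no solution). -/
noncomputable def M₂ (P : StarData ι) (j : ι) (s : ℝ) (z f : ℂ) : ℂ :=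
  Classical.epsilon fun c =>
    ∃ u p, (P.innerPart j s).Solves z (innerValue j f) u p ∧ c = p j s

/-- The two-sided map `M₁ + M₂`, where a linear map `ℂ → ℂ` is identified with its value at `1`. -/
noncomputable def twoSidedMap (P : StarData ι) (j : ι) (s : ℝ) (z : ℂ) : ℂ :=
  P.M₁ j s z 1 + P.M₂ j s z 1

end StarData

end QuantumStar

namespace QuantumStar

open MeasureTheory Set Filter Topology

set_option linter.unusedSectionVars false

/-! ### Calculus of absolutely continuous functions -/

section AbsolutelyContinuous

/-! The formula is the sum over real `μ ≤ Λ` of a local identity: the dimension of the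
`μ`-eigenspace on `Ω` equals the sum of those on `Ω₁` and `Ω₂` plus the order of `M₁ + M₂` at `μ`
(`finrank_ker_boundaryMap_eq`).

Everything is reduced to finite-dimensional linear algebra. A solution is determined by its initial
data at the left ends, and its boundary trace is a linear function `boundaryMap z` of these data,
entire in `z`. Eigenspaces are isomorphic to kernels of `boundaryMap`. By Cramer's rule each
one-sided map agrees, off the eigenvalues, with a quotient of entire functions (`weylFunction`), the
value of the conjugate boundary datum on the solution with unit Dirichlet datum at `s`.

Green's formula gives `Im Mₖ(z) = -Im z ‖u‖²` for this solution `u`. Hence `M₁ + M₂` has no zero off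
the real axis, and its order at a real point is -1, 0 or 1. At a real `μ` each part falls under one
of two cases (`exists_ne`). Either the problem with unit datum at `s` is solvable, and `Mₖ(μ + iy)`
tends to the real conjugate datum of that solution; or there is an eigenfunction with nonzero
derivative at `s`, and `-Im Mₖ(μ + iy) ≥ c / y`, which forces a pole. Both imaginary parts have the
same sign, so two poles cannot cancel.

On the side of dimensions, let `W` be the space of solutions on `Ω₂` satisfying all conditions but
the one at `s`, and let `K ⊆ W` be given by zero value and zero derivative at `s`. Then `dim W = dim
K + 1`. An eigenfunction on `Ω` is an element of `W` whose data at `s` continue to a solution on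
`Ω₁` satisfying the condition at the outer end, so the eigenspace is `W` or `K`. Comparing the
resulting four cases proves the local identity.

Finiteness comes from an energy estimate, which bounds the eigenvalues below, and from the
determinant of `boundaryMap z`, which is entire and nonzero at `i`. -/

/-- Increments of the primitive of `p` are dominated by increments of the primitive of `‖p‖`, so the
real-valued case suffices. -/
theorem absolutelyContinuousOnInterval_primitive {a b : ℝ} {p : ℝ → ℂ}
    (hp : IntervalIntegrable p volume a b) :
    AbsolutelyContinuousOnInterval (fun x => ∫ t in a..x, p t) a b := by
  have hG := hp.norm.absolutelyContinuousOnInterval_intervalIntegral (left_mem_uIcc (b := b))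
  unfold AbsolutelyContinuousOnInterval at hG ⊢
  refine squeeze_zero' (Eventually.of_forall fun _ => Finset.sum_nonneg fun i _ => dist_nonneg)
    ?_ hG
  rw [eventually_inf_principal]
  filter_upwards with E hE
  refine Finset.sum_le_sum fun i hi => ?_
  obtain ⟨h1, h2⟩ := hE.1 i hi
  have i1 := hp.mono_set (uIcc_subset_uIcc left_mem_uIcc h1)
  have i2 := hp.mono_set (uIcc_subset_uIcc left_mem_uIcc h2)
  rw [dist_eq_norm, dist_eq_norm, intervalIntegral.integral_interval_sub_left i1 i2,
    intervalIntegral.integral_interval_sub_left i1.norm i2.norm]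
  exact intervalIntegral.norm_integral_le_abs_integral_norm

variable {a b : ℝ} {u p v q : ℝ → ℂ}

theorem HasACDeriv.continuousOn (h : HasACDeriv a b u p) : ContinuousOn u (Icc a b) := by
  rcases le_or_gt a b with hab | hab
  · have := intervalIntegral.continuousOn_primitive_interval' h.1 left_mem_uIcc
    rw [uIcc_of_le hab] at this
    exact (continuousOn_const.add this).congr h.2
  · rw [Icc_eq_empty (not_le.mpr hab)]
    exact continuousOn_empty _

theorem HasACDeriv.congr_deriv (hab : a ≤ b) (h : HasACDeriv a b u p)
    (hq : q =ᵐ[volume.restrict (Ioc a b)] p) : HasACDeriv a b u q := by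
  have hq' : q =ᵐ[volume.restrict (uIoc a b)] p := by rwa [uIoc_of_le hab]
  refine ⟨h.1.congr_ae hq'.symm, fun x hx => ?_⟩
  rw [h.2 x hx]
  congr 1
  refine intervalIntegral.integral_congr_ae_restrict ?_
  rw [uIoc_of_le hx.1]
  exact ae_restrict_of_ae_restrict_of_subset (Ioc_subset_Ioc_right hx.2) hq.symm

theorem HasACDeriv.mono {c d : ℝ} (h : HasACDeriv a b u p) (hc : a ≤ c) (hd : d ≤ b)
    (hcd : c ≤ d) : HasACDeriv c d u p := by
  have hab : a ≤ b := hc.trans (hcd.trans hd)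
  have hs : uIcc c d ⊆ uIcc a b := by
    rw [uIcc_of_le hab, uIcc_of_le hcd]
    exact Icc_subset_Icc hc hd
  refine ⟨h.1.mono_set hs, fun x hx => ?_⟩
  have hx' : x ∈ Icc a b := ⟨hc.trans hx.1, hx.2.trans hd⟩
  have hc' : c ∈ Icc a b := ⟨hc, hcd.trans hd⟩
  have i1 := h.1.mono_set (uIcc_subset_uIcc left_mem_uIcc (Icc_subset_uIcc hx'))
  have i2 := h.1.mono_set (uIcc_subset_uIcc left_mem_uIcc (Icc_subset_uIcc hc'))
  rw [h.2 x hx', h.2 c hc', ← intervalIntegral.integral_interval_sub_left i1 i2]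
  ring

theorem HasACDeriv.sub (h : HasACDeriv a b u p) (k : HasACDeriv a b v q) :
    HasACDeriv a b (u - v) (p - q) := by
  have := h.add (k.smul (-1))
  simpa [sub_eq_add_neg] using this

theorem HasACDeriv.star (h : HasACDeriv a b u p) :
    HasACDeriv a b (fun x => starRingEnd ℂ (u x)) (fun x => starRingEnd ℂ (p x)) := by
  refine ⟨?_, fun x hx => ?_⟩
  · have := h.1
    rw [intervalIntegrable_iff] at this ⊢
    exact Complex.conjLIE.toContinuousLinearEquiv.toContinuousLinearMap.integrable_comp this
  · simp only []
    rw [h.2 x hx, map_add]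
    congr 1
    simp only [intervalIntegral, map_sub, integral_conj]

/-- The product minus the primitive of the expected derivative is absolutely continuous with
derivative zero almost everywhere, hence constant. -/
theorem HasACDeriv.mul (hab : a ≤ b) (h : HasACDeriv a b u p) (k : HasACDeriv a b v q) :
    HasACDeriv a b (fun x => u x * v x) (fun x => p x * v x + u x * q x) := by
  have hu := h.continuousOn
  have hv := k.continuousOn
  rw [← uIcc_of_le hab] at hu hv
  have hi : IntervalIntegrable (fun x => p x * v x + u x * q x) volume a b :=
    (h.1.mul_continuousOn hv).add (k.1.continuousOn_mul hu)
  refine ⟨hi, fun x hx => ?_⟩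
  -- `u` and `v` are arbitrary outside `[a, b]`, so two-sided derivatives are taken of the
  -- primitives that agree with them on `[a, b]`.
  set U : ℝ → ℂ := fun x => u a + ∫ t in a..x, p t
  set W : ℝ → ℂ := fun x => v a + ∫ t in a..x, q t
  have acConst : ∀ c : ℂ, AbsolutelyContinuousOnInterval (fun _ : ℝ => c) a b := fun c => by
    unfold AbsolutelyContinuousOnInterval
    simpa using tendsto_const_nhds
  have acU : AbsolutelyContinuousOnInterval U a b :=
    (acConst _).add (absolutelyContinuousOnInterval_primitive h.1)
  have acW : AbsolutelyContinuousOnInterval W a b :=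
    (acConst _).add (absolutelyContinuousOnInterval_primitive k.1)
  have acF := (acU.fun_smul acW).sub (absolutelyContinuousOnInterval_primitive hi)
  have hae : ∀ᵐ x, x ∈ uIcc a b → HasDerivAt ((fun x => U x • W x) -
      fun x => ∫ t in a..x, (p t * v t + u t * q t)) 0 x := by
    filter_upwards [h.1.ae_hasDerivAt_integral, k.1.ae_hasDerivAt_integral,
      hi.ae_hasDerivAt_integral] with x h1 h2 h3 hx
    have d1 : HasDerivAt U (p x) x := (h1 hx a left_mem_uIcc).const_add _
    have d2 : HasDerivAt W (q x) x := (h2 hx a left_mem_uIcc).const_add _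
    have d3 := h3 hx a left_mem_uIcc
    rw [uIcc_of_le hab] at hx
    have eU : U x = u x := (h.2 x hx).symm
    have eW : W x = v x := (k.2 x hx).symm
    have := (d1.mul d2).sub d3
    rw [eU, eW, sub_self] at this
    exact this
  obtain ⟨C, hC⟩ := acF.const_of_ae_hasDerivAt_zero hae
  have e1 := hC x (by rwa [uIcc_of_le hab])
  have e2 := hC a left_mem_uIcc
  have eU : U x = u x := (h.2 x hx).symm
  have eW : W x = v x := (k.2 x hx).symm
  simp only [Pi.sub_apply, smul_eq_mul, eU, eW] at e1
  simp only [U, W, Pi.sub_apply, smul_eq_mul, intervalIntegral.integral_same, add_zero,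
    sub_zero] at e2
  simp only []
  rw [e2, ← e1]
  ring

theorem HasACDeriv.pow_succ (hab : a ≤ b) (h : HasACDeriv a b u p) (n : ℕ) :
    HasACDeriv a b (fun x => u x ^ (n + 1)) (fun x => (n + 1 : ℂ) * (p x * u x ^ n)) := by
  induction n with
  | zero => simpa using h
  | succ n ih =>
    have := h.mul hab ih
    convert this using 2 with x
    · ring
    · push_cast
      ring

theorem HasACDeriv.integral_eq_sub (hab : a ≤ b) (h : HasACDeriv a b u p) :
    ∫ t in a..b, p t = u b - u a := by
  rw [h.2 b (right_mem_Icc.2 hab)]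
  ring

/-- This is the source of the factorial in the bound for the iterated integral operator. -/
theorem integral_mul_primitive_pow {μ : ℝ → ℝ} (hab : a ≤ b)
    (hμ : IntervalIntegrable μ volume a b) (n : ℕ) :
    ∫ t in a..b, μ t * (∫ r in a..t, μ r) ^ n = (∫ r in a..b, μ r) ^ (n + 1) / (n + 1) := by
  have h : HasACDeriv a b (fun x => ((∫ r in a..x, μ r : ℝ) : ℂ)) (fun t => (μ t : ℂ)) := by
    refine ⟨⟨hμ.1.ofReal, hμ.2.ofReal⟩, fun x hx => ?_⟩
    simp [intervalIntegral.integral_ofReal]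
  have h2 := (h.pow_succ hab n).integral_eq_sub hab
  rw [intervalIntegral.integral_const_mul] at h2
  simp only [intervalIntegral.integral_same] at h2
  have h3 : ((n : ℂ) + 1) ≠ 0 := by exact_mod_cast n.succ_ne_zero
  have h4 : ∫ t in a..b, ((μ t * (∫ r in a..t, μ r) ^ n : ℝ) : ℂ) =
      (((∫ r in a..b, μ r) ^ (n + 1) / (n + 1) : ℝ) : ℂ) := by
    push_cast
    rw [eq_div_iff h3, mul_comm, h2]
    simp
  rw [intervalIntegral.integral_ofReal] at h4
  exact_mod_cast h4

end AbsolutelyContinuous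

/-! ### The initial value problem with an integrable potential -/

/-- `1 - T ^ n` is the product of `1 - T` with a geometric sum that commutes with it. It is
therefore enough that some power of `T` is a contraction. -/
theorem isUnit_one_sub_of_isUnit_one_sub_pow {R : Type*} [Ring R] {T : R} {n : ℕ}
    (h : IsUnit (1 - T ^ n)) : IsUnit (1 - T) := by
  rw [← mul_neg_geom_sum T n] at h
  refine ((Commute.isUnit_mul_iff ?_).1 h).1
  exact (Commute.one_left _).sub_left
    (Commute.sum_right _ _ _ fun i _ => (Commute.refl T).pow_right i)

theorem differentiable_inverse_affine {F : Type*} [NormedAddCommGroup F] [NormedSpace ℂ F]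
    [CompleteSpace F] {T : ℂ → F →L[ℂ] F} (A B : F →L[ℂ] F) (hT : ∀ z, T z = A + z • B)
    (hu : ∀ z, IsUnit (1 - T z)) (y : F) : Differentiable ℂ fun z => Ring.inverse (1 - T z) y := by
  intro z
  have hd : DifferentiableAt ℂ (fun z => 1 - T z) z := by
    simp only [hT]
    fun_prop
  exact ((differentiableAt_inverse (𝕜 := ℂ) (hu z)).comp z hd).clm_apply (differentiableAt_const _)

section InitialValue

variable {a b : ℝ}

theorem intervalIntegrable_mul_extend (hab : a ≤ b) {g : ℝ → ℂ}
    (hg : IntervalIntegrable g volume a b) (f : C(Icc a b, ℂ)) :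
    IntervalIntegrable (fun t => g t * f (projIcc a b hab t)) volume a b :=
  hg.mul_continuousOn (f.continuous.comp continuous_projIcc).continuousOn

theorem continuous_integral_mul (hab : a ≤ b) {g : ℝ → ℂ}
    (hg : IntervalIntegrable g volume a b) (f : C(Icc a b, ℂ)) :
    Continuous fun x : Icc a b => ∫ t in a..(x : ℝ), g t * f (projIcc a b hab t) := by
  have := intervalIntegral.continuousOn_primitive_interval'
    (intervalIntegrable_mul_extend hab hg f) left_mem_uIcc
  rw [uIcc_of_le hab] at this
  exact continuousOn_iff_continuous_domRestrict.1 this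

/-- The Volterra operator `f ↦ ∫ₐˣ g f` on continuous functions. -/
noncomputable def volterra (hab : a ≤ b) (g : ℝ → ℂ) (hg : IntervalIntegrable g volume a b) :
    C(Icc a b, ℂ) →L[ℂ] C(Icc a b, ℂ) :=
  LinearMap.mkContinuous
    { toFun := fun f => ⟨fun x => ∫ t in a..x, g t * f (projIcc a b hab t),
        continuous_integral_mul hab hg f⟩
      map_add' := fun f f' => by
        ext x
        have hs : uIcc a (x : ℝ) ⊆ uIcc a b :=
          uIcc_subset_uIcc left_mem_uIcc (Icc_subset_uIcc x.2)
        simp only [ContinuousMap.add_apply, ContinuousMap.coe_mk, mul_add]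
        exact intervalIntegral.integral_add
          ((intervalIntegrable_mul_extend hab hg f).mono_set hs)
          ((intervalIntegrable_mul_extend hab hg f').mono_set hs)
      map_smul' := fun c f => by
        ext x
        simp only [ContinuousMap.smul_apply, ContinuousMap.coe_mk, smul_eq_mul, RingHom.id_apply]
        rw [← intervalIntegral.integral_const_mul]
        exact intervalIntegral.integral_congr fun t _ => by ring }
    (∫ t in a..b, ‖g t‖) fun f => by
      have h0 : 0 ≤ ∫ t in a..b, ‖g t‖ :=
        intervalIntegral.integral_nonneg hab fun _ _ => norm_nonneg _
      rw [ContinuousMap.norm_le _ (mul_nonneg h0 (norm_nonneg _))]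
      intro x
      have hs : uIcc a (x : ℝ) ⊆ uIcc a b :=
        uIcc_subset_uIcc left_mem_uIcc (Icc_subset_uIcc x.2)
      calc ‖∫ t in a..x, g t * f (projIcc a b hab t)‖
          ≤ ∫ t in a..x, ‖g t‖ * ‖f‖ := by
            refine intervalIntegral.norm_integral_le_of_norm_le x.2.1
              (Eventually.of_forall fun t _ => ?_) ((hg.mono_set hs).norm.mul_const _)
            rw [norm_mul]
            exact mul_le_mul_of_nonneg_left (f.norm_coe_le_norm _) (norm_nonneg _)
        _ ≤ ∫ t in a..b, ‖g t‖ * ‖f‖ := by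
            refine intervalIntegral.integral_mono_interval le_rfl x.2.1 x.2.2
              (Eventually.of_forall fun t => mul_nonneg (norm_nonneg _) (norm_nonneg _))
              (hg.norm.mul_const _)
        _ = _ := intervalIntegral.integral_mul_const _ _

theorem volterra_apply (hab : a ≤ b) (g : ℝ → ℂ) (hg : IntervalIntegrable g volume a b)
    (f : C(Icc a b, ℂ)) (x : Icc a b) :
    volterra hab g hg f x = ∫ t in a..x, g t * f (projIcc a b hab t) := rfl

/-- The integral operator of the first order system for `u'' = (W - z) u`. -/
noncomputable def systemOp (hab : a ≤ b) (W : ℝ → ℂ) (hW : IntervalIntegrable W volume a b)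
    (z : ℂ) : (C(Icc a b, ℂ) × C(Icc a b, ℂ)) →L[ℂ] (C(Icc a b, ℂ) × C(Icc a b, ℂ)) :=
  ((volterra hab (fun _ => 1) intervalIntegrable_const).comp
    (ContinuousLinearMap.snd ℂ _ _)).prod
  ((volterra hab W hW - z • volterra hab (fun _ => 1) intervalIntegrable_const).comp
    (ContinuousLinearMap.fst ℂ _ _))

theorem systemOp_fst (hab : a ≤ b) (W : ℝ → ℂ) (hW : IntervalIntegrable W volume a b)
    (z : ℂ) (Y : C(Icc a b, ℂ) × C(Icc a b, ℂ)) (x : Icc a b) :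
    (systemOp hab W hW z Y).1 x = ∫ t in a..x, Y.2 (projIcc a b hab t) := by
  simp [systemOp, volterra_apply]

theorem systemOp_snd (hab : a ≤ b) (W : ℝ → ℂ) (hW : IntervalIntegrable W volume a b)
    (z : ℂ) (Y : C(Icc a b, ℂ) × C(Icc a b, ℂ)) (x : Icc a b) :
    (systemOp hab W hW z Y).2 x = ∫ t in a..x, (W t - z) * Y.1 (projIcc a b hab t) := by
  have hs : uIcc a (x : ℝ) ⊆ uIcc a b :=
    uIcc_subset_uIcc left_mem_uIcc (Icc_subset_uIcc x.2)
  have i1 := (intervalIntegrable_mul_extend hab hW Y.1).mono_set hs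
  have i2 := (intervalIntegrable_mul_extend hab
    (intervalIntegrable_const (c := z)) Y.1).mono_set hs
  simp only [sub_mul]
  rw [intervalIntegral.integral_sub i1 i2, intervalIntegral.integral_const_mul]
  simp [systemOp, volterra_apply]

/-- The weight `1 + ‖W - z‖` dominates the coefficients `1` and `W - z` of both rows of the system,
so one bound serves both components and reproduces itself under integration. -/
theorem norm_systemOp_pow_apply_le (hab : a ≤ b) (W : ℝ → ℂ)
    (hW : IntervalIntegrable W volume a b) (z : ℂ) (Y : C(Icc a b, ℂ) × C(Icc a b, ℂ)) (n : ℕ)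
    (x : Icc a b) :
    ‖((systemOp hab W hW z ^ n) Y).1 x‖ ≤
        (∫ t in a..x, (1 + ‖W t - z‖)) ^ n / n.factorial * ‖Y‖ ∧
      ‖((systemOp hab W hW z ^ n) Y).2 x‖ ≤
        (∫ t in a..x, (1 + ‖W t - z‖)) ^ n / n.factorial * ‖Y‖ := by
  have hμ : IntervalIntegrable (fun t => 1 + ‖W t - z‖) volume a b :=
    intervalIntegrable_const.add (hW.sub intervalIntegrable_const).norm
  induction n generalizing x with
  | zero =>
    simp only [pow_zero, Nat.factorial_zero, Nat.cast_one, div_one, one_mul]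
    exact ⟨(Y.1.norm_coe_le_norm x).trans (norm_fst_le Y),
      (Y.2.norm_coe_le_norm x).trans (norm_snd_le Y)⟩
  | succ n ih =>
    have hx : uIcc a (x : ℝ) ⊆ uIcc a b :=
      uIcc_subset_uIcc left_mem_uIcc (Icc_subset_uIcc x.2)
    have hμx := hμ.mono_set hx
    have key : ∫ t in a..x, (1 + ‖W t - z‖) *
        ((∫ r in a..t, (1 + ‖W r - z‖)) ^ n / n.factorial * ‖Y‖) =
        (∫ t in a..x, (1 + ‖W t - z‖)) ^ (n + 1) / (n + 1).factorial * ‖Y‖ := by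
      have h := integral_mul_primitive_pow x.2.1 hμx n
      have e : ∀ t, (1 + ‖W t - z‖) *
          ((∫ r in a..t, (1 + ‖W r - z‖)) ^ n / n.factorial * ‖Y‖) =
          (1 + ‖W t - z‖) * (∫ r in a..t, (1 + ‖W r - z‖)) ^ n * (‖Y‖ / n.factorial) :=
        fun t => by ring
      simp only [e]
      rw [intervalIntegral.integral_mul_const, h, Nat.factorial_succ]
      push_cast
      field_simp
    have hint : IntervalIntegrable (fun t => (1 + ‖W t - z‖) *
        ((∫ r in a..t, (1 + ‖W r - z‖)) ^ n / n.factorial * ‖Y‖)) volume a x := by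
      refine hμx.mul_continuousOn ?_
      exact (((intervalIntegral.continuousOn_primitive_interval' hμx left_mem_uIcc).pow n).div_const
        _).mul continuousOn_const
    have hB : ∀ t ∈ Ioc a (x : ℝ),
        0 ≤ (∫ r in a..t, (1 + ‖W r - z‖)) ^ n / n.factorial * ‖Y‖ := fun t ht => by
      have : 0 ≤ ∫ r in a..t, (1 + ‖W r - z‖) :=
        intervalIntegral.integral_nonneg ht.1.le fun _ _ => by positivity
      positivity
    have hp : ∀ t ∈ Ioc a (x : ℝ), ((projIcc a b hab t : Icc a b) : ℝ) = t := fun t ht => by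
      rw [projIcc_of_mem hab ⟨ht.1.le, ht.2.trans x.2.2⟩]
    rw [pow_succ', mul_apply_eq_comp, systemOp_fst, systemOp_snd, ← key]
    refine ⟨intervalIntegral.norm_integral_le_of_norm_le x.2.1
      (Eventually.of_forall fun t ht => ?_) hint,
      intervalIntegral.norm_integral_le_of_norm_le x.2.1
      (Eventually.of_forall fun t ht => ?_) hint⟩
    · have h1 := (ih (projIcc a b hab t)).2
      rw [hp t ht] at h1
      refine h1.trans ?_
      nlinarith [hB t ht, norm_nonneg (W t - z), mul_nonneg (norm_nonneg (W t - z)) (hB t ht)]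
    · have h1 := (ih (projIcc a b hab t)).1
      rw [hp t ht] at h1
      rw [norm_mul]
      calc ‖W t - z‖ * _ ≤ ‖W t - z‖ * _ := mul_le_mul_of_nonneg_left h1 (norm_nonneg _)
        _ ≤ _ := mul_le_mul_of_nonneg_right (by linarith) (hB t ht)

theorem isUnit_one_sub_systemOp (hab : a ≤ b) (W : ℝ → ℂ)
    (hW : IntervalIntegrable W volume a b) (z : ℂ) : IsUnit (1 - systemOp hab W hW z) := by
  set T := systemOp hab W hW z
  set m := ∫ t in a..b, (1 + ‖W t - z‖)
  have hμ : IntervalIntegrable (fun t => 1 + ‖W t - z‖) volume a b :=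
    intervalIntegrable_const.add (hW.sub intervalIntegrable_const).norm
  have hm : 0 ≤ m := intervalIntegral.integral_nonneg hab fun _ _ => by positivity
  have hle : ∀ n, ‖T ^ n‖ ≤ m ^ n / n.factorial := fun n => by
    refine ContinuousLinearMap.opNorm_le_bound _ (by positivity) fun Y => ?_
    have hmono : ∀ x : Icc a b, (∫ t in a..x, (1 + ‖W t - z‖)) ^ n / n.factorial * ‖Y‖ ≤
        m ^ n / n.factorial * ‖Y‖ := fun x => by
      have h0 : 0 ≤ ∫ t in a..x, (1 + ‖W t - z‖) :=
        intervalIntegral.integral_nonneg x.2.1 fun _ _ => by positivity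
      have h1 : ∫ t in a..x, (1 + ‖W t - z‖) ≤ m :=
        intervalIntegral.integral_mono_interval le_rfl x.2.1 x.2.2
          (Eventually.of_forall fun t => by simp only [Pi.zero_apply]; positivity) hμ
      gcongr
    rw [Prod.norm_def, max_le_iff, ContinuousMap.norm_le _ (by positivity),
      ContinuousMap.norm_le _ (by positivity)]
    exact ⟨fun x => (norm_systemOp_pow_apply_le hab W hW z Y n x).1.trans (hmono x),
      fun x => (norm_systemOp_pow_apply_le hab W hW z Y n x).2.trans (hmono x)⟩
  -- No smallness of `m` is needed: `m ^ n / n!` tends to zero, so some power of `T` has norm below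
  -- one.
  obtain ⟨n, hn⟩ :=
    ((FloorSemiring.tendsto_pow_div_factorial_atTop m).eventually_lt_const one_pos).exists
  have hu : IsUnit (1 - T ^ n) := isUnit_one_sub_of_norm_lt_one
    (R := (C(Icc a b, ℂ) × C(Icc a b, ℂ)) →L[ℂ] (C(Icc a b, ℂ) × C(Icc a b, ℂ))) ((hle n).trans_lt hn)
  exact isUnit_one_sub_of_isUnit_one_sub_pow
    (R := (C(Icc a b, ℂ) × C(Icc a b, ℂ)) →L[ℂ] (C(Icc a b, ℂ) × C(Icc a b, ℂ))) hu

/-- The pair `(u, u')` is the fixed point `(1 - T_z)⁻¹ Y₀` of the integral equation. Since `T_z` is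
affine in `z` and inversion is analytic on units, it is entire in `z`, as are its point values. -/
theorem exists_entire_solution (hab : a ≤ b) {W : ℝ → ℂ} (hW : IntervalIntegrable W volume a b)
    (c d : ℂ) : ∃ u p : ℂ → ℝ → ℂ,
      (∀ z, HasACDeriv a b (u z) (p z) ∧ HasACDeriv a b (p z) (fun t => (W t - z) * u z t) ∧
        u z a = c ∧ p z a = d) ∧
      ∀ x ∈ Icc a b, Differentiable ℂ (fun z => u z x) ∧ Differentiable ℂ (fun z => p z x) := by
  set Y₀ : C(Icc a b, ℂ) × C(Icc a b, ℂ) := (ContinuousMap.const _ c, ContinuousMap.const _ d)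
  set Y : ℂ → C(Icc a b, ℂ) × C(Icc a b, ℂ) := fun z =>
    Ring.inverse (1 - systemOp hab W hW z) Y₀
  have hY : ∀ z, Y z = Y₀ + systemOp hab W hW z (Y z) := fun z => by
    have h := Ring.mul_inverse_cancel _ (isUnit_one_sub_systemOp hab W hW z)
    have h2 := congrArg (fun S => S Y₀) h
    simp only [mul_apply_eq_comp, sub_apply,
      one_apply_eq_self] at h2
    exact eq_add_of_sub_eq h2
  have hproj : ∀ x ∈ Icc a b, ((projIcc a b hab x : Icc a b) : ℝ) = x := fun x hx => by
    rw [projIcc_of_mem hab hx]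
  have hY1 : ∀ z, ∀ x ∈ Icc a b, (Y z).1 (projIcc a b hab x) =
      c + ∫ t in a..x, (Y z).2 (projIcc a b hab t) := fun z x hx => by
    conv_lhs => rw [hY z]
    rw [Prod.fst_add, ContinuousMap.add_apply, systemOp_fst, hproj x hx]
    rfl
  have hY2 : ∀ z, ∀ x ∈ Icc a b, (Y z).2 (projIcc a b hab x) =
      d + ∫ t in a..x, (W t - z) * (Y z).1 (projIcc a b hab t) := fun z x hx => by
    conv_lhs => rw [hY z]
    rw [Prod.snd_add, ContinuousMap.add_apply, systemOp_snd, hproj x hx]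
    rfl
  have ha := left_mem_Icc.2 hab
  refine ⟨fun z x => (Y z).1 (projIcc a b hab x), fun z x => (Y z).2 (projIcc a b hab x),
    fun z => ⟨⟨?_, fun x hx => ?_⟩, ⟨?_, fun x hx => ?_⟩, ?_, ?_⟩, fun x hx => ?_⟩
  · exact ((Y z).2.continuous.comp continuous_projIcc).intervalIntegrable _ _
  · simp only []
    rw [hY1 z x hx, hY1 z a ha]
    simp
  · exact intervalIntegrable_mul_extend hab (hW.sub intervalIntegrable_const) _
  · simp only []
    rw [hY2 z x hx, hY2 z a ha]
    simp
  · simp only []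
    rw [hY1 z a ha]
    simp
  · simp only []
    rw [hY2 z a ha]
    simp
  · have hYd : Differentiable ℂ Y := by
      -- The coefficient of `z` in the operator is `(u, p) ↦ (0, -∫ u)`.
      refine differentiable_inverse_affine (systemOp hab W hW 0)
        ((0 : (C(Icc a b, ℂ) × C(Icc a b, ℂ)) →L[ℂ] C(Icc a b, ℂ)).prod
          ((-volterra hab (fun _ => 1) intervalIntegrable_const).comp
            (ContinuousLinearMap.fst ℂ _ _)))
        (fun z => ContinuousLinearMap.ext fun Y => Prod.ext ?_ ?_)
        (isUnit_one_sub_systemOp hab W hW) Y₀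
      · simp only [systemOp, ContinuousLinearMap.prod_apply, add_apply,
          smul_apply, Prod.fst_add, Prod.smul_fst]
        exact (add_eq_left.2 (smul_zero z)).symm
      · simp [systemOp, sub_eq_add_neg]
    have hev : ∀ y : Icc a b, Differentiable ℂ (fun f : C(Icc a b, ℂ) => f y) := fun y =>
      ContinuousLinearMap.differentiable
        (ContinuousMap.evalCLM ℂ y : C(Icc a b, ℂ) →L[ℂ] ℂ)
    exact ⟨(hev _).comp hYd.fst, (hev _).comp hYd.snd⟩

/-- With zero initial data `(u, p)` is fixed by `systemOp`, while `1 - systemOp` is invertible. -/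
theorem solution_eq_zero (hab : a ≤ b) {W : ℝ → ℂ} (hW : IntervalIntegrable W volume a b)
    {z : ℂ} {u p : ℝ → ℂ} (hu : HasACDeriv a b u p)
    (hp : HasACDeriv a b p (fun t => (W t - z) * u t)) (hua : u a = 0) (hpa : p a = 0) :
    ∀ x ∈ Icc a b, u x = 0 ∧ p x = 0 := by
  set Y : C(Icc a b, ℂ) × C(Icc a b, ℂ) :=
    (⟨_, continuousOn_iff_continuous_domRestrict.1 hu.continuousOn⟩,
      ⟨_, continuousOn_iff_continuous_domRestrict.1 hp.continuousOn⟩)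
  have hproj : ∀ x ∈ Icc a b, ((projIcc a b hab x : Icc a b) : ℝ) = x := fun x hx => by
    rw [projIcc_of_mem hab hx]
  have hmem : ∀ x : Icc a b, ∀ t ∈ uIcc a (x : ℝ), t ∈ Icc a b := fun x t ht => by
    rw [uIcc_of_le x.2.1] at ht
    exact ⟨ht.1, ht.2.trans x.2.2⟩
  have hY : systemOp hab W hW z Y = Y := by
    refine Prod.ext (ContinuousMap.ext fun x => ?_) (ContinuousMap.ext fun x => ?_)
    · rw [systemOp_fst]
      have : Y.1 x = u x := rfl
      rw [this, hu.2 x x.2, hua, zero_add]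
      refine intervalIntegral.integral_congr fun t ht => ?_
      have : Y.2 (projIcc a b hab t) = p (projIcc a b hab t : Icc a b) := rfl
      rw [this, hproj t (hmem x t ht)]
    · rw [systemOp_snd]
      have : Y.2 x = p x := rfl
      rw [this, hp.2 x x.2, hpa, zero_add]
      refine intervalIntegral.integral_congr fun t ht => ?_
      have : Y.1 (projIcc a b hab t) = u (projIcc a b hab t : Icc a b) := rfl
      rw [this, hproj t (hmem x t ht)]
  have hz : Y = 0 := by
    have h := Ring.inverse_mul_cancel _ (isUnit_one_sub_systemOp hab W hW z)
    have h2 := congrArg (fun S => S Y) h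
    simp only [mul_apply_eq_comp, sub_apply,
      one_apply_eq_self, hY, sub_self, map_zero] at h2
    exact h2.symm
  intro x hx
  have h1 : Y.1 ⟨x, hx⟩ = u x := rfl
  have h2 : Y.2 ⟨x, hx⟩ = p x := rfl
  rw [← h1, ← h2, hz]
  exact ⟨rfl, rfl⟩

end InitialValue

/-! ### Solutions on a star graph and eigenspaces -/

theorem mem_eigenspace_iff_mem_graph {E : Type*} [NormedAddCommGroup E] [NormedSpace ℂ E]
    (T : E →ₗ.[ℂ] E) (z : ℂ) (x : E) : x ∈ eigenspace T z ↔ (x, z • x) ∈ T.graph := by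
  rw [LinearPMap.mem_graph_iff]
  constructor
  · rintro ⟨h, e⟩
    exact ⟨⟨x, h⟩, rfl, e⟩
  · rintro ⟨⟨y, h⟩, rfl, e⟩
    exact ⟨h, e⟩

theorem eigenspace_eq_bot_of_mem_resolventSet {E : Type*} [NormedAddCommGroup E]
    [NormedSpace ℂ E] {T : E →ₗ.[ℂ] E} {z : ℂ} (hz : z ∈ resolventSet T) :
    eigenspace T z = ⊥ := by
  obtain ⟨R, -, hR⟩ := hz
  rw [eq_bot_iff]
  rintro x ⟨h, e⟩
  have := hR ⟨x, h⟩
  rw [e, sub_self, map_zero] at this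
  exact this.symm

theorem memLp_two_of_continuousOn {a b : ℝ} {u : ℝ → ℂ} (hu : ContinuousOn u (Icc a b)) :
    MemLp u 2 (volume.restrict (Ioc a b)) := by
  obtain ⟨C, hC⟩ := isCompact_Icc.exists_bound_of_continuousOn hu
  refine MemLp.of_bound ((hu.mono Ioc_subset_Icc_self).aestronglyMeasurable measurableSet_Ioc) C ?_
  rw [ae_restrict_iff' measurableSet_Ioc]
  exact Eventually.of_forall fun x hx => hC x (Ioc_subset_Icc_self hx)

theorem eqOn_Icc_zero_of_ae_eq {a b : ℝ} (hab : a < b) {u : ℝ → ℂ} (hu : ContinuousOn u (Icc a b))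
    (h : u =ᵐ[volume.restrict (Ioc a b)] 0) : EqOn u 0 (Icc a b) := by
  rw [Measure.restrict_congr_set Ioc_ae_eq_Icc] at h
  exact Measure.eqOn_Icc_of_ae_eq volume hab.ne h hu continuousOn_const

/-- A pair of matrices whose boundary conditions `A₁ u + A₂ u' = 0` are of self-adjoint type. -/
structure IsLagrangian {ι : Type*} [Fintype ι] (A₁ A₂ : Matrix ι ι ℂ) : Prop where
  symm : A₁ * A₂.conjTranspose = A₂ * A₁.conjTranspose
  inj : ∀ y, A₁.conjTranspose.mulVec y = 0 → A₂.conjTranspose.mulVec y = 0 → y = 0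

namespace StarData

variable {ι : Type*} [Fintype ι]

/-- Nondegenerate edges, integrable potentials and boundary conditions of self-adjoint type. -/
structure Regular (P : StarData ι) : Prop where
  lt : ∀ i, P.left i < P.right i
  integrable : ∀ i, IntervalIntegrable (P.V i) volume (P.left i) (P.right i)
  lagrangian_α : IsLagrangian P.α₁ P.α₂
  lagrangian_β : IsLagrangian P.β₁ P.β₂

/-- Fundamental solutions of `-u'' + V u = z u` on every edge, entire in `z`. -/
structure FundamentalSystem (P : StarData ι) where
  c : ι → ℂ → ℝ → ℂ
  dc : ι → ℂ → ℝ → ℂ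
  s : ι → ℂ → ℝ → ℂ
  ds : ι → ℂ → ℝ → ℂ
  c_ac : ∀ i z, HasACDeriv (P.left i) (P.right i) (c i z) (dc i z)
  dc_ac : ∀ i z, HasACDeriv (P.left i) (P.right i) (dc i z) fun t => ((P.V i t : ℂ) - z) * c i z t
  s_ac : ∀ i z, HasACDeriv (P.left i) (P.right i) (s i z) (ds i z)
  ds_ac : ∀ i z, HasACDeriv (P.left i) (P.right i) (ds i z) fun t => ((P.V i t : ℂ) - z) * s i z t
  c_left : ∀ i z, c i z (P.left i) = 1
  dc_left : ∀ i z, dc i z (P.left i) = 0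
  s_left : ∀ i z, s i z (P.left i) = 0
  ds_left : ∀ i z, ds i z (P.left i) = 1
  c_diff : ∀ i, ∀ x ∈ Icc (P.left i) (P.right i), Differentiable ℂ fun z => c i z x
  dc_diff : ∀ i, ∀ x ∈ Icc (P.left i) (P.right i), Differentiable ℂ fun z => dc i z x
  s_diff : ∀ i, ∀ x ∈ Icc (P.left i) (P.right i), Differentiable ℂ fun z => s i z x
  ds_diff : ∀ i, ∀ x ∈ Icc (P.left i) (P.right i), Differentiable ℂ fun z => ds i z x

theorem Regular.intervalIntegrable_ofReal {P : StarData ι} (hP : P.Regular) (i : ι) :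
    IntervalIntegrable (fun t => (P.V i t : ℂ)) volume (P.left i) (P.right i) :=
  ⟨(hP.integrable i).1.ofReal, (hP.integrable i).2.ofReal⟩

theorem Regular.nonempty_fundamentalSystem {P : StarData ι} (hP : P.Regular) :
    Nonempty P.FundamentalSystem := by
  have h := fun i (c d : ℂ) =>
    exists_entire_solution (hP.lt i).le (hP.intervalIntegrable_ofReal i) c d
  choose u p h1 h2 using h
  exact ⟨{
    c := fun i => u i 1 0
    dc := fun i => p i 1 0
    s := fun i => u i 0 1
    ds := fun i => p i 0 1
    c_ac := fun i z => (h1 i 1 0 z).1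
    dc_ac := fun i z => (h1 i 1 0 z).2.1
    s_ac := fun i z => (h1 i 0 1 z).1
    ds_ac := fun i z => (h1 i 0 1 z).2.1
    c_left := fun i z => (h1 i 1 0 z).2.2.1
    dc_left := fun i z => (h1 i 1 0 z).2.2.2
    s_left := fun i z => (h1 i 0 1 z).2.2.1
    ds_left := fun i z => (h1 i 0 1 z).2.2.2
    c_diff := fun i x hx => (h2 i 1 0 x hx).1
    dc_diff := fun i x hx => (h2 i 1 0 x hx).2
    s_diff := fun i x hx => (h2 i 0 1 x hx).1
    ds_diff := fun i x hx => (h2 i 0 1 x hx).2 }⟩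

namespace FundamentalSystem

variable {P : StarData ι} (F : P.FundamentalSystem)

/-- The solution with initial values `x (inl i)` and initial derivatives `x (inr i)`. -/
def sol (z : ℂ) (x : ι ⊕ ι → ℂ) : ι → ℝ → ℂ :=
  fun i t => x (Sum.inl i) * F.c i z t + x (Sum.inr i) * F.s i z t

/-- The derivative of the solution with initial data `x`. -/
def der (z : ℂ) (x : ι ⊕ ι → ℂ) : ι → ℝ → ℂ :=
  fun i t => x (Sum.inl i) * F.dc i z t + x (Sum.inr i) * F.ds i z t

theorem sol_add (z : ℂ) (x y : ι ⊕ ι → ℂ) : F.sol z (x + y) = F.sol z x + F.sol z y := by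
  funext i t
  simp only [sol, Pi.add_apply]
  ring

theorem der_add (z : ℂ) (x y : ι ⊕ ι → ℂ) : F.der z (x + y) = F.der z x + F.der z y := by
  funext i t
  simp only [der, Pi.add_apply]
  ring

theorem sol_smul (z a : ℂ) (x : ι ⊕ ι → ℂ) : F.sol z (a • x) = a • F.sol z x := by
  funext i t
  simp only [sol, Pi.smul_apply, smul_eq_mul]
  ring

theorem der_smul (z a : ℂ) (x : ι ⊕ ι → ℂ) : F.der z (a • x) = a • F.der z x := by
  funext i t
  simp only [der, Pi.smul_apply, smul_eq_mul]
  ring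

theorem sol_left (z : ℂ) (x : ι ⊕ ι → ℂ) (i : ι) : F.sol z x i (P.left i) = x (Sum.inl i) := by
  simp [sol, F.c_left, F.s_left]

theorem der_left (z : ℂ) (x : ι ⊕ ι → ℂ) (i : ι) : F.der z x i (P.left i) = x (Sum.inr i) := by
  simp [der, F.dc_left, F.ds_left]

theorem isTwiceDiff (z : ℂ) (x : ι ⊕ ι → ℂ) : P.IsTwiceDiff (F.sol z x) (F.der z x)
    (fun i t => ((P.V i t : ℂ) - z) * F.sol z x i t) := fun i => by
  refine ⟨((F.c_ac i z).smul (x (Sum.inl i))).add ((F.s_ac i z).smul (x (Sum.inr i))), ?_⟩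
  have := ((F.dc_ac i z).smul (x (Sum.inl i))).add ((F.ds_ac i z).smul (x (Sum.inr i)))
  have e : (fun t => ((P.V i t : ℂ) - z) * F.sol z x i t) =
      (x (Sum.inl i) • fun t => (↑(P.V i t) - z) * F.c i z t) +
        x (Sum.inr i) • fun t => (↑(P.V i t) - z) * F.s i z t := by
    funext t
    simp only [sol, Pi.add_apply, Pi.smul_apply, smul_eq_mul]
    ring
  simp only [e]
  exact this

theorem sol_diff (x : ι ⊕ ι → ℂ) (i : ι) {t : ℝ} (ht : t ∈ Icc (P.left i) (P.right i)) :
    Differentiable ℂ fun z => F.sol z x i t :=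
  ((F.c_diff i t ht).const_mul _).add ((F.s_diff i t ht).const_mul _)

theorem der_diff (x : ι ⊕ ι → ℂ) (i : ι) {t : ℝ} (ht : t ∈ Icc (P.left i) (P.right i)) :
    Differentiable ℂ fun z => F.der z x i t :=
  ((F.dc_diff i t ht).const_mul _).add ((F.ds_diff i t ht).const_mul _)

/-- The initial data of a function on the graph. -/
def initial (P : StarData ι) (u p : ι → ℝ → ℂ) : ι ⊕ ι → ℂ :=
  Sum.elim (fun i => u i (P.left i)) (fun i => p i (P.left i))

theorem eq_sol (hP : P.Regular) {z : ℂ} {u p : ι → ℝ → ℂ}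
    (h : P.IsTwiceDiff u p fun i t => ((P.V i t : ℂ) - z) * u i t) (i : ι) :
    ∀ t ∈ Icc (P.left i) (P.right i),
      u i t = F.sol z (initial P u p) i t ∧ p i t = F.der z (initial P u p) i t := by
  intro t ht
  have h1 := F.isTwiceDiff z (initial P u p) i
  have h2 : HasACDeriv (P.left i) (P.right i) (p i - F.der z (initial P u p) i)
      (fun t => ((P.V i t : ℂ) - z) * (u i - F.sol z (initial P u p) i) t) := by
    convert (h i).2.sub h1.2 using 1
    funext t
    simp only [Pi.sub_apply]
    ring
  have h3 := solution_eq_zero (hP.lt i).le (hP.intervalIntegrable_ofReal i)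
    ((h i).1.sub h1.1) h2 (by simp [sol_left, initial]) (by simp [der_left, initial]) t ht
  exact ⟨sub_eq_zero.1 h3.1, sub_eq_zero.1 h3.2⟩

theorem trace_eq_of_isTwiceDiff (hP : P.Regular) {z : ℂ} {u p : ι → ℝ → ℂ}
    (h : P.IsTwiceDiff u p fun i t => ((P.V i t : ℂ) - z) * u i t) :
    P.trace u p = P.trace (F.sol z (initial P u p)) (F.der z (initial P u p)) := by
  have hl := fun i => F.eq_sol hP h i _ (left_mem_Icc.2 (hP.lt i).le)
  have hr := fun i => F.eq_sol hP h i _ (right_mem_Icc.2 (hP.lt i).le)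
  simp only [trace, fun i => (hl i).1, fun i => (hl i).2, fun i => (hr i).1, fun i => (hr i).2]

/-- The map from initial data to the boundary trace of the solution. -/
def boundaryMap (z : ℂ) : (ι ⊕ ι → ℂ) →ₗ[ℂ] (ι ⊕ ι → ℂ) where
  toFun x := P.trace (F.sol z x) (F.der z x)
  map_add' x y := by rw [sol_add, der_add, trace_add]
  map_smul' a x := by rw [sol_smul, der_smul, trace_smul, RingHom.id_apply]

theorem boundaryMap_apply (z : ℂ) (x : ι ⊕ ι → ℂ) :
    F.boundaryMap z x = P.trace (F.sol z x) (F.der z x) := rfl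

theorem solves_sol (z : ℂ) (x : ι ⊕ ι → ℂ) :
    P.Solves z (F.boundaryMap z x) (F.sol z x) (F.der z x) := ⟨F.isTwiceDiff z x, rfl⟩

theorem boundaryMap_initial (hP : P.Regular) {z : ℂ} {w : ι ⊕ ι → ℂ} {u p : ι → ℝ → ℂ}
    (h : P.Solves z w u p) : F.boundaryMap z (initial P u p) = w := by
  rw [boundaryMap_apply, ← F.trace_eq_of_isTwiceDiff hP h.1, h.2]

theorem uniquelySolvable (hP : P.Regular) {z : ℂ} (hz : LinearMap.ker (F.boundaryMap z) = ⊥)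
    (w : ι ⊕ ι → ℂ) : P.UniquelySolvable z w := by
  obtain ⟨x, hx⟩ := LinearMap.surjective_of_injective (LinearMap.ker_eq_bot.1 hz) w
  refine ⟨F.sol z x, F.der z x, hx ▸ F.solves_sol z x, fun u p h i => ?_⟩
  have : initial P u p = x :=
    LinearMap.ker_eq_bot.1 hz ((F.boundaryMap_initial hP h).trans hx.symm)
  have h1 := F.eq_sol hP h.1 i
  rw [this] at h1
  exact ⟨fun t ht => (h1 t ht).1, fun t ht => (h1 t ht).2⟩

end FundamentalSystem

theorem mem_eigenspace_operator_iff {P : StarData ι} (hP : P.Regular) (z : ℂ) (f : P.L2) :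
    f ∈ eigenspace P.operator z ↔ ∃ u p, P.Solves z 0 u p ∧
      ∀ i, (f i : ℝ → ℂ) =ᵐ[volume.restrict (Ioc (P.left i) (P.right i))] u i := by
  rw [mem_eigenspace_iff_mem_graph, operator_graph]
  constructor
  · rintro ⟨u, p, q, hd, ht, he⟩
    -- The eigenvalue equation determines the second derivative `q` only almost everywhere, so it is
    -- exchanged for `(V - z) u`.
    refine ⟨u, p, ⟨fun i => ⟨(hd i).1, (hd i).2.congr_deriv (hP.lt i).le ?_⟩, ht⟩,
      fun i => (he i).1⟩
    have hs : ((z • f : P.L2) i : ℝ → ℂ) =ᵐ[volume.restrict (Ioc (P.left i) (P.right i))]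
        z • (f i : ℝ → ℂ) := Lp.coeFn_smul z (f i)
    filter_upwards [(he i).1, (he i).2, hs] with t h1 h2 h3
    simp only [Pi.smul_apply, smul_eq_mul] at h1 h2 h3
    rw [h3, h1] at h2
    linear_combination -h2
  · rintro ⟨u, p, ⟨hd, ht⟩, he⟩
    refine ⟨u, p, _, hd, ht, fun i => ⟨he i, ?_⟩⟩
    have hs : ((z • f : P.L2) i : ℝ → ℂ) =ᵐ[volume.restrict (Ioc (P.left i) (P.right i))]
        z • (f i : ℝ → ℂ) := Lp.coeFn_smul z (f i)
    filter_upwards [he i, hs] with t h1 h3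
    simp only [Pi.smul_apply, smul_eq_mul] at h1 h3 ⊢
    rw [h3, h1]
    ring

namespace FundamentalSystem

variable {P : StarData ι} (F : P.FundamentalSystem)

theorem continuousOn_sol (z : ℂ) (x : ι ⊕ ι → ℂ) (i : ι) :
    ContinuousOn (F.sol z x i) (Icc (P.left i) (P.right i)) :=
  (F.isTwiceDiff z x i).1.continuousOn

/-- The class in `L²` of the solution with given initial data. -/
noncomputable def toL2 (z : ℂ) : (ι ⊕ ι → ℂ) →ₗ[ℂ] P.L2 where
  toFun x := WithLp.toLp 2 fun i =>
    (memLp_two_of_continuousOn (F.continuousOn_sol z x i)).toLp (F.sol z x i)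
  map_add' x y := by
    ext1 i
    simp only [sol_add]
    exact MemLp.toLp_add (memLp_two_of_continuousOn (F.continuousOn_sol z x i))
      (memLp_two_of_continuousOn (F.continuousOn_sol z y i))
  map_smul' a x := by
    ext1 i
    simp only [sol_smul]
    exact MemLp.toLp_const_smul a (memLp_two_of_continuousOn (F.continuousOn_sol z x i))

theorem toL2_ae_eq (z : ℂ) (x : ι ⊕ ι → ℂ) (i : ι) :
    (F.toL2 z x i : ℝ → ℂ) =ᵐ[volume.restrict (Ioc (P.left i) (P.right i))] F.sol z x i :=
  MemLp.coeFn_toLp (memLp_two_of_continuousOn (F.continuousOn_sol z x i))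

/-- A solution and its derivative are continuous. If the solution vanishes almost everywhere, both
vanish identically on each nondegenerate edge, and so do the initial data. -/
theorem toL2_injective (hP : P.Regular) (z : ℂ) : Function.Injective (F.toL2 z) := by
  rw [← LinearMap.ker_eq_bot, LinearMap.ker_eq_bot']
  intro x hx
  have h0 : ∀ i, EqOn (F.sol z x i) 0 (Icc (P.left i) (P.right i)) := fun i => by
    refine eqOn_Icc_zero_of_ae_eq (hP.lt i) (F.continuousOn_sol z x i) ?_
    have h1 := F.toL2_ae_eq z x i
    rw [hx] at h1
    exact h1.symm.trans (Lp.coeFn_zero _ _ _)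
  have h1 : ∀ i, EqOn (F.der z x i) 0 (Icc (P.left i) (P.right i)) := fun i => by
    refine eqOn_Icc_zero_of_ae_eq (hP.lt i) (F.isTwiceDiff z x i).2.continuousOn
      ((F.isTwiceDiff z x i).1.ae_eq_zero ?_)
    filter_upwards [ae_restrict_mem measurableSet_Ioc] with t ht
    exact h0 i (Ioc_subset_Icc_self ht)
  funext k
  rcases k with i | i
  · rw [← F.sol_left z x i]
    exact h0 i (left_mem_Icc.2 (hP.lt i).le)
  · rw [← F.der_left z x i]
    exact h1 i (left_mem_Icc.2 (hP.lt i).le)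

theorem map_toL2_ker_boundaryMap (hP : P.Regular) (z : ℂ) :
    (LinearMap.ker (F.boundaryMap z)).map (F.toL2 z) = eigenspace P.operator z := by
  ext f
  rw [mem_eigenspace_operator_iff hP, Submodule.mem_map]
  constructor
  · rintro ⟨x, hx, rfl⟩
    rw [LinearMap.mem_ker] at hx
    exact ⟨F.sol z x, F.der z x, hx ▸ F.solves_sol z x, F.toL2_ae_eq z x⟩
  · rintro ⟨u, p, h, he⟩
    refine ⟨initial P u p, F.boundaryMap_initial hP h, ?_⟩
    ext1 i
    refine Lp.ext ((F.toL2_ae_eq z _ i).trans ?_)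
    filter_upwards [he i, ae_restrict_mem measurableSet_Ioc] with t h1 ht
    rw [h1, (F.eq_sol hP h.1 i t (Ioc_subset_Icc_self ht)).1]

/-- Initial data with vanishing boundary trace are identified with eigenfunctions. -/
noncomputable def kerEquivEigenspace (hP : P.Regular) (z : ℂ) :
    LinearMap.ker (F.boundaryMap z) ≃ₗ[ℂ] eigenspace P.operator z :=
  (Submodule.equivMapOfInjective _ (F.toL2_injective hP z) _).trans
    (LinearEquiv.ofEq _ _ (F.map_toL2_ker_boundaryMap hP z))

theorem finrank_eigenspace (hP : P.Regular) (z : ℂ) :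
    Module.finrank ℂ (eigenspace P.operator z) =
      Module.finrank ℂ (LinearMap.ker (F.boundaryMap z)) :=
  (F.kerEquivEigenspace hP z).finrank_eq.symm

theorem eigenspace_eq_bot_iff (hP : P.Regular) (z : ℂ) :
    eigenspace P.operator z = ⊥ ↔ LinearMap.ker (F.boundaryMap z) = ⊥ := by
  rw [← F.map_toL2_ker_boundaryMap hP z, ← Submodule.map_bot (F.toL2 z)]
  exact (Submodule.map_injective_of_injective (F.toL2_injective hP z)).eq_iff

end FundamentalSystem

theorem Regular.finiteDimensional_eigenspace {P : StarData ι} (hP : P.Regular) (z : ℂ) :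
    FiniteDimensional ℂ (eigenspace P.operator z) := by
  obtain ⟨F⟩ := hP.nonempty_fundamentalSystem
  exact (F.kerEquivEigenspace hP z).finiteDimensional

end StarData

/-! ### Green's formula and self-adjoint boundary conditions -/

/-- The real potential cancels. Two spectral parameters are kept so that a solution at `λ + iy` can
be compared with one at `λ`. -/
theorem green_edge {a b : ℝ} (hab : a ≤ b) {V : ℝ → ℝ} {z w : ℂ} {u p v q : ℝ → ℂ}
    (hu : HasACDeriv a b u p) (hp : HasACDeriv a b p fun t => ((V t : ℂ) - z) * u t)
    (hv : HasACDeriv a b v q) (hq : HasACDeriv a b q fun t => ((V t : ℂ) - w) * v t) :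
    (p b * starRingEnd ℂ (v b) - u b * starRingEnd ℂ (q b)) -
      (p a * starRingEnd ℂ (v a) - u a * starRingEnd ℂ (q a)) =
      (starRingEnd ℂ w - z) * ∫ t in a..b, u t * starRingEnd ℂ (v t) := by
  have h := ((hp.mul hab hv.star).sub (hu.mul hab hq.star)).integral_eq_sub hab
  simp only [Pi.sub_apply] at h
  rw [← h, ← intervalIntegral.integral_const_mul]
  refine intervalIntegral.integral_congr fun t _ => ?_
  simp only [map_mul, map_sub, Complex.conj_ofReal]
  ring

theorem wronskian_eq {a b : ℝ} (hab : a ≤ b) {W : ℝ → ℂ} {u p v q : ℝ → ℂ}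
    (hu : HasACDeriv a b u p) (hp : HasACDeriv a b p fun t => W t * u t)
    (hv : HasACDeriv a b v q) (hq : HasACDeriv a b q fun t => W t * v t) :
    u b * q b - p b * v b = u a * q a - p a * v a := by
  have h := ((hu.mul hab hq).sub (hp.mul hab hv)).integral_eq_sub hab
  have h0 : ∀ t, ((fun x => p x * q x + u x * (W x * v x)) -
      fun x => W x * u x * v x + p x * q x) t = 0 := fun t => by
    simp only [Pi.sub_apply]
    ring
  simp only [h0, intervalIntegral.integral_zero, Pi.sub_apply] at h
  exact (sub_eq_zero.1 h.symm)

namespace IsLagrangian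

variable {ι : Type*} [Fintype ι] [DecidableEq ι] {A₁ A₂ : Matrix ι ι ℂ}

theorem mulVec_symm (h : IsLagrangian A₁ A₂) (y : ι → ℂ) :
    A₁.mulVec (A₂.conjTranspose.mulVec y) = A₂.mulVec (A₁.conjTranspose.mulVec y) := by
  rw [Matrix.mulVec_mulVec, Matrix.mulVec_mulVec, h.symm]

open scoped ComplexOrder in
-- The map `y ↦ (A₂ᴴ y, -A₁ᴴ y)` is injective with range inside the solution space of the boundary
-- condition, and the dimensions agree.
theorem exists_param (h : IsLagrangian A₁ A₂) {u p : ι → ℂ}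
    (hup : A₁.mulVec u + A₂.mulVec p = 0) :
    ∃ y, u = A₂.conjTranspose.mulVec y ∧ p = -A₁.conjTranspose.mulVec y := by
  set g : (ι → ℂ) × (ι → ℂ) →ₗ[ℂ] (ι → ℂ) := A₁.mulVecLin.coprod A₂.mulVecLin with hg
  set f : (ι → ℂ) →ₗ[ℂ] (ι → ℂ) × (ι → ℂ) :=
    A₂.conjTranspose.mulVecLin.prod (-A₁.conjTranspose.mulVecLin) with hf
  have hfi : Function.Injective f := by
    rw [← LinearMap.ker_eq_bot, LinearMap.ker_eq_bot']
    intro y hy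
    have h1 : A₂.conjTranspose.mulVec y = 0 := congrArg Prod.fst hy
    have h2 : -A₁.conjTranspose.mulVec y = 0 := congrArg Prod.snd hy
    exact h.inj y (neg_eq_zero.1 h2) h1
  have hle : LinearMap.range f ≤ LinearMap.ker g := by
    rintro _ ⟨y, rfl⟩
    change A₁.mulVec (A₂.conjTranspose.mulVec y) + A₂.mulVec (-A₁.conjTranspose.mulVec y) = 0
    rw [Matrix.mulVec_neg, h.mulVec_symm, add_neg_cancel]
  have hgs : Function.Surjective g := by
    -- `A₁ A₁ᴴ + A₂ A₂ᴴ` is positive definite: pairing with `y` gives the sum of the squared lengths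
    -- of `A₁ᴴ y` and `A₂ᴴ y`.
    have hG : Function.Injective (g ∘ₗ
        (A₁.conjTranspose.mulVecLin.prod A₂.conjTranspose.mulVecLin)) := by
      rw [← LinearMap.ker_eq_bot, LinearMap.ker_eq_bot']
      intro y hy
      replace hy : A₁.mulVec (A₁.conjTranspose.mulVec y) +
        A₂.mulVec (A₂.conjTranspose.mulVec y) = 0 := hy
      have e : ∀ A : Matrix ι ι ℂ, star y ⬝ᵥ A.mulVec (A.conjTranspose.mulVec y) =
          star (A.conjTranspose.mulVec y) ⬝ᵥ A.conjTranspose.mulVec y := fun A => by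
        rw [Matrix.dotProduct_mulVec, Matrix.star_mulVec, Matrix.conjTranspose_conjTranspose]
      have h1 := congrArg (fun w => star y ⬝ᵥ w) hy
      simp only [dotProduct_add, e, dotProduct_zero] at h1
      have h2 := (add_eq_zero_iff_of_nonneg (dotProduct_star_self_nonneg _)
        (dotProduct_star_self_nonneg _)).1 h1
      exact h.inj y (dotProduct_star_self_eq_zero.1 h2.1) (dotProduct_star_self_eq_zero.1 h2.2)
    have := LinearMap.surjective_of_injective hG
    exact Function.Surjective.of_comp (g := A₁.conjTranspose.mulVecLin.prod
      A₂.conjTranspose.mulVecLin) (by simpa using this)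
  have hdim : Module.finrank ℂ (LinearMap.range f) = Module.finrank ℂ (LinearMap.ker g) := by
    have h1 := LinearMap.finrank_range_add_finrank_ker g
    rw [LinearMap.range_eq_top.2 hgs, finrank_top, Module.finrank_prod] at h1
    rw [LinearMap.finrank_range_of_inj hfi]
    omega
  have heq := Submodule.eq_of_le_of_finrank_eq hle hdim
  have hmem : (u, p) ∈ LinearMap.ker g := by
    simpa [hg] using hup
  rw [← heq] at hmem
  obtain ⟨y, hy⟩ := hmem
  refine ⟨y, (congrArg Prod.fst hy).symm, (congrArg Prod.snd hy).symm⟩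

/-- Once `(v, q)` is parametrized by `y`, the form is the pairing of `y` with the boundary condition
for `(u, p)`. -/
theorem form_eq_zero (h : IsLagrangian A₁ A₂) {u p v q : ι → ℂ}
    (hup : A₁.mulVec u + A₂.mulVec p = 0) (hvq : A₁.mulVec v + A₂.mulVec q = 0) :
    ∑ i, (p i * starRingEnd ℂ (v i) - u i * starRingEnd ℂ (q i)) = 0 := by
  obtain ⟨y, rfl, rfl⟩ := h.exists_param hvq
  have e : ∑ i, (p i * starRingEnd ℂ (A₂.conjTranspose.mulVec y i) -
      u i * starRingEnd ℂ ((-A₁.conjTranspose.mulVec y) i)) =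
      star (A₂.conjTranspose.mulVec y) ⬝ᵥ p + star (A₁.conjTranspose.mulVec y) ⬝ᵥ u := by
    simp only [dotProduct, ← Finset.sum_add_distrib]
    refine Finset.sum_congr rfl fun i _ => ?_
    simp only [Pi.neg_apply, map_neg, Pi.star_apply, RCLike.star_def]
    ring
  rw [e, Matrix.star_mulVec, Matrix.star_mulVec, Matrix.conjTranspose_conjTranspose,
    Matrix.conjTranspose_conjTranspose, ← Matrix.dotProduct_mulVec, ← Matrix.dotProduct_mulVec,
    ← dotProduct_add, add_comm, hup, dotProduct_zero]

/-- The derivative values `p` are not controlled by `u`, but the boundary form vanishes between any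
two admissible pairs. So `p` may be replaced by an admissible `S u` that depends linearly on `u`. -/
theorem exists_bound (h : IsLagrangian A₁ A₂) : ∃ K : ℝ, 0 ≤ K ∧ ∀ u p : ι → ℂ,
    A₁.mulVec u + A₂.mulVec p = 0 →
      ‖∑ i, p i * starRingEnd ℂ (u i)‖ ≤ K * ∑ i, ‖u i‖ ^ 2 := by
  -- `T` extends a linear right inverse of `A₂ᴴ` from its range, where every admissible `u` lies, to
  -- the whole space.
  obtain ⟨g, hg⟩ := A₂.conjTranspose.mulVecLin.rangeRestrict.exists_rightInverse_of_surjective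
    (LinearMap.range_rangeRestrict _)
  obtain ⟨T, hT⟩ := g.exists_extend
  set S := ((-A₁.conjTranspose.mulVecLin) ∘ₗ T).toContinuousLinearMap with hS
  refine ⟨Fintype.card ι * ‖S‖, by positivity, fun u p hup => ?_⟩
  obtain ⟨y, hy, -⟩ := h.exists_param hup
  have hr : A₂.conjTranspose.mulVec (T u) = u := by
    have hu : u ∈ LinearMap.range A₂.conjTranspose.mulVecLin := ⟨y, hy.symm⟩
    have h1 : T u = g ⟨u, hu⟩ := by rw [← hT]; rfl
    have h2 := LinearMap.congr_fun hg ⟨u, hu⟩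
    rw [h1]
    exact congrArg Subtype.val h2
  have hSu : A₁.mulVec u + A₂.mulVec (S u) = 0 := by
    have : S u = -A₁.conjTranspose.mulVec (T u) := rfl
    rw [this, Matrix.mulVec_neg, ← h.mulVec_symm, hr, add_neg_cancel]
  have h3 := h.form_eq_zero hup hSu
  rw [Finset.sum_sub_distrib, sub_eq_zero] at h3
  rw [h3]
  have hn : ‖u‖ ^ 2 ≤ ∑ i, ‖u i‖ ^ 2 := by
    have h0 : 0 ≤ ∑ i, ‖u i‖ ^ 2 := Finset.sum_nonneg fun i _ => by positivity
    have : ‖u‖ ≤ Real.sqrt (∑ i, ‖u i‖ ^ 2) := by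
      rw [pi_norm_le_iff_of_nonneg (Real.sqrt_nonneg _)]
      intro i
      refine Real.le_sqrt_of_sq_le ?_
      exact Finset.single_le_sum (f := fun i => ‖u i‖ ^ 2) (fun i _ => by positivity)
        (Finset.mem_univ i)
    calc ‖u‖ ^ 2 ≤ Real.sqrt (∑ i, ‖u i‖ ^ 2) ^ 2 := by gcongr
      _ = _ := Real.sq_sqrt h0
  calc ‖∑ i, u i * starRingEnd ℂ (S u i)‖ ≤ ∑ i, ‖u i * starRingEnd ℂ (S u i)‖ :=
        norm_sum_le _ _
    _ ≤ ∑ _i : ι, ‖u‖ * (‖S‖ * ‖u‖) := by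
        refine Finset.sum_le_sum fun i _ => ?_
        rw [norm_mul, RCLike.norm_conj]
        exact mul_le_mul (norm_le_pi_norm u i) ((norm_le_pi_norm (S u) i).trans (S.le_opNorm u))
          (norm_nonneg _) (norm_nonneg _)
    _ = Fintype.card ι * ‖S‖ * ‖u‖ ^ 2 := by
        rw [Finset.sum_const, Finset.card_univ, nsmul_eq_mul]
        ring
    _ ≤ _ := by gcongr

end IsLagrangian

namespace StarData

variable {ι : Type*} [Fintype ι] [DecidableEq ι] {P : StarData ι}

namespace FundamentalSystem

variable (F : P.FundamentalSystem)

theorem inner_toL2 (hP : P.Regular) (z w : ℂ) (x y : ι ⊕ ι → ℂ) :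
    inner ℂ (F.toL2 w y) (F.toL2 z x) =
      ∑ i, ∫ t in P.left i..P.right i, F.sol z x i t * starRingEnd ℂ (F.sol w y i t) := by
  rw [PiLp.inner_apply]
  refine Finset.sum_congr rfl fun i _ => ?_
  rw [L2.inner_def, intervalIntegral.integral_of_le (hP.lt i).le]
  refine integral_congr_ae ?_
  filter_upwards [F.toL2_ae_eq w y i, F.toL2_ae_eq z x i] with t h1 h2
  rw [h1, h2, RCLike.inner_apply]

theorem green (hP : P.Regular) (z w : ℂ) (x y : ι ⊕ ι → ℂ) :
    ∑ i, (F.der z x i (P.right i) * starRingEnd ℂ (F.sol w y i (P.right i)) -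
        F.sol z x i (P.right i) * starRingEnd ℂ (F.der w y i (P.right i))) -
      ∑ i, (x (Sum.inr i) * starRingEnd ℂ (y (Sum.inl i)) -
        x (Sum.inl i) * starRingEnd ℂ (y (Sum.inr i))) =
      (starRingEnd ℂ w - z) * inner ℂ (F.toL2 w y) (F.toL2 z x) := by
  rw [F.inner_toL2 hP, Finset.mul_sum, ← Finset.sum_sub_distrib]
  refine Finset.sum_congr rfl fun i _ => ?_
  have h := green_edge (hP.lt i).le (F.isTwiceDiff z x i).1 (F.isTwiceDiff z x i).2
    (F.isTwiceDiff w y i).1 (F.isTwiceDiff w y i).2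
  rw [← h]
  simp only [F.sol_left, F.der_left]

theorem boundaryMap_eq_zero_iff (z : ℂ) (x : ι ⊕ ι → ℂ) : F.boundaryMap z x = 0 ↔
    (P.β₁.mulVec (fun i => F.sol z x i (P.right i)) +
      P.β₂.mulVec (fun i => F.der z x i (P.right i)) = 0) ∧
    (P.α₁.mulVec (fun i => x (Sum.inl i)) + P.α₂.mulVec (fun i => x (Sum.inr i)) = 0) := by
  rw [boundaryMap_apply, trace]
  simp only [F.sol_left, F.der_left]
  constructor
  · intro h
    exact ⟨funext fun i => congrFun h (Sum.inl i), funext fun i => congrFun h (Sum.inr i)⟩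
  · rintro ⟨h1, h2⟩
    rw [h1, h2]
    funext k
    rcases k with i | i <;> rfl

theorem ker_boundaryMap_eq_bot (hP : P.Regular) {z : ℂ} (hz : z.im ≠ 0) :
    LinearMap.ker (F.boundaryMap z) = ⊥ := by
  rw [LinearMap.ker_eq_bot']
  intro x hx
  rw [boundaryMap_eq_zero_iff] at hx
  have h := F.green hP z z x x
  rw [hP.lagrangian_β.form_eq_zero hx.1 hx.1, hP.lagrangian_α.form_eq_zero hx.2 hx.2, sub_zero]
    at h
  rcases mul_eq_zero.1 h.symm with h | h
  · exfalso
    have := congrArg Complex.im h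
    simp only [Complex.sub_im, Complex.conj_im, Complex.zero_im] at this
    exact hz (by linarith)
  · rw [inner_self_eq_zero] at h
    exact F.toL2_injective hP z (h.trans (map_zero _).symm)

/-- On each edge the transfer matrix has determinant one, the Wronskian, and is inverted by Cramer's
rule. -/
theorem exists_right_data (hP : P.Regular) (z : ℂ) (a b : ι → ℂ) :
    ∃ x, (∀ i, F.sol z x i (P.right i) = a i) ∧ ∀ i, F.der z x i (P.right i) = b i := by
  have hw : ∀ i, F.c i z (P.right i) * F.ds i z (P.right i) -
      F.dc i z (P.right i) * F.s i z (P.right i) = 1 := fun i => by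
    rw [wronskian_eq (hP.lt i).le (F.c_ac i z) (F.dc_ac i z) (F.s_ac i z) (F.ds_ac i z),
      F.c_left, F.dc_left, F.ds_left]
    ring
  refine ⟨Sum.elim (fun i => F.ds i z (P.right i) * a i - F.s i z (P.right i) * b i)
    (fun i => F.c i z (P.right i) * b i - F.dc i z (P.right i) * a i), fun i => ?_, fun i => ?_⟩
  · simp only [sol, Sum.elim_inl, Sum.elim_inr]
    linear_combination a i * hw i
  · simp only [der, Sum.elim_inl, Sum.elim_inr]
    linear_combination b i * hw i

/-- At a real point either the boundary value problem with unit datum at `k` is solvable, or there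
is an eigenfunction whose conjugate boundary datum at `k` is the unit. -/
theorem exists_boundaryMap_eq_single_or (hP : P.Regular) (lam : ℝ) (k : ι ⊕ ι) :
    (∃ x, F.boundaryMap lam x = Pi.single k 1) ∨
    ∃ x y : ι ⊕ ι → ℂ, y k ≠ 0 ∧ F.boundaryMap lam x = 0 ∧
      (∀ i, x (Sum.inl i) = -P.α₂.conjTranspose.mulVec (fun i => y (Sum.inr i)) i) ∧
      (∀ i, x (Sum.inr i) = P.α₁.conjTranspose.mulVec (fun i => y (Sum.inr i)) i) ∧
      (∀ i, F.sol lam x i (P.right i) =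
        P.β₂.conjTranspose.mulVec (fun i => y (Sum.inl i)) i) ∧
      ∀ i, F.der lam x i (P.right i) =
        -P.β₁.conjTranspose.mulVec (fun i => y (Sum.inl i)) i := by
  by_cases hk : Pi.single k 1 ∈ LinearMap.range (F.boundaryMap lam)
  · exact Or.inl hk
  right
  -- A functional that annihilates the range but not the unit vector; `y` holds its conjugated
  -- coefficients.
  obtain ⟨f, hfk, hf⟩ := Submodule.exists_le_ker_of_notMem hk
  set y : ι ⊕ ι → ℂ := fun k => starRingEnd ℂ (f (Pi.single k 1)) with hy
  set yl : ι → ℂ := fun i => y (Sum.inl i) with hyl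
  set yr : ι → ℂ := fun i => y (Sum.inr i) with hyr
  have hfw : ∀ w, f w = ∑ k, w k * starRingEnd ℂ (y k) := fun w => by
    rw [LinearMap.pi_apply_eq_sum_univ f w]
    refine Finset.sum_congr rfl fun k _ => ?_
    simp only [hy, Complex.conj_conj, smul_eq_mul]
    congr 3
    funext l
    simp [Pi.single_apply, eq_comm]
  have hadj : ∀ (A : Matrix ι ι ℂ) (v w : ι → ℂ), ∑ i, A.mulVec v i * starRingEnd ℂ (w i) =
      ∑ i, v i * starRingEnd ℂ (A.conjTranspose.mulVec w i) := fun A v w => by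
    have h1 : star w ⬝ᵥ A.mulVec v = star (A.conjTranspose.mulVec w) ⬝ᵥ v := by
      rw [Matrix.dotProduct_mulVec, Matrix.star_mulVec, Matrix.conjTranspose_conjTranspose]
    simp only [dotProduct, Pi.star_apply, RCLike.star_def] at h1
    simpa only [mul_comm] using h1
  -- These initial data make the left boundary terms of Green's formula equal to the left terms of
  -- the orthogonality relation `hor`; subtracting leaves only terms at the right ends.
  set x : ι ⊕ ι → ℂ := Sum.elim (-P.α₂.conjTranspose.mulVec yr) (P.α₁.conjTranspose.mulVec yr)
    with hx
  have hor : ∀ x', ∑ i, F.sol lam x' i (P.right i) *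
        starRingEnd ℂ (P.β₁.conjTranspose.mulVec yl i) +
      ∑ i, F.der lam x' i (P.right i) * starRingEnd ℂ (P.β₂.conjTranspose.mulVec yl i) +
      (∑ i, x' (Sum.inl i) * starRingEnd ℂ (P.α₁.conjTranspose.mulVec yr i) +
      ∑ i, x' (Sum.inr i) * starRingEnd ℂ (P.α₂.conjTranspose.mulVec yr i)) = 0 := fun x' => by
    have h1 : f (F.boundaryMap lam x') = 0 := hf ⟨x', rfl⟩
    rw [hfw, Fintype.sum_sum_type, boundaryMap_apply, trace] at h1
    simp only [Sum.elim_inl, Sum.elim_inr, Pi.add_apply, add_mul, Finset.sum_add_distrib,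
      F.sol_left, F.der_left] at h1
    rw [hadj _ _ yl, hadj _ _ yl, hadj _ _ yr, hadj _ _ yr] at h1
    exact h1
  have hgr : ∀ x', ∑ i, (F.der lam x' i (P.right i) *
        starRingEnd ℂ (F.sol lam x i (P.right i) - P.β₂.conjTranspose.mulVec yl i) -
      F.sol lam x' i (P.right i) *
        starRingEnd ℂ (F.der lam x i (P.right i) + P.β₁.conjTranspose.mulVec yl i)) = 0 :=
    fun x' => by
    have h1 := F.green hP lam lam x' x
    have h2 := hor x'
    simp only [Complex.conj_ofReal, sub_self, zero_mul, hx, Sum.elim_inl, Sum.elim_inr,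
      Pi.neg_apply, map_neg, Finset.sum_sub_distrib, mul_neg, Finset.sum_neg_distrib] at h1
    simp only [map_sub, map_add, mul_sub, mul_add, Finset.sum_sub_distrib,
      Finset.sum_add_distrib]
    linear_combination h1 - h2
  -- Testing with the solution whose right data are the mismatch itself turns the relation into a
  -- vanishing sum of squares.
  obtain ⟨x', hs, hd⟩ := F.exists_right_data hP lam
    (fun i => -(F.der lam x i (P.right i) + P.β₁.conjTranspose.mulVec yl i))
    (fun i => F.sol lam x i (P.right i) - P.β₂.conjTranspose.mulVec yl i)
  have h0 := hgr x'
  simp only [hs, hd, neg_mul, sub_neg_eq_add, Complex.mul_conj] at h0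
  have h0' : ∑ i, (Complex.normSq (F.sol lam x i (P.right i) -
      P.β₂.conjTranspose.mulVec yl i) + Complex.normSq (F.der lam x i (P.right i) +
      P.β₁.conjTranspose.mulVec yl i)) = 0 := by exact_mod_cast h0
  rw [Finset.sum_eq_zero_iff_of_nonneg fun i _ =>
    add_nonneg (Complex.normSq_nonneg _) (Complex.normSq_nonneg _)] at h0'
  have h1 : ∀ i, F.sol lam x i (P.right i) = P.β₂.conjTranspose.mulVec yl i ∧
      F.der lam x i (P.right i) = -P.β₁.conjTranspose.mulVec yl i := fun i => by
    have := (add_eq_zero_iff_of_nonneg (Complex.normSq_nonneg _) (Complex.normSq_nonneg _)).1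
      (h0' i (Finset.mem_univ i))
    rw [Complex.normSq_eq_zero, Complex.normSq_eq_zero] at this
    exact ⟨sub_eq_zero.1 this.1, eq_neg_of_add_eq_zero_left this.2⟩
  refine ⟨x, y, ?_, ?_, fun i => by simp [hx, hyr], fun i => by simp [hx, hyr],
    fun i => (h1 i).1, fun i => (h1 i).2⟩
  · simpa [hy] using hfk
  · rw [boundaryMap_eq_zero_iff]
    simp only [fun i => (h1 i).1, fun i => (h1 i).2]
    constructor
    · have := hP.lagrangian_β.mulVec_symm yl
      change P.β₁.mulVec (P.β₂.conjTranspose.mulVec yl) +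
        P.β₂.mulVec (-P.β₁.conjTranspose.mulVec yl) = 0
      rw [Matrix.mulVec_neg, this, add_neg_cancel]
    · have := hP.lagrangian_α.mulVec_symm yr
      change P.α₁.mulVec (-P.α₂.conjTranspose.mulVec yr) +
        P.α₂.mulVec (P.α₁.conjTranspose.mulVec yr) = 0
      rw [Matrix.mulVec_neg, this, neg_add_cancel]

end FundamentalSystem

end StarData

/-! ### Eigenvalues are discrete and bounded below -/

theorem HasACDeriv.continuousOn_normSq {a b : ℝ} {u p : ℝ → ℂ} (h : HasACDeriv a b u p) :
    ContinuousOn (fun t => ‖u t‖ ^ 2) (Icc a b) := h.continuousOn.norm.pow 2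

/-- The minimum of `‖u‖²` is at most its mean, and the increase from there is at most the integral
of `2‖u‖‖p‖ ≤ ‖u‖² / ε + ε‖p‖²`. -/
theorem norm_sq_le_of_hasACDeriv {a b : ℝ} (hab : a < b) {u p : ℝ → ℂ} (hu : HasACDeriv a b u p)
    (hp : ContinuousOn p (Icc a b)) {ε : ℝ} (hε : 0 < ε) {x : ℝ} (hx : x ∈ Icc a b) :
    ‖u x‖ ^ 2 ≤ (1 / (b - a) + 1 / ε) * (∫ t in a..b, ‖u t‖ ^ 2) +
      ε * ∫ t in a..b, ‖p t‖ ^ 2 := by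
  have hu2 := hu.continuousOn_normSq
  have hp2 : ContinuousOn (fun t => ‖p t‖ ^ 2) (Icc a b) := hp.norm.pow 2
  have iu : IntervalIntegrable (fun t => ‖u t‖ ^ 2) volume a b :=
    ContinuousOn.intervalIntegrable (by rwa [uIcc_of_le hab.le])
  have ip : IntervalIntegrable (fun t => ‖p t‖ ^ 2) volume a b :=
    ContinuousOn.intervalIntegrable (by rwa [uIcc_of_le hab.le])
  obtain ⟨y, hy, hmin⟩ := isCompact_Icc.exists_isMinOn (nonempty_Icc.2 hab.le) hu2
  have h1 : ‖u y‖ ^ 2 ≤ 1 / (b - a) * ∫ t in a..b, ‖u t‖ ^ 2 := by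
    have : ∫ _t in a..b, ‖u y‖ ^ 2 ≤ ∫ t in a..b, ‖u t‖ ^ 2 :=
      intervalIntegral.integral_mono_on hab.le intervalIntegrable_const iu fun t ht => hmin ht
    rw [intervalIntegral.integral_const, smul_eq_mul] at this
    rw [one_div, ← div_eq_inv_mul, le_div_iff₀ (by linarith)]
    linarith
  set g : ℝ → ℝ := fun t => ‖u t‖ ^ 2 / ε + ε * ‖p t‖ ^ 2 with hg
  have ig : IntervalIntegrable g volume a b := (iu.div_const ε).add (ip.const_mul ε)
  have hsq := hu.mul hab.le hu.star
  have hbd : ∀ t, ‖p t * starRingEnd ℂ (u t) + u t * starRingEnd ℂ (p t)‖ ≤ g t := fun t => by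
    have e : g t - 2 * (‖u t‖ * ‖p t‖) = (‖u t‖ - ε * ‖p t‖) ^ 2 / ε := by
      simp only [hg]
      field_simp
      ring
    have e2 : 0 ≤ (‖u t‖ - ε * ‖p t‖) ^ 2 / ε := by positivity
    refine (norm_add_le _ _).trans ?_
    rw [norm_mul, norm_mul, RCLike.norm_conj, RCLike.norm_conj]
    linarith
  have key : ‖u x * starRingEnd ℂ (u x) - u y * starRingEnd ℂ (u y)‖ ≤ ∫ t in a..b, g t := by
    have i1 := hsq.1.mono_set (uIcc_subset_uIcc left_mem_uIcc (Icc_subset_uIcc hx))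
    have i2 := hsq.1.mono_set (uIcc_subset_uIcc left_mem_uIcc (Icc_subset_uIcc hy))
    have e1 := hsq.2 x hx
    have e2 := hsq.2 y hy
    simp only [] at e1 e2
    rw [e1, e2, add_sub_add_left_eq_sub, intervalIntegral.integral_interval_sub_left i1 i2]
    refine (intervalIntegral.norm_integral_le_abs_of_norm_le
      (Eventually.of_forall fun t => hbd t) (ig.mono_set ?_)).trans ?_
    · exact uIcc_subset_uIcc (Icc_subset_uIcc hy) (Icc_subset_uIcc hx)
    · refine (intervalIntegral.abs_integral_mono_interval ?_ ?_ ig).trans_eq (abs_of_nonneg ?_)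
      · exact uIoc_subset_uIoc_of_uIcc_subset_uIcc
          (uIcc_subset_uIcc (Icc_subset_uIcc hy) (Icc_subset_uIcc hx))
      · exact Eventually.of_forall fun t => (norm_nonneg _).trans (hbd t)
      · exact intervalIntegral.integral_nonneg hab.le fun t _ => (norm_nonneg _).trans (hbd t)
  have h2 : ‖u x‖ ^ 2 - ‖u y‖ ^ 2 ≤ ∫ t in a..b, g t := by
    refine le_trans ?_ key
    rw [Complex.mul_conj, Complex.mul_conj, ← Complex.ofReal_sub, Complex.norm_real,
      Complex.normSq_eq_norm_sq, Complex.normSq_eq_norm_sq]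
    exact le_abs_self _
  have h3 : ∫ t in a..b, g t = (1 / ε) * (∫ t in a..b, ‖u t‖ ^ 2) + ε * ∫ t in a..b, ‖p t‖ ^ 2 := by
    simp only [hg]
    rw [intervalIntegral.integral_add (iu.div_const ε) (ip.const_mul ε),
      intervalIntegral.integral_div, intervalIntegral.integral_const_mul]
    ring
  rw [h3] at h2
  rw [add_mul]
  linarith

theorem energy_edge {a b : ℝ} (hab : a ≤ b) {V : ℝ → ℝ} {lam : ℝ} {u p : ℝ → ℂ}
    (hV : IntervalIntegrable V volume a b)
    (hu : HasACDeriv a b u p) (hp : HasACDeriv a b p fun t => ((V t : ℂ) - lam) * u t) :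
    p b * starRingEnd ℂ (u b) - p a * starRingEnd ℂ (u a) =
      (((∫ t in a..b, V t * ‖u t‖ ^ 2) - lam * (∫ t in a..b, ‖u t‖ ^ 2) +
        ∫ t in a..b, ‖p t‖ ^ 2 : ℝ) : ℂ) := by
  have hu2 := hu.continuousOn_normSq
  have hp2 := hp.continuousOn_normSq
  rw [← uIcc_of_le hab] at hu2 hp2
  have h := (hp.mul hab hu.star).integral_eq_sub hab
  rw [← h, ← intervalIntegral.integral_const_mul, ← intervalIntegral.integral_sub
    (hV.mul_continuousOn hu2) (hu2.intervalIntegrable.const_mul _),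
    ← intervalIntegral.integral_add ((hV.mul_continuousOn hu2).sub
    (hu2.intervalIntegrable.const_mul _)) hp2.intervalIntegrable,
    ← intervalIntegral.integral_ofReal]
  refine intervalIntegral.integral_congr fun t _ => ?_
  simp only [Complex.ofReal_add, Complex.ofReal_sub, Complex.ofReal_mul,
    ← Complex.normSq_eq_norm_sq, ← Complex.mul_conj]
  ring

/-- Infinitely many zeros in a compact interval would accumulate, against the identity theorem. -/
theorem entire_zeros_finite {f : ℂ → ℂ} (hf : Differentiable ℂ f) {z₀ : ℂ} (hz₀ : f z₀ ≠ 0)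
    (a b : ℝ) : {x : ℝ | x ∈ Icc a b ∧ f x = 0}.Finite := by
  by_contra hinf
  obtain ⟨x, hx, hacc⟩ := Set.Infinite.exists_accPt_of_subset_isCompact hinf isCompact_Icc
    (fun x hx => hx.1)
  have hfan : AnalyticOnNhd ℂ f univ := fun z _ => hf.analyticAt z
  have hfreq : ∃ᶠ z in 𝓝[≠] (x : ℂ), f z = 0 := by
    rw [accPt_iff_frequently_nhdsNE] at hacc
    have ht : Tendsto (fun t : ℝ => (t : ℂ)) (𝓝[≠] x) (𝓝[≠] (x : ℂ)) := by
      refine tendsto_nhdsWithin_iff.2 ⟨?_, ?_⟩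
      · exact (Complex.continuous_ofReal.tendsto x).mono_left nhdsWithin_le_nhds
      · filter_upwards [self_mem_nhdsWithin] with t ht
        simpa using ht
    exact ht.frequently (hacc.mono fun t ht => ht.2)
  have := hfan.eqOn_zero_of_preconnected_of_frequently_eq_zero isPreconnected_univ
    (mem_univ _) hfreq
  exact hz₀ (this (mem_univ z₀))

namespace StarData

variable {ι : Type*} [Fintype ι] [DecidableEq ι] {P : StarData ι}

/-- In the energy identity for an eigenfunction, the potential and the boundary terms are bounded by
constants times the supremum of `‖u‖²` on each edge. The Sobolev estimate with small `ε` lets `∫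
‖u'‖²` absorb the derivative part, leaving `-λ ∫ ‖u‖² ≤ C ∫ ‖u‖²` summed over the edges. -/
theorem FundamentalSystem.exists_lower_bound (F : P.FundamentalSystem) (hP : P.Regular) :
    ∃ C : ℝ, ∀ lam : ℝ, LinearMap.ker (F.boundaryMap lam) ≠ ⊥ → -C ≤ lam := by
  obtain ⟨Kα, hKα, hα⟩ := hP.lagrangian_α.exists_bound
  obtain ⟨Kβ, hKβ, hβ⟩ := hP.lagrangian_β.exists_bound
  set I : ι → ℝ := fun i => ∫ t in P.left i..P.right i, |P.V i t| with hI
  have hI0 : ∀ i, 0 ≤ I i := fun i =>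
    intervalIntegral.integral_nonneg (hP.lt i).le fun _ _ => abs_nonneg _
  -- `M` dominates all constants in front of the supremum; the summand 1 makes it positive.
  set M : ℝ := ∑ i, I i + Kα + Kβ + 1 with hM
  have hIM : ∀ i, I i + Kα + Kβ ≤ M := fun i => by
    have := Finset.single_le_sum (f := I) (fun i _ => hI0 i) (Finset.mem_univ i)
    simp only [hM]
    linarith
  have hM0 : 0 < M := by
    have := Finset.sum_nonneg (s := Finset.univ) fun i _ => hI0 i
    simp only [hM]
    linarith
  set R : ℝ := ∑ i, 1 / (P.right i - P.left i) with hR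
  have hRi : ∀ i, 1 / (P.right i - P.left i) ≤ R := fun i =>
    Finset.single_le_sum (f := fun i => 1 / (P.right i - P.left i))
      (fun i _ => one_div_nonneg.2 (sub_nonneg.2 (hP.lt i).le)) (Finset.mem_univ i)
  refine ⟨M * (R + M), fun lam hker => ?_⟩
  obtain ⟨x, hx, hx0⟩ := Submodule.exists_mem_ne_zero_of_ne_bot hker
  rw [LinearMap.mem_ker, F.boundaryMap_eq_zero_iff] at hx
  set u := F.sol lam x with hu
  set p := F.der lam x with hp
  have hd := F.isTwiceDiff lam x
  set N : ι → ℝ := fun i => ∫ t in P.left i..P.right i, ‖u i t‖ ^ 2 with hN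
  set D : ι → ℝ := fun i => ∫ t in P.left i..P.right i, ‖p i t‖ ^ 2 with hD
  -- The Sobolev bound with `ε = 1 / M`, chosen so that `M * S i` contains `D i` with coefficient
  -- exactly one.
  set S : ι → ℝ := fun i => (R + M) * N i + 1 / M * D i with hS
  have hN0 : ∀ i, 0 ≤ N i := fun i =>
    intervalIntegral.integral_nonneg (hP.lt i).le fun _ _ => by positivity
  have hD0 : ∀ i, 0 ≤ D i := fun i =>
    intervalIntegral.integral_nonneg (hP.lt i).le fun _ _ => by positivity
  have hsup : ∀ i, ∀ t ∈ Icc (P.left i) (P.right i), ‖u i t‖ ^ 2 ≤ S i := fun i t ht => by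
    refine (norm_sq_le_of_hasACDeriv (hP.lt i) (hd i).1 (hd i).2.continuousOn
      (one_div_pos.2 hM0) ht).trans ?_
    rw [one_div_one_div]
    exact add_le_add_left (mul_le_mul_of_nonneg_right (add_le_add_left (hRi i) M) (hN0 i)) _
  have hS0 : ∀ i, 0 ≤ S i := fun i =>
    (sq_nonneg _).trans (hsup i _ (left_mem_Icc.2 (hP.lt i).le))
  have hpos : 0 < ∑ i, N i := by
    have h1 := F.inner_toL2 hP lam lam x x
    have h2 : ∑ i, ∫ t in P.left i..P.right i, F.sol lam x i t * starRingEnd ℂ (F.sol lam x i t) =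
        ((∑ i, N i : ℝ) : ℂ) := by
      rw [Complex.ofReal_sum]
      refine Finset.sum_congr rfl fun i _ => ?_
      simp only [hN]
      rw [← intervalIntegral.integral_ofReal]
      refine intervalIntegral.integral_congr fun t _ => ?_
      simp only [Complex.mul_conj, Complex.normSq_eq_norm_sq, hu]
    have h3 : ∑ i, N i ≠ 0 := fun h => by
      rw [h2, h, Complex.ofReal_zero, inner_self_eq_zero] at h1
      exact hx0 (F.toL2_injective hP lam (h1.trans (map_zero _).symm))
    exact lt_of_le_of_ne (Finset.sum_nonneg fun i _ => hN0 i) (Ne.symm h3)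
  have hV : ∀ i, -(I i * S i) ≤ ∫ t in P.left i..P.right i, P.V i t * ‖u i t‖ ^ 2 := fun i => by
    refine neg_le_of_abs_le ?_
    rw [← Real.norm_eq_abs]
    have e : I i * S i = ∫ t in P.left i..P.right i, |P.V i t| * S i := by
      rw [intervalIntegral.integral_mul_const]
    rw [e]
    refine intervalIntegral.norm_integral_le_of_norm_le (hP.lt i).le
      (Eventually.of_forall fun t ht => ?_) ((hP.integrable i).abs.mul_const _)
    rw [norm_mul, Real.norm_eq_abs, Real.norm_of_nonneg (by positivity)]
    exact mul_le_mul_of_nonneg_left (hsup i t (Ioc_subset_Icc_self ht)) (abs_nonneg _)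
  have hener : (∑ i, p i (P.right i) * starRingEnd ℂ (u i (P.right i))) -
      ∑ i, x (Sum.inr i) * starRingEnd ℂ (x (Sum.inl i)) =
      ((∑ i, ((∫ t in P.left i..P.right i, P.V i t * ‖u i t‖ ^ 2) - lam * N i + D i) : ℝ) : ℂ) := by
    rw [Complex.ofReal_sum, ← Finset.sum_sub_distrib]
    refine Finset.sum_congr rfl fun i _ => ?_
    rw [← energy_edge (hP.lt i).le (hP.integrable i) (hd i).1 (hd i).2]
    simp only [hu, hp, F.sol_left, F.der_left]
  have h1 := hα _ _ hx.2
  have h2 := hβ _ _ hx.1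
  have h3 : ∑ i, ((∫ t in P.left i..P.right i, P.V i t * ‖u i t‖ ^ 2) - lam * N i + D i) ≤
      ∑ i, (Kα + Kβ) * S i := by
    refine (le_abs_self _).trans ?_
    rw [← Real.norm_eq_abs, ← Complex.norm_real, ← hener]
    refine (norm_sub_le _ _).trans ?_
    have s1 : ∑ i, ‖x (Sum.inl i)‖ ^ 2 ≤ ∑ i, S i := Finset.sum_le_sum fun i _ => by
      rw [← F.sol_left lam x i]
      exact hsup i _ (left_mem_Icc.2 (hP.lt i).le)
    have s2 : ∑ i, ‖u i (P.right i)‖ ^ 2 ≤ ∑ i, S i := Finset.sum_le_sum fun i _ =>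
      hsup i _ (right_mem_Icc.2 (hP.lt i).le)
    rw [← Finset.mul_sum, add_mul]
    linarith [h1.trans (mul_le_mul_of_nonneg_left s1 hKα),
      h2.trans (mul_le_mul_of_nonneg_left s2 hKβ)]
  have h4 : ∑ i, (-(M * (R + M)) * N i - lam * N i) ≤ 0 := by
    rw [← sub_nonpos, ← Finset.sum_sub_distrib] at h3
    refine le_trans (Finset.sum_le_sum fun i _ => ?_) h3
    have e : M * S i = M * (R + M) * N i + D i := by
      simp only [hS]
      field_simp
    have := mul_le_mul_of_nonneg_right (hIM i) (hS0 i)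
    linarith [hV i]
  rw [← Finset.sum_congr rfl fun i _ => sub_mul (-(M * (R + M))) lam (N i), ← Finset.mul_sum] at h4
  by_contra hlt
  have := mul_pos (sub_pos.2 (not_le.1 hlt)) hpos
  linarith

namespace FundamentalSystem

variable (F : P.FundamentalSystem)

/-- The matrix of the boundary map. -/
noncomputable def boundaryMatrix (z : ℂ) : Matrix (ι ⊕ ι) (ι ⊕ ι) ℂ :=
  LinearMap.toMatrix' (F.boundaryMap z)

theorem boundaryMatrix_mulVec (z : ℂ) (x : ι ⊕ ι → ℂ) :
    (F.boundaryMatrix z).mulVec x = F.boundaryMap z x := LinearMap.toMatrix'_mulVec _ _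

theorem differentiable_boundaryMap (hP : P.Regular) (x : ι ⊕ ι → ℂ) (k : ι ⊕ ι) :
    Differentiable ℂ fun z => F.boundaryMap z x k := by
  have h1 := fun i => F.sol_diff x i (left_mem_Icc.2 (hP.lt i).le)
  have h2 := fun i => F.der_diff x i (left_mem_Icc.2 (hP.lt i).le)
  have h3 := fun i => F.sol_diff x i (right_mem_Icc.2 (hP.lt i).le)
  have h4 := fun i => F.der_diff x i (right_mem_Icc.2 (hP.lt i).le)
  rcases k with i | i <;>
    simp only [boundaryMap_apply, trace, Sum.elim_inl, Sum.elim_inr, Pi.add_apply, Matrix.mulVec,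
      dotProduct] <;> fun_prop

theorem differentiable_boundaryMatrix (hP : P.Regular) (k l : ι ⊕ ι) :
    Differentiable ℂ fun z => F.boundaryMatrix z k l := by
  simp only [boundaryMatrix, LinearMap.toMatrix'_apply]
  exact F.differentiable_boundaryMap hP _ k

theorem _root_.Matrix.differentiable_det {κ : Type*} [Fintype κ] [DecidableEq κ]
    {A : ℂ → Matrix κ κ ℂ} (hA : ∀ k l, Differentiable ℂ fun z => A z k l) :
    Differentiable ℂ fun z => (A z).det := by
  simp only [Matrix.det_apply]
  refine Differentiable.fun_sum fun σ _ => Differentiable.const_smul ?_ _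
  exact Differentiable.fun_finsetProd fun i _ => hA _ _

theorem differentiable_det (hP : P.Regular) : Differentiable ℂ fun z => (F.boundaryMatrix z).det :=
  Matrix.differentiable_det (F.differentiable_boundaryMatrix hP)

theorem det_ne_zero_iff (z : ℂ) :
    (F.boundaryMatrix z).det ≠ 0 ↔ LinearMap.ker (F.boundaryMap z) = ⊥ := by
  rw [boundaryMatrix, LinearMap.det_toMatrix', ← isUnit_iff_ne_zero,
    ← LinearMap.isUnit_iff_isUnit_det, LinearMap.isUnit_iff_ker_eq_bot]

end FundamentalSystem

theorem Regular.finitelyManyEigenvalues (hP : P.Regular) (Λ : ℝ) :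
    FinitelyManyEigenvalues P.operator Λ := by
  obtain ⟨F⟩ := hP.nonempty_fundamentalSystem
  refine ⟨?_, fun μ _ => hP.finiteDimensional_eigenspace μ⟩
  obtain ⟨C, hC⟩ := F.exists_lower_bound hP
  have h0 : (F.boundaryMatrix Complex.I).det ≠ 0 :=
    (F.det_ne_zero_iff _).2 (F.ker_boundaryMap_eq_bot hP (by simp))
  refine (entire_zeros_finite (F.differentiable_det hP) h0 (-C) Λ).subset fun μ hμ => ?_
  have h1 : LinearMap.ker (F.boundaryMap μ) ≠ ⊥ := fun h => hμ.2 ((F.eigenspace_eq_bot_iff hP _).2 h)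
  exact ⟨⟨hC μ h1, hμ.1⟩, by_contra fun h => h1 ((F.det_ne_zero_iff _).1 h)⟩

end StarData

/-! ### Herglotz functions near a real point -/

/-- The hypothesis is `Im (e^{ikθ} c) ≤ 0`. For `|k| ≥ 2` the angle `kθ` sweeps an interval of
length at least `2π`, so it takes four values a quarter turn apart, and the inequalities come in
opposite pairs. -/
theorem eq_zero_of_forall_im_nonpos {k : ℤ} (hk : 2 ≤ k.natAbs) {c : ℂ}
    (h : ∀ θ : ℝ, 0 < θ → θ < Real.pi →
      Real.cos (k * θ) * c.im + Real.sin (k * θ) * c.re ≤ 0) : c = 0 := by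
  have hK : (2 : ℝ) ≤ k.natAbs := by exact_mod_cast hk
  set K : ℝ := (k.natAbs : ℝ) with hKdef
  have hπ := Real.pi_pos
  have hK0 : 0 < K := by linarith
  obtain ⟨σ, hσ, hkσ⟩ : ∃ σ : ℝ, (σ = 1 ∨ σ = -1) ∧ (k : ℝ) = σ * K := by
    rcases le_total 0 k with h0 | h0
    · refine ⟨1, Or.inl rfl, ?_⟩
      rw [one_mul, hKdef, ← Int.cast_natCast, Int.natAbs_of_nonneg h0]
    · refine ⟨-1, Or.inr rfl, ?_⟩
      rw [hKdef, ← Int.cast_natCast, Int.ofNat_natAbs_of_nonpos h0]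
      push_cast
      ring
  -- The angles `±(π/4 + mπ/2)` with `m ≤ 3` stay strictly between 0 and `2π` in absolute value, so
  -- the corresponding `θ` lies in `(0, π)`.
  set φ : ℝ := σ * (Real.pi / 4) with hφ
  have key : ∀ m : ℕ, m ≤ 3 → Real.cos (φ + σ * (m * (Real.pi / 2))) * c.im +
      Real.sin (φ + σ * (m * (Real.pi / 2))) * c.re ≤ 0 := fun m hm => by
    have hm' : (m : ℝ) ≤ 3 := by exact_mod_cast hm
    have h1 := h ((Real.pi / 4 + m * (Real.pi / 2)) / K) (by positivity) (by
      rw [div_lt_iff₀ hK0]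
      nlinarith)
    have e : (k : ℝ) * ((Real.pi / 4 + m * (Real.pi / 2)) / K) = φ + σ * (m * (Real.pi / 2)) := by
      rw [hkσ, hφ]
      field_simp
    rwa [e] at h1
  have h0 := key 0 (by norm_num)
  have h1 := key 1 (by norm_num)
  have h2 := key 2 (by norm_num)
  have h3 := key 3 (by norm_num)
  have hsc := Real.sin_sq_add_cos_sq φ
  have hc3 : ∀ x : ℝ, Real.cos (x + 3 * (Real.pi / 2)) = Real.sin x := fun x => by
    rw [show x + 3 * (Real.pi / 2) = x + Real.pi / 2 + Real.pi by ring, Real.cos_add_pi,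
      Real.cos_add_pi_div_two, neg_neg]
  have hs3 : ∀ x : ℝ, Real.sin (x + 3 * (Real.pi / 2)) = -Real.cos x := fun x => by
    rw [show x + 3 * (Real.pi / 2) = x + Real.pi / 2 + Real.pi by ring, Real.sin_add_pi,
      Real.sin_add_pi_div_two]
  have hc3' : ∀ x : ℝ, Real.cos (x - 3 * (Real.pi / 2)) = -Real.sin x := fun x => by
    rw [show x - 3 * (Real.pi / 2) = x - Real.pi / 2 - Real.pi by ring, Real.cos_sub_pi,
      Real.cos_sub_pi_div_two]
  have hs3' : ∀ x : ℝ, Real.sin (x - 3 * (Real.pi / 2)) = Real.cos x := fun x => by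
    rw [show x - 3 * (Real.pi / 2) = x - Real.pi / 2 - Real.pi by ring, Real.sin_sub_pi,
      Real.sin_sub_pi_div_two, neg_neg]
  have e2 : ((2 : ℕ) : ℝ) * (Real.pi / 2) = Real.pi := by push_cast; ring
  rw [e2] at h2
  have hAB : Real.cos φ * c.im + Real.sin φ * c.re = 0 ∧
      Real.cos φ * c.re - Real.sin φ * c.im = 0 := by
    push_cast at h0 h1 h3
    rcases hσ with rfl | rfl
    · simp only [one_mul, zero_mul, add_zero, Real.cos_add_pi, Real.sin_add_pi,
        Real.cos_add_pi_div_two, Real.sin_add_pi_div_two, hc3, hs3] at h0 h1 h2 h3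
      constructor <;> linarith
    · simp only [neg_mul, one_mul, zero_mul, neg_zero, add_zero, ← sub_eq_add_neg, Real.cos_sub_pi,
        Real.sin_sub_pi, Real.cos_sub_pi_div_two, Real.sin_sub_pi_div_two, hc3', hs3']
        at h0 h1 h2 h3
      constructor <;> linarith
  obtain ⟨hA, hB⟩ := hAB
  refine Complex.ext ?_ ?_
  · rw [Complex.zero_re]
    linear_combination (Real.sin φ) * hA + (Real.cos φ) * hB - c.re * hsc
  · rw [Complex.zero_im]
    linear_combination (Real.cos φ) * hA - (Real.sin φ) * hB - c.im * hsc

/-- Along the ray `λ + r e^{iθ}`, dividing by `r ^ k > 0` and letting `r` tend to zero puts `e^{ikθ}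
g(λ)` in the closed lower half-plane for every `θ` in `(0, π)`. -/
theorem natAbs_order_le_one {f : ℂ → ℂ} {lam : ℝ} (hf : MeromorphicAt f lam) {k : ℤ}
    (hk : meromorphicOrderAt f lam = k)
    (him : ∀ z : ℂ, 0 < z.im → (f z).im ≤ 0) : k.natAbs ≤ 1 := by
  by_contra hk2
  obtain ⟨g, hg, hg0, hfg⟩ := (meromorphicOrderAt_eq_int_iff hf).1 hk
  refine hg0 (eq_zero_of_forall_im_nonpos (k := k) (by omega) fun θ h0 hπ => ?_)
  set ζ : ℂ := Complex.exp (θ * Complex.I) with hζ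
  have hζim : 0 < ζ.im := by
    rw [hζ, Complex.exp_ofReal_mul_I_im]
    exact Real.sin_pos_of_pos_of_lt_pi h0 hπ
  have hζ0 : ζ ≠ 0 := Complex.exp_ne_zero _
  have hpath : Tendsto (fun r : ℝ => (lam : ℂ) + r * ζ) (𝓝[>] 0) (𝓝[≠] (lam : ℂ)) := by
    refine tendsto_nhdsWithin_iff.2 ⟨?_, ?_⟩
    · have : Continuous fun r : ℝ => (lam : ℂ) + r * ζ := by fun_prop
      have h := this.tendsto 0
      simp only [Complex.ofReal_zero, zero_mul, add_zero] at h
      exact h.mono_left nhdsWithin_le_nhds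
    · filter_upwards [self_mem_nhdsWithin] with r hr
      have : (r : ℂ) * ζ ≠ 0 := mul_ne_zero (by exact_mod_cast (ne_of_gt hr)) hζ0
      simpa using this
  have hlim : Tendsto (fun r : ℝ => (ζ ^ k * g ((lam : ℂ) + r * ζ)).im) (𝓝[>] 0)
      (𝓝 (ζ ^ k * g lam).im) := by
    have h1 := hg.continuousAt.tendsto.comp (hpath.mono_right nhdsWithin_le_nhds)
    exact (Complex.continuous_im.tendsto _).comp (h1.const_mul (ζ ^ k))
  have hle : (ζ ^ k * g lam).im ≤ 0 := by
    refine le_of_tendsto hlim ?_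
    filter_upwards [hpath.eventually hfg, self_mem_nhdsWithin] with r hr hr0
    have hr0' : 0 < r := hr0
    have h1 := him ((lam : ℂ) + r * ζ) (by
      simp only [Complex.add_im, Complex.ofReal_im, Complex.im_ofReal_mul, zero_add]
      exact mul_pos hr0' hζim)
    rw [hr, add_sub_cancel_left, mul_zpow, smul_eq_mul, mul_assoc, ← Complex.ofReal_zpow,
      Complex.im_ofReal_mul] at h1
    exact nonpos_of_mul_nonpos_right h1 (zpow_pos hr0' k)
  have e : ζ ^ k = Real.cos (k * θ) + Real.sin (k * θ) * Complex.I := by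
    rw [hζ, ← Complex.exp_int_mul, ← mul_assoc]
    have : (k : ℂ) * θ = ((k * θ : ℝ) : ℂ) := by push_cast; rfl
    rw [this, Complex.exp_mul_I, ← Complex.ofReal_cos, ← Complex.ofReal_sin]
  rw [e] at hle
  simp only [Complex.mul_im, Complex.add_re, Complex.add_im, Complex.mul_re, Complex.ofReal_re,
    Complex.ofReal_im, Complex.I_re, Complex.I_im] at hle
  linarith

theorem tendsto_vertical (z : ℂ) :
    Tendsto (fun y : ℝ => z + y * Complex.I) (𝓝[>] 0) (𝓝[≠] z) := by
  refine tendsto_nhdsWithin_iff.2 ⟨?_, ?_⟩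
  · have : Continuous fun r : ℝ => z + r * Complex.I := by fun_prop
    have h := this.tendsto 0
    simp only [Complex.ofReal_zero, zero_mul, add_zero] at h
    exact h.mono_left nhdsWithin_le_nhds
  · filter_upwards [self_mem_nhdsWithin] with r hr
    have : (r : ℂ) * Complex.I ≠ 0 := mul_ne_zero (by exact_mod_cast (ne_of_gt hr)) Complex.I_ne_zero
    simpa using this

section Order

variable {f : ℂ → ℂ} {lam : ℝ}

/-- At nonnegative order `f` would have a finite limit along the vertical line, against the growth
of `c / y`. -/
theorem order_eq_neg_one_of_le (hf : MeromorphicAt f lam) (htop : meromorphicOrderAt f lam ≠ ⊤)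
    (him : ∀ z : ℂ, 0 < z.im → (f z).im ≤ 0) {c : ℝ} (hc : 0 < c)
    (h : ∀ y : ℝ, 0 < y → c / y ≤ -(f ((lam : ℂ) + y * Complex.I)).im) :
    meromorphicOrderAt f lam = (-1 : ℤ) := by
  obtain ⟨k, hk⟩ := WithTop.ne_top_iff_exists.1 htop
  have h1 := natAbs_order_le_one hf hk.symm him
  have hneg : ¬ 0 ≤ meromorphicOrderAt f lam := fun h0 => by
    obtain ⟨b, hb⟩ := tendsto_nhds_of_meromorphicOrderAt_nonneg hf h0
    have h2 : Tendsto (fun y : ℝ => -(f ((lam : ℂ) + y * Complex.I)).im) (𝓝[>] 0) (𝓝 (-b.im)) :=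
      ((Complex.continuous_im.tendsto _).comp (hb.comp (tendsto_vertical lam))).neg
    have h3 : Tendsto (fun y : ℝ => c / y) (𝓝[>] 0) atTop :=
      Tendsto.const_mul_atTop hc tendsto_inv_nhdsGT_zero
    refine not_tendsto_atTop_of_tendsto_nhds h2 (tendsto_atTop_mono' _ ?_ h3)
    filter_upwards [self_mem_nhdsWithin] with y hy using h y hy
  rw [← hk] at hneg ⊢
  have h4 : ¬ 0 ≤ k := fun h => hneg (by exact_mod_cast h)
  have : k = -1 := by omega
  rw [this]

theorem order_eq_zero_of_tendsto {b : ℂ} (hb : b ≠ 0)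
    (h : Tendsto (fun y : ℝ => f ((lam : ℂ) + y * Complex.I)) (𝓝[>] 0) (𝓝 b)) :
    meromorphicOrderAt f lam = (0 : ℤ) := by
  rcases lt_trichotomy (meromorphicOrderAt f lam) 0 with ho | ho | ho
  · exfalso
    have h1 := (tendsto_cobounded_of_meromorphicOrderAt_neg ho).comp (tendsto_vertical lam)
    rw [← tendsto_norm_atTop_iff_cobounded] at h1
    exact not_tendsto_atTop_of_tendsto_nhds h.norm h1
  · exact ho
  · exfalso
    have h1 := (tendsto_zero_of_meromorphicOrderAt_pos ho).comp (tendsto_vertical lam)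
    exact hb (tendsto_nhds_unique h h1)

theorem order_eq_one_of_tendsto (hf : MeromorphicAt f lam) (htop : meromorphicOrderAt f lam ≠ ⊤)
    (him : ∀ z : ℂ, 0 < z.im → (f z).im ≤ 0)
    (h : Tendsto (fun y : ℝ => f ((lam : ℂ) + y * Complex.I)) (𝓝[>] 0) (𝓝 0)) :
    meromorphicOrderAt f lam = (1 : ℤ) := by
  obtain ⟨k, hk⟩ := WithTop.ne_top_iff_exists.1 htop
  have h1 := natAbs_order_le_one hf hk.symm him
  have hpos : 0 < meromorphicOrderAt f lam := by
    rcases lt_trichotomy (meromorphicOrderAt f lam) 0 with ho | ho | ho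
    · exfalso
      have h1 := (tendsto_cobounded_of_meromorphicOrderAt_neg ho).comp (tendsto_vertical lam)
      rw [← tendsto_norm_atTop_iff_cobounded] at h1
      exact not_tendsto_atTop_of_tendsto_nhds h.norm h1
    · exfalso
      obtain ⟨c, hc, hc'⟩ := tendsto_ne_zero_of_meromorphicOrderAt_eq_zero hf ho
      exact hc (tendsto_nhds_unique (hc'.comp (tendsto_vertical lam)) h)
    · exact ho
  rw [← hk] at hpos ⊢
  have h4 : 0 < k := by exact_mod_cast hpos
  have : k = 1 := by omega
  rw [this]

end Order

/-! ### Estimates for one-sided maps -/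

section Weyl

variable {H : Type*} [NormedAddCommGroup H] [InnerProductSpace ℂ H]

theorem im_eq_of_green {z M : ℂ} {x : H}
    (h : M - starRingEnd ℂ M = (starRingEnd ℂ z - z) * inner ℂ x x) :
    M.im = -(z.im * ‖x‖ ^ 2) := by
  have h1 := congrArg Complex.im h
  rw [inner_self_eq_norm_sq_to_K] at h1
  simp only [Complex.coe_algebraMap, Complex.sub_im, Complex.conj_im, Complex.mul_im,
    Complex.sub_re, Complex.conj_re, sub_self, zero_mul, zero_add, ← Complex.ofReal_pow,
    Complex.ofReal_re] at h1
  linarith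

/-- Here `x` and `w` stand for the unit-datum solutions at `λ + iy` and `λ`. The imaginary part
gives `y‖x‖² ≤ ‖M - m‖ ≤ y‖w‖‖x‖`, so `‖x‖ ≤ ‖w‖`, a bound uniform in `y`. -/
theorem norm_sub_le_of_green {lam y : ℝ} (hy : 0 < y) {M m : ℂ} {x w : H} (hm : m.im = 0)
    (hM : M.im = -(y * ‖x‖ ^ 2))
    (h : M - m = ((lam : ℂ) - (lam + y * Complex.I)) * inner ℂ w x) :
    ‖M - m‖ ≤ y * ‖w‖ ^ 2 := by
  have e : ‖M - m‖ = y * ‖inner ℂ w x‖ := by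
    rw [h, norm_mul, sub_add_cancel_left, norm_neg, norm_mul, Complex.norm_I, mul_one,
      Complex.norm_real, Real.norm_of_nonneg hy.le]
  have h1 : y * ‖x‖ ^ 2 ≤ ‖M - m‖ := by
    have h2 := Complex.abs_im_le_norm (M - m)
    rw [Complex.sub_im, hm, hM, sub_zero, abs_neg, abs_of_nonneg (by positivity)] at h2
    exact h2
  have h2 : ‖inner ℂ w x‖ ≤ ‖w‖ * ‖x‖ := norm_inner_le_norm w x
  rw [e] at h1 ⊢
  have h3 : ‖x‖ ^ 2 ≤ ‖w‖ * ‖x‖ := (le_of_mul_le_mul_left h1 hy).trans h2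
  have h4 : ‖x‖ ≤ ‖w‖ := by
    rcases (norm_nonneg x).eq_or_lt with h0 | h0
    · rw [← h0]
      exact norm_nonneg w
    · rw [sq] at h3
      exact le_of_mul_le_mul_right h3 h0
  refine mul_le_mul_of_nonneg_left (h2.trans ?_) hy.le
  rw [sq]
  exact mul_le_mul_of_nonneg_left h4 (norm_nonneg w)

/-- Now `w` stands for an eigenfunction at `λ`. Cauchy–Schwarz makes `‖x‖` at least `‖ν‖ / (y‖w‖)`,
and `-Im M = y‖x‖²`. -/
theorem div_le_neg_im_of_green {lam y : ℝ} (hy : 0 < y) {M ν : ℂ} {x w : H} (hν : ν ≠ 0)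
    (hM : M.im = -(y * ‖x‖ ^ 2))
    (h : ν = ((lam : ℂ) - (lam + y * Complex.I)) * inner ℂ w x) :
    0 < ‖ν‖ ^ 2 / ‖w‖ ^ 2 ∧ ‖ν‖ ^ 2 / ‖w‖ ^ 2 / y ≤ -M.im := by
  have e : ‖ν‖ = y * ‖inner ℂ w x‖ := by
    rw [h, norm_mul, sub_add_cancel_left, norm_neg, norm_mul, Complex.norm_I, mul_one,
      Complex.norm_real, Real.norm_of_nonneg hy.le]
  have h2 : ‖inner ℂ w x‖ ≤ ‖w‖ * ‖x‖ := norm_inner_le_norm w x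
  have hw : 0 < ‖w‖ := by
    rw [norm_pos_iff]
    rintro rfl
    rw [inner_zero_left, mul_zero] at h
    exact hν h
  have hν' : 0 < ‖ν‖ := norm_pos_iff.2 hν
  refine ⟨by positivity, ?_⟩
  rw [hM, neg_neg, div_div, div_le_iff₀ (by positivity)]
  calc ‖ν‖ ^ 2 ≤ (y * (‖w‖ * ‖x‖)) ^ 2 := by
        rw [e]
        gcongr
    _ = _ := by ring

end Weyl

/-! ### Weyl functions -/

namespace StarData

variable {ι : Type*} [Fintype ι] [DecidableEq ι] {P : StarData ι}

namespace FundamentalSystem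

/-- Initial data of the solutions that satisfy all boundary conditions except the one at `k`. -/
def weylSpace (F : P.FundamentalSystem) (k : ι ⊕ ι) (z : ℂ) : Submodule ℂ (ι ⊕ ι → ℂ) where
  carrier := {x | ∀ l, l ≠ k → F.boundaryMap z x l = 0}
  zero_mem' := fun l _ => by simp
  add_mem' := fun {x y} hx hy l hl => by simp [hx l hl, hy l hl]
  smul_mem' := fun a x hx l hl => by simp [hx l hl]

theorem mem_weylSpace (F : P.FundamentalSystem) (k : ι ⊕ ι) (z : ℂ) (x : ι ⊕ ι → ℂ) :
    x ∈ F.weylSpace k z ↔ ∀ l, l ≠ k → F.boundaryMap z x l = 0 := Iff.rfl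

theorem mem_weylSpace_iff_eq_single (F : P.FundamentalSystem) (k : ι ⊕ ι) (z : ℂ)
    (x : ι ⊕ ι → ℂ) : x ∈ F.weylSpace k z ↔
      F.boundaryMap z x = Pi.single k (F.boundaryMap z x k) := by
  rw [mem_weylSpace]
  constructor
  · intro h
    funext l
    rcases eq_or_ne l k with rfl | hl
    · simp
    · simp [h l hl, hl]
  · intro h l hl
    rw [h]
    simp [hl]

/-- `ν` is the conjugate boundary datum at the index `k` where the condition is of Dirichlet type:
Green's formula holds, and at real points the pair of data does not vanish identically. -/
structure IsConjugateDatum (F : P.FundamentalSystem) (k : ι ⊕ ι)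
    (ν : ℂ → (ι ⊕ ι → ℂ) →ₗ[ℂ] ℂ) : Prop where
  green : ∀ z w x y, x ∈ F.weylSpace k z → y ∈ F.weylSpace k w →
    ν z x * starRingEnd ℂ (F.boundaryMap w y k) - F.boundaryMap z x k * starRingEnd ℂ (ν w y) =
      (starRingEnd ℂ w - z) * inner ℂ (F.toL2 w y) (F.toL2 z x)
  exists_ne : ∀ lam : ℝ, (∃ x, F.boundaryMap lam x = Pi.single k 1) ∨
    ∃ x, F.boundaryMap lam x = 0 ∧ ν lam x ≠ 0
  diff : ∀ x, Differentiable ℂ fun z => ν z x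

/-- The Weyl function: the conjugate datum of the solution with unit boundary value at `k`. -/
noncomputable def weylFunction (F : P.FundamentalSystem) (k : ι ⊕ ι)
    (ν : ℂ → (ι ⊕ ι → ℂ) →ₗ[ℂ] ℂ) (z : ℂ) : ℂ :=
  ∑ l, (F.boundaryMatrix z).det⁻¹ * (F.boundaryMatrix z).adjugate l k * ν z (Pi.single l 1)

variable {F : P.FundamentalSystem} {k : ι ⊕ ι} {ν : ℂ → (ι ⊕ ι → ℂ) →ₗ[ℂ] ℂ}

theorem exists_boundaryMap_eq {z : ℂ} (hz : LinearMap.ker (F.boundaryMap z) = ⊥)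
    (w : ι ⊕ ι → ℂ) : ∃ x, F.boundaryMap z x = w :=
  LinearMap.surjective_of_injective (LinearMap.ker_eq_bot.1 hz) w

/-- Cramer's rule for the initial data. -/
theorem weylFunction_mul_eq {z : ℂ} (hz : LinearMap.ker (F.boundaryMap z) = ⊥) {x : ι ⊕ ι → ℂ}
    {f : ℂ} (hx : F.boundaryMap z x = Pi.single k f) : ν z x = F.weylFunction k ν z * f := by
  have hdet : IsUnit (F.boundaryMatrix z).det := isUnit_iff_ne_zero.2 ((F.det_ne_zero_iff z).2 hz)
  have hx' : x = (F.boundaryMatrix z)⁻¹.mulVec (Pi.single k f) := by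
    rw [← hx, ← F.boundaryMatrix_mulVec, Matrix.mulVec_mulVec, Matrix.nonsing_inv_mul _ hdet,
      Matrix.one_mulVec]
  have hl : ∀ l, x l = (F.boundaryMatrix z).det⁻¹ * (F.boundaryMatrix z).adjugate l k * f :=
    fun l => by
    rw [hx', Matrix.mulVec_single, Matrix.inv_def, Ring.inverse_eq_inv']
    simp [mul_comm]
  have hsum : ν z x = ∑ l, x l * ν z (Pi.single l 1) := by
    rw [LinearMap.pi_apply_eq_sum_univ (ν z) x]
    refine Finset.sum_congr rfl fun l _ => ?_
    rw [smul_eq_mul]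
    congr 2
    funext m
    simp [Pi.single_apply, eq_comm]
  rw [hsum, weylFunction, Finset.sum_mul]
  refine Finset.sum_congr rfl fun l _ => ?_
  rw [hl l]
  ring

theorem weylFunction_meromorphicAt (hP : P.Regular) (hν : F.IsConjugateDatum k ν) (z : ℂ) :
    MeromorphicAt (F.weylFunction k ν) z := by
  have hdet : MeromorphicAt (fun z => (F.boundaryMatrix z).det) z :=
    ((F.differentiable_det hP).analyticAt z).meromorphicAt
  have hadj : ∀ l, MeromorphicAt (fun z => (F.boundaryMatrix z).adjugate l k) z := fun l => by
    have : Differentiable ℂ fun z => (F.boundaryMatrix z).adjugate l k := by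
      simp only [Matrix.adjugate_apply]
      refine Matrix.differentiable_det fun a b => ?_
      simp only [Matrix.updateRow_apply]
      split_ifs
      · exact differentiable_const _
      · exact F.differentiable_boundaryMatrix hP a b
    exact (this.analyticAt z).meromorphicAt
  unfold weylFunction
  refine MeromorphicAt.fun_sum fun l _ => ?_
  exact (hdet.fun_inv.fun_mul (hadj l)).fun_mul ((hν.diff _).analyticAt z).meromorphicAt

theorem eventually_ker_boundaryMap_eq_bot (F : P.FundamentalSystem) (hP : P.Regular) (z₀ : ℂ) :
    ∀ᶠ z in 𝓝[≠] z₀, LinearMap.ker (F.boundaryMap z) = ⊥ := by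
  have han : AnalyticOnNhd ℂ (fun z => (F.boundaryMatrix z).det) univ :=
    fun z _ => (F.differentiable_det hP).analyticAt z
  rcases (han z₀ (mem_univ _)).eventually_eq_zero_or_eventually_ne_zero with h | h
  · exfalso
    have h0 := han.eqOn_zero_of_preconnected_of_eventuallyEq_zero isPreconnected_univ
      (mem_univ z₀) h (mem_univ Complex.I)
    exact (F.det_ne_zero_iff _).2 (F.ker_boundaryMap_eq_bot hP (by simp)) h0
  · filter_upwards [h] with z hz using (F.det_ne_zero_iff z).1 hz

theorem exists_weyl_solution (hP : P.Regular) (hν : F.IsConjugateDatum k ν) {z : ℂ}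
    (hz : z.im ≠ 0) : ∃ x, F.boundaryMap z x = Pi.single k 1 ∧ ν z x = F.weylFunction k ν z ∧
      0 < ‖F.toL2 z x‖ ∧ (F.weylFunction k ν z).im = -(z.im * ‖F.toL2 z x‖ ^ 2) := by
  have hker := F.ker_boundaryMap_eq_bot hP hz
  obtain ⟨x, hx⟩ := exists_boundaryMap_eq hker (Pi.single k 1)
  have hxν : ν z x = F.weylFunction k ν z := by rw [weylFunction_mul_eq hker hx, mul_one]
  refine ⟨x, hx, hxν, ?_, ?_⟩
  · rw [norm_pos_iff]
    intro h0
    have : x = 0 := F.toL2_injective hP z (h0.trans (map_zero _).symm)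
    rw [this, map_zero] at hx
    have := congrFun hx k
    simp at this
  · have hmem : x ∈ F.weylSpace k z := by
      rw [mem_weylSpace_iff_eq_single, hx, Pi.single_eq_same]
    have h := hν.green z z x x hmem hmem
    rw [hx, hxν, Pi.single_eq_same, map_one, mul_one, one_mul] at h
    exact im_eq_of_green h

theorem im_conjugate_eq_zero (hν : F.IsConjugateDatum k ν) {lam : ℝ} {w : ι ⊕ ι → ℂ}
    (hw : F.boundaryMap lam w = Pi.single k 1) : (ν lam w).im = 0 := by
  have hmem : w ∈ F.weylSpace k lam := by
    rw [mem_weylSpace_iff_eq_single, hw, Pi.single_eq_same]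
  have h := hν.green lam lam w w hmem hmem
  rw [hw, Pi.single_eq_same, map_one, mul_one, one_mul, Complex.conj_ofReal, sub_self,
    zero_mul, sub_eq_zero] at h
  exact Complex.conj_eq_iff_im.1 h.symm

theorem weylFunction_tendsto (hP : P.Regular) (hν : F.IsConjugateDatum k ν) {lam : ℝ}
    {w : ι ⊕ ι → ℂ} (hw : F.boundaryMap lam w = Pi.single k 1) :
    Tendsto (fun y : ℝ => F.weylFunction k ν ((lam : ℂ) + y * Complex.I)) (𝓝[>] 0)
      (𝓝 (ν lam w)) := by
  have him := im_conjugate_eq_zero hν hw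
  have hwmem : w ∈ F.weylSpace k lam := by
    rw [mem_weylSpace_iff_eq_single, hw, Pi.single_eq_same]
  have hle : ∀ᶠ y : ℝ in 𝓝[>] 0,
      ‖F.weylFunction k ν ((lam : ℂ) + y * Complex.I) - ν lam w‖ ≤ y * ‖F.toL2 lam w‖ ^ 2 := by
    filter_upwards [self_mem_nhdsWithin] with y hy
    have hy' : 0 < y := hy
    have hzim : ((lam : ℂ) + y * Complex.I).im = y := by simp
    obtain ⟨x, hx, hxν, -, hxim⟩ := exists_weyl_solution hP hν (z := (lam : ℂ) + y * Complex.I)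
      (by rw [hzim]; exact hy'.ne')
    have hmem : x ∈ F.weylSpace k ((lam : ℂ) + y * Complex.I) := by
      rw [mem_weylSpace_iff_eq_single, hx, Pi.single_eq_same]
    rw [hzim] at hxim
    refine norm_sub_le_of_green (lam := lam) hy' him hxim ?_
    have h := hν.green _ _ x w hmem hwmem
    rw [hx, hw, hxν, Pi.single_eq_same, map_one, mul_one, one_mul, Complex.conj_ofReal,
      Complex.conj_eq_iff_im.2 him] at h
    exact h
  rw [tendsto_iff_norm_sub_tendsto_zero]
  refine squeeze_zero' (Eventually.of_forall fun _ => norm_nonneg _) hle ?_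
  have : Tendsto (fun y : ℝ => y * ‖F.toL2 lam w‖ ^ 2) (𝓝 0) (𝓝 (0 * ‖F.toL2 lam w‖ ^ 2)) :=
    tendsto_id.mul_const _
  rw [zero_mul] at this
  exact this.mono_left nhdsWithin_le_nhds

theorem weylFunction_pole (hP : P.Regular) (hν : F.IsConjugateDatum k ν) {lam : ℝ}
    {w : ι ⊕ ι → ℂ} (hw : F.boundaryMap lam w = 0) (hw0 : ν lam w ≠ 0) :
    ∃ c : ℝ, 0 < c ∧ ∀ y : ℝ, 0 < y →
      c / y ≤ -(F.weylFunction k ν ((lam : ℂ) + y * Complex.I)).im := by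
  have hwmem : w ∈ F.weylSpace k lam := fun l _ => by rw [hw]; rfl
  have key : ∀ y : ℝ, 0 < y →
      0 < ‖-starRingEnd ℂ (ν lam w)‖ ^ 2 / ‖F.toL2 lam w‖ ^ 2 ∧
      ‖-starRingEnd ℂ (ν lam w)‖ ^ 2 / ‖F.toL2 lam w‖ ^ 2 / y ≤
        -(F.weylFunction k ν ((lam : ℂ) + y * Complex.I)).im := fun y hy => by
    have hzim : ((lam : ℂ) + y * Complex.I).im = y := by simp
    obtain ⟨x, hx, hxν, -, hxim⟩ := exists_weyl_solution hP hν (z := (lam : ℂ) + y * Complex.I)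
      (by rw [hzim]; exact hy.ne')
    have hmem : x ∈ F.weylSpace k ((lam : ℂ) + y * Complex.I) := by
      rw [mem_weylSpace_iff_eq_single, hx, Pi.single_eq_same]
    rw [hzim] at hxim
    have hne : -starRingEnd ℂ (ν lam w) ≠ 0 := by simpa using hw0
    refine div_le_neg_im_of_green (lam := lam) hy hne hxim (?_ : _ = _ * inner ℂ (F.toL2 lam w) _)
    have h := hν.green _ _ x w hmem hwmem
    rw [hx, hw, Pi.single_eq_same, Pi.zero_apply, map_zero, mul_zero, one_mul,
      Complex.conj_ofReal, zero_sub] at h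
    exact h
  exact ⟨_, (key 1 one_pos).1, fun y hy => (key y hy).2⟩

end FundamentalSystem

end StarData

/-! ### The two parts of a star graph cut at an interior point of an edge -/

/-- A scalar boundary condition `a u + b u' = 0` of self-adjoint type. -/
structure IsLocalBC (a b : ℂ) : Prop where
  symm : a * starRingEnd ℂ b = b * starRingEnd ℂ a
  ne : a ≠ 0 ∨ b ≠ 0

/-- Multiplied by `|a|²` or `|b|²`, the form is a combination of the two conditions and the symmetry
relation. The one-vertex version is needed since elements of `weylSpace` break the condition at one
index. -/
theorem IsLocalBC.form_eq_zero {a b : ℂ} (h : IsLocalBC a b) {u p v q : ℂ}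
    (hu : a * u + b * p = 0) (hv : a * v + b * q = 0) :
    p * starRingEnd ℂ v - u * starRingEnd ℂ q = 0 := by
  have hv' : starRingEnd ℂ a * starRingEnd ℂ v + starRingEnd ℂ b * starRingEnd ℂ q = 0 := by
    rw [← map_mul, ← map_mul, ← map_add, hv, map_zero]
  rcases h.ne with ha | hb
  · have ha' : starRingEnd ℂ a ≠ 0 := by simpa using ha
    have : a * starRingEnd ℂ a * (p * starRingEnd ℂ v - u * starRingEnd ℂ q) = 0 := by
      linear_combination a * p * hv' - starRingEnd ℂ a * starRingEnd ℂ q * hu -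
        p * starRingEnd ℂ q * h.symm
    exact (mul_eq_zero.1 this).resolve_left (mul_ne_zero ha ha')
  · have hb' : starRingEnd ℂ b ≠ 0 := by simpa using hb
    have : b * starRingEnd ℂ b * (p * starRingEnd ℂ v - u * starRingEnd ℂ q) = 0 := by
      linear_combination starRingEnd ℂ b * starRingEnd ℂ v * hu - u * b * hv' -
        u * starRingEnd ℂ v * h.symm
    exact (mul_eq_zero.1 this).resolve_left (mul_ne_zero hb hb')

section

variable {ι : Type*} [Fintype ι] [DecidableEq ι]

open scoped ComplexOrder in
theorem IsLagrangian.of_rank {A₁ A₂ : Matrix ι ι ℂ}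
    (hr : (Matrix.fromCols A₁ A₂).rank = Fintype.card ι)
    (hs : A₁ * A₂.conjTranspose = A₂ * A₁.conjTranspose) : IsLagrangian A₁ A₂ := by
  refine ⟨hs, fun y h1 h2 => ?_⟩
  have hr' : (Matrix.fromCols A₁ A₂).conjTranspose.rank = Fintype.card ι := by
    rw [Matrix.rank_conjTranspose, hr]
  have hk := LinearMap.finrank_range_add_finrank_ker
    (Matrix.fromCols A₁ A₂).conjTranspose.mulVecLin
  rw [Matrix.rank] at hr'
  rw [hr', Module.finrank_pi, Nat.add_eq_left, Submodule.finrank_eq_zero,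
    LinearMap.ker_eq_bot'] at hk
  refine hk y ?_
  rw [Matrix.mulVecLin_apply, Matrix.conjTranspose_fromCols_eq_fromRows_conjTranspose,
    Matrix.fromRows_mulVec, h1, h2]
  funext l
  rcases l with l | l <;> rfl

theorem isLagrangian_diagonal {a b : ι → ℂ} (h : ∀ i, IsLocalBC (a i) (b i)) :
    IsLagrangian (Matrix.diagonal a) (Matrix.diagonal b) := by
  refine ⟨?_, fun y h1 h2 => ?_⟩
  · rw [Matrix.diagonal_conjTranspose, Matrix.diagonal_conjTranspose, Matrix.diagonal_mul_diagonal,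
      Matrix.diagonal_mul_diagonal]
    congr 1
    funext i
    exact (h i).symm
  · funext i
    have e1 := congrFun h1 i
    have e2 := congrFun h2 i
    rw [Matrix.diagonal_conjTranspose, Matrix.mulVec_diagonal, Pi.zero_apply, mul_eq_zero] at e1 e2
    rcases (h i).ne with ha | hb
    · exact e1.resolve_left (by simpa using ha)
    · exact e2.resolve_left (by simpa using hb)

theorem IsLagrangian.isLocalBC {A₁ A₂ : Matrix ι ι ℂ} (h : IsLagrangian A₁ A₂) (h₁ : A₁.IsDiag)
    (h₂ : A₂.IsDiag) (i : ι) : IsLocalBC (A₁ i i) (A₂ i i) := by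
  rw [← h₁.diagonal_diag, ← h₂.diagonal_diag] at h
  constructor
  · have := congrFun (congrFun h.symm i) i
    simpa [Matrix.diagonal_conjTranspose, Matrix.diagonal_mul_diagonal] using this
  · by_contra hne
    push Not at hne
    have h0 := h.inj (Pi.single i 1) ?_ ?_
    · have := congrFun h0 i
      simp at this
    · funext l
      rw [Matrix.diagonal_conjTranspose, Matrix.mulVec_diagonal]
      rcases eq_or_ne l i with rfl | hl
      · simp [hne.1]
      · simp [hl]
    · funext l
      rw [Matrix.diagonal_conjTranspose, Matrix.mulVec_diagonal]
      rcases eq_or_ne l i with rfl | hl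
      · simp [hne.2]
      · simp [hl]

end

namespace StarData

variable {ι : Type*} [Fintype ι] [DecidableEq ι]

/-- A regular star graph with local outer conditions and a cutting point `s` on its edge `j`. -/
structure IsCut (P : StarData ι) (j : ι) (s : ℝ) : Prop where
  regular : P.Regular
  diag_β₁ : P.β₁.IsDiag
  diag_β₂ : P.β₂.IsDiag
  mem : s ∈ Ioo (P.left j) (P.right j)

variable {P : StarData ι} {j : ι} {s : ℝ}

namespace IsCut

theorem isLocalBC (h : P.IsCut j s) (i : ι) : IsLocalBC (P.β₁ i i) (P.β₂ i i) :=
  h.regular.lagrangian_β.isLocalBC h.diag_β₁ h.diag_β₂ i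

theorem innerPart_β₁ (h : P.IsCut j s) : (P.innerPart j s).β₁ =
    Matrix.diagonal (Function.update (fun i => P.β₁ i i) j 1) := by
  ext k l
  simp only [innerPart, Matrix.updateRow_apply, Matrix.diagonal_apply, Function.update_apply]
  split_ifs with h1 h2 h3
  · rw [← h2, h1, Pi.single_eq_same]
  · rw [Pi.single_eq_of_ne (fun e => h2 (h1.trans e.symm))]
  · rw [h3]
  · exact h.diag_β₁ h3

theorem innerPart_β₂ (h : P.IsCut j s) : (P.innerPart j s).β₂ =
    Matrix.diagonal (Function.update (fun i => P.β₂ i i) j 0) := by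
  ext k l
  simp only [innerPart, Matrix.updateRow_apply, Matrix.diagonal_apply, Function.update_apply]
  split_ifs with h1 h2 h3
  · rfl
  · rfl
  · rw [h3]
  · exact h.diag_β₂ h3

theorem left_lt_inner_right (h : P.IsCut j s) (i : ι) :
    P.left i < (P.innerPart j s).right i := by
  simp only [innerPart, Function.update_apply]
  split_ifs with hi
  · rw [hi]
    exact h.mem.1
  · exact h.regular.lt i

theorem inner_right_le (h : P.IsCut j s) (i : ι) : (P.innerPart j s).right i ≤ P.right i := by
  simp only [innerPart, Function.update_apply]
  split_ifs with hi
  · rw [hi]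
    exact h.mem.2.le
  · exact le_rfl

theorem inner_localBC (h : P.IsCut j s) (i : ι) :
    IsLocalBC (Function.update (fun i => P.β₁ i i) j 1 i)
      (Function.update (fun i => P.β₂ i i) j 0 i) := by
  rcases eq_or_ne i j with rfl | hi
  · rw [Function.update_self, Function.update_self]
    exact ⟨by simp, Or.inl one_ne_zero⟩
  · rw [Function.update_of_ne hi, Function.update_of_ne hi]
    exact h.isLocalBC i

theorem innerPart_regular (h : P.IsCut j s) : (P.innerPart j s).Regular where
  lt := h.left_lt_inner_right
  integrable i := (h.regular.integrable i).mono_set (by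
    change uIcc (P.left i) ((P.innerPart j s).right i) ⊆ _
    rw [uIcc_of_le (h.left_lt_inner_right i).le, uIcc_of_le (h.regular.lt i).le]
    exact Icc_subset_Icc le_rfl (h.inner_right_le i))
  lagrangian_α := h.regular.lagrangian_α
  lagrangian_β := by
    rw [h.innerPart_β₁, h.innerPart_β₂]
    exact isLagrangian_diagonal h.inner_localBC

theorem _root_.QuantumStar.matrix_fin_one_eq_diagonal (A : Matrix (Fin 1) (Fin 1) ℂ) :
    A = Matrix.diagonal fun _ => A 0 0 := by
  ext k l
  rw [Subsingleton.elim k 0, Subsingleton.elim l 0, Matrix.diagonal_apply_eq]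

theorem outerPart_regular (h : P.IsCut j s) : (P.outerPart j s).Regular where
  lt _ := h.mem.2
  integrable _ := (h.regular.integrable j).mono_set (by
    change uIcc s (P.right j) ⊆ _
    rw [uIcc_of_le h.mem.2.le, uIcc_of_le (h.regular.lt j).le]
    exact Icc_subset_Icc h.mem.1.le le_rfl)
  lagrangian_α := by
    have h1 : (P.outerPart j s).α₁ = Matrix.diagonal fun _ => 1 := Matrix.diagonal_one.symm
    have h2 : (P.outerPart j s).α₂ = Matrix.diagonal fun _ => 0 := Matrix.diagonal_zero.symm
    rw [h1, h2]
    exact isLagrangian_diagonal fun _ => ⟨by simp, Or.inl one_ne_zero⟩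
  lagrangian_β := by
    rw [matrix_fin_one_eq_diagonal (P.outerPart j s).β₁,
      matrix_fin_one_eq_diagonal (P.outerPart j s).β₂]
    exact isLagrangian_diagonal fun _ => h.isLocalBC j

end IsCut

theorem innerPart_right_same : (P.innerPart j s).right j = s := Function.update_self _ _ _

theorem innerPart_right_of_ne {i : ι} (hi : i ≠ j) : (P.innerPart j s).right i = P.right i :=
  Function.update_of_ne hi _ _

theorem IsCut.cut_mem (h : P.IsCut j s) :
    s ∈ Icc ((P.innerPart j s).left j) ((P.innerPart j s).right j) := by
  rw [innerPart_right_same]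
  exact ⟨h.mem.1.le, le_rfl⟩

namespace FundamentalSystem

/-- The conjugate datum of the inner part: the derivative at the cutting point. -/
def innerDatum (F : (P.innerPart j s).FundamentalSystem) (z : ℂ) : (ι ⊕ ι → ℂ) →ₗ[ℂ] ℂ where
  toFun x := F.der z x j s
  map_add' x y := by rw [F.der_add]; rfl
  map_smul' a x := by rw [F.der_smul]; rfl

/-- The conjugate datum of the outer part: minus the derivative at the cutting point. -/
def outerDatum : (Fin 1 ⊕ Fin 1 → ℂ) →ₗ[ℂ] ℂ := -LinearMap.proj (Sum.inr 0)

theorem inner_boundaryMap_inl (h : P.IsCut j s) (F : (P.innerPart j s).FundamentalSystem) (z : ℂ)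
    (x : ι ⊕ ι → ℂ) (i : ι) : F.boundaryMap z x (Sum.inl i) =
      Function.update (fun i => P.β₁ i i) j 1 i * F.sol z x i ((P.innerPart j s).right i) +
      Function.update (fun i => P.β₂ i i) j 0 i * F.der z x i ((P.innerPart j s).right i) := by
  rw [F.boundaryMap_apply, trace, h.innerPart_β₁, h.innerPart_β₂, Sum.elim_inl, Pi.add_apply,
    Matrix.mulVec_diagonal, Matrix.mulVec_diagonal]

theorem inner_boundaryMap_cut (h : P.IsCut j s) (F : (P.innerPart j s).FundamentalSystem) (z : ℂ)
    (x : ι ⊕ ι → ℂ) : F.boundaryMap z x (Sum.inl j) = F.sol z x j s := by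
  rw [F.inner_boundaryMap_inl h, innerPart_right_same, Function.update_self, Function.update_self]
  ring

theorem inner_boundaryMap_of_ne (h : P.IsCut j s) (F : (P.innerPart j s).FundamentalSystem)
    (z : ℂ) (x : ι ⊕ ι → ℂ) {i : ι} (hi : i ≠ j) : F.boundaryMap z x (Sum.inl i) =
      P.β₁ i i * F.sol z x i (P.right i) + P.β₂ i i * F.der z x i (P.right i) := by
  rw [F.inner_boundaryMap_inl h, innerPart_right_of_ne hi, Function.update_of_ne hi,
    Function.update_of_ne hi]

theorem boundaryMap_inr (F : P.FundamentalSystem) (z : ℂ) (x : ι ⊕ ι → ℂ) (i : ι) :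
    F.boundaryMap z x (Sum.inr i) = (P.α₁.mulVec (fun i => x (Sum.inl i)) +
      P.α₂.mulVec (fun i => x (Sum.inr i))) i := by
  rw [F.boundaryMap_apply, trace, Sum.elim_inr]
  simp only [F.sol_left, F.der_left]

/-- In Green's formula the central terms cancel together and the outer ones edge by edge, because
`β₁` and `β₂` are diagonal; only the terms at `s` survive. -/
theorem isConjugateDatum_inner (h : P.IsCut j s) (F : (P.innerPart j s).FundamentalSystem) :
    F.IsConjugateDatum (Sum.inl j) F.innerDatum where
  green z w x y hx hy := by
    have hg := F.green h.innerPart_regular z w x y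
    have hα : ∀ (z : ℂ) (x : ι ⊕ ι → ℂ), x ∈ F.weylSpace (Sum.inl j) z →
        (P.innerPart j s).α₁.mulVec (fun i => x (Sum.inl i)) +
          (P.innerPart j s).α₂.mulVec (fun i => x (Sum.inr i)) = 0 := fun z x hx => by
      funext i
      rw [← F.boundaryMap_inr z x i]
      exact hx _ (by simp)
    rw [h.innerPart_regular.lagrangian_α.form_eq_zero (hα z x hx) (hα w y hy), sub_zero,
      Finset.sum_eq_single j] at hg
    · rw [← hg, innerPart_right_same, F.inner_boundaryMap_cut h, F.inner_boundaryMap_cut h]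
      rfl
    · intro i _ hi
      rw [innerPart_right_of_ne hi]
      refine (h.isLocalBC i).form_eq_zero ?_ ?_
      · rw [← F.inner_boundaryMap_of_ne h z x hi]
        exact hx _ (by simpa using hi)
      · rw [← F.inner_boundaryMap_of_ne h w y hi]
        exact hy _ (by simpa using hi)
    · simp
  exists_ne lam := by
    rcases F.exists_boundaryMap_eq_single_or h.innerPart_regular lam (Sum.inl j) with h1 | h1
    · exact Or.inl h1
    · right
      obtain ⟨x, y, hy, hx, -, -, -, hd⟩ := h1
      refine ⟨x, hx, ?_⟩
      have h2 := hd j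
      rw [innerPart_right_same, h.innerPart_β₁, Matrix.diagonal_conjTranspose,
        Matrix.mulVec_diagonal] at h2
      change F.der lam x j s ≠ 0
      rw [h2]
      simpa using hy
  diff x := by
    exact F.der_diff x j h.cut_mem

theorem outer_boundaryMap_inl (F : (P.outerPart j s).FundamentalSystem) (z : ℂ)
    (x : Fin 1 ⊕ Fin 1 → ℂ) (i : Fin 1) : F.boundaryMap z x (Sum.inl i) =
      P.β₁ j j * F.sol z x 0 (P.right j) + P.β₂ j j * F.der z x 0 (P.right j) := by
  rw [F.boundaryMap_apply, trace, Sum.elim_inl, Pi.add_apply, Subsingleton.elim i 0]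
  simp [Matrix.mulVec, dotProduct, outerPart]

theorem outer_boundaryMap_inr (F : (P.outerPart j s).FundamentalSystem) (z : ℂ)
    (x : Fin 1 ⊕ Fin 1 → ℂ) (i : Fin 1) : F.boundaryMap z x (Sum.inr i) = x (Sum.inl 0) := by
  rw [F.boundaryMap_inr, Subsingleton.elim i 0]
  simp [outerPart]

theorem isConjugateDatum_outer (h : P.IsCut j s) (F : (P.outerPart j s).FundamentalSystem) :
    F.IsConjugateDatum (Sum.inr 0) fun _ => outerDatum where
  green z w x y hx hy := by
    have hg := F.green h.outerPart_regular z w x y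
    rw [Fin.sum_univ_one, Fin.sum_univ_one] at hg
    have h0 : F.der z x 0 (P.right j) * starRingEnd ℂ (F.sol w y 0 (P.right j)) -
        F.sol z x 0 (P.right j) * starRingEnd ℂ (F.der w y 0 (P.right j)) = 0 := by
      refine (h.isLocalBC j).form_eq_zero ?_ ?_
      · rw [← F.outer_boundaryMap_inl z x 0]
        exact hx _ (by simp)
      · rw [← F.outer_boundaryMap_inl w y 0]
        exact hy _ (by simp)
    have er : (P.outerPart j s).right 0 = P.right j := rfl
    rw [er] at hg
    rw [← hg, F.outer_boundaryMap_inr, F.outer_boundaryMap_inr]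
    have e1 : outerDatum x = -x (Sum.inr 0) := rfl
    have e2 : outerDatum y = -y (Sum.inr 0) := rfl
    rw [e1, e2, map_neg]
    linear_combination -h0
  exists_ne lam := by
    rcases F.exists_boundaryMap_eq_single_or h.outerPart_regular lam (Sum.inr 0) with h1 | h1
    · exact Or.inl h1
    · right
      obtain ⟨x, y, hy, hx, -, hd, -, -⟩ := h1
      refine ⟨x, hx, ?_⟩
      have h2 := hd 0
      have e1 : outerDatum x = -x (Sum.inr 0) := rfl
      rw [e1, h2]
      simpa [outerPart] using hy
  diff x := differentiable_const _

end FundamentalSystem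

/-! ### The one-sided maps as Weyl functions -/

theorem epsilon_eq_of_unique {α : Type*} [Nonempty α] {q : α → Prop} {c : α} (hc : q c)
    (hu : ∀ c', q c' → c' = c) : Classical.epsilon q = c :=
  hu _ (Classical.epsilon_spec ⟨c, hc⟩)

/-- Off the eigenvalues a solution exists and all solutions yield the same number, so
`Classical.epsilon` returns that number. -/
theorem M₁_eq (h : P.IsCut j s) (F : (P.outerPart j s).FundamentalSystem) {z : ℂ}
    (hz : LinearMap.ker (F.boundaryMap z) = ⊥) (f : ℂ) :
    P.M₁ j s z f = F.weylFunction (Sum.inr 0) (fun _ => FundamentalSystem.outerDatum) z * f := by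
  have hval : ∀ u p, (P.outerPart j s).Solves z (outerValue f) u p →
      -p 0 s = F.weylFunction (Sum.inr 0) (fun _ => FundamentalSystem.outerDatum) z * f :=
    fun u p hs => F.weylFunction_mul_eq (ν := fun _ => FundamentalSystem.outerDatum) hz
      (F.boundaryMap_initial h.outerPart_regular hs)
  obtain ⟨u, p, hs, -⟩ := F.uniquelySolvable h.outerPart_regular hz (outerValue f)
  refine epsilon_eq_of_unique ⟨u, p, hs, (hval u p hs).symm⟩ ?_
  rintro _ ⟨u', p', hs', rfl⟩
  exact hval u' p' hs'

theorem M₂_eq (h : P.IsCut j s) (F : (P.innerPart j s).FundamentalSystem) {z : ℂ}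
    (hz : LinearMap.ker (F.boundaryMap z) = ⊥) (f : ℂ) :
    P.M₂ j s z f = F.weylFunction (Sum.inl j) F.innerDatum z * f := by
  have hval : ∀ u p, (P.innerPart j s).Solves z (innerValue j f) u p →
      p j s = F.weylFunction (Sum.inl j) F.innerDatum z * f := fun u p hs => by
    have h1 := F.eq_sol h.innerPart_regular hs.1 j s h.cut_mem
    rw [h1.2]
    exact F.weylFunction_mul_eq (ν := F.innerDatum) hz
      (F.boundaryMap_initial h.innerPart_regular hs)
  obtain ⟨u, p, hs, -⟩ := F.uniquelySolvable h.innerPart_regular hz (innerValue j f)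
  refine epsilon_eq_of_unique ⟨u, p, hs, (hval u p hs).symm⟩ ?_
  rintro _ ⟨u', p', hs', rfl⟩
  exact hval u' p' hs'

end StarData

/-! ### The local counting formula -/

theorem finrank_eq_finrank_add_one {V : Type*} [AddCommGroup V] [Module ℂ V]
    [FiniteDimensional ℂ V] {K U : Submodule ℂ V} (hKU : K ≤ U) {w : V} (hwU : w ∈ U)
    (hwK : w ∉ K) (h : ∀ x ∈ U, ∃ t : ℂ, x - t • w ∈ K) :
    Module.finrank ℂ U = Module.finrank ℂ K + 1 := by
  have hU : U = K ⊔ Submodule.span ℂ {w} := by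
    refine le_antisymm (fun x hx => ?_) (sup_le hKU ?_)
    · obtain ⟨t, ht⟩ := h x hx
      rw [Submodule.mem_sup]
      exact ⟨_, ht, t • w, Submodule.smul_mem _ t (Submodule.mem_span_singleton_self w),
        sub_add_cancel _ _⟩
    · rw [Submodule.span_singleton_le_iff_mem]
      exact hwU
  have hinf : K ⊓ Submodule.span ℂ {w} = ⊥ := by
    rw [eq_bot_iff]
    rintro x ⟨hxK, hxw⟩
    obtain ⟨t, rfl⟩ := Submodule.mem_span_singleton.1 hxw
    rcases eq_or_ne t 0 with rfl | ht
    · simp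
    · exact absurd ((Submodule.smul_mem_iff K ht).1 hxK) hwK
  have hw0 : w ≠ 0 := fun h0 => hwK (h0 ▸ K.zero_mem)
  have := Submodule.finrank_sup_add_finrank_inf_eq K (Submodule.span ℂ {w})
  rw [hinf, finrank_bot, add_zero, finrank_span_singleton hw0, ← hU] at this
  exact this

namespace StarData

variable {ι : Type*} [Fintype ι] [DecidableEq ι] {P : StarData ι}

namespace FundamentalSystem

section Conjugate

variable {F : P.FundamentalSystem} {k : ι ⊕ ι} {ν : ℂ → (ι ⊕ ι → ℂ) →ₗ[ℂ] ℂ} {lam : ℝ}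
  {w x : ι ⊕ ι → ℂ}

theorem ker_boundaryMap_le_weylSpace (F : P.FundamentalSystem) (k : ι ⊕ ι) (z : ℂ) :
    LinearMap.ker (F.boundaryMap z) ≤ F.weylSpace k z := fun x hx l _ => by
  rw [LinearMap.mem_ker.1 hx]
  rfl

theorem mem_ker_of_mem_weylSpace {z : ℂ} (hx : x ∈ F.weylSpace k z)
    (h0 : F.boundaryMap z x k = 0) : x ∈ LinearMap.ker (F.boundaryMap z) := by
  rw [LinearMap.mem_ker, (mem_weylSpace_iff_eq_single F k z x).1 hx, h0, Pi.single_zero]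

theorem mem_weylSpace_of_eq_single {z : ℂ} (hw : F.boundaryMap z w = Pi.single k 1) :
    w ∈ F.weylSpace k z := by
  rw [mem_weylSpace_iff_eq_single, hw, Pi.single_eq_same]

/-- Green's formula at a real point against `w`: the pair of data of `x` is proportional to the pair
`(1, ν w)`. -/
theorem conjugate_eq_mul (hν : F.IsConjugateDatum k ν)
    (hw : F.boundaryMap lam w = Pi.single k 1) (hx : x ∈ F.weylSpace k lam) :
    ν lam x = F.boundaryMap lam x k * ν lam w := by
  have h := hν.green lam lam x w hx (mem_weylSpace_of_eq_single hw)
  rw [hw, Pi.single_eq_same, map_one, mul_one, Complex.conj_ofReal, sub_self, zero_mul,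
    Complex.conj_eq_iff_im.2 (im_conjugate_eq_zero hν hw)] at h
  exact sub_eq_zero.1 h

theorem boundaryMap_eq_zero_of_conjugate_ne_zero (hν : F.IsConjugateDatum k ν)
    (hw : F.boundaryMap lam w = 0) (hw0 : ν lam w ≠ 0) (hx : x ∈ F.weylSpace k lam) :
    F.boundaryMap lam x k = 0 := by
  have h := hν.green lam lam x w hx (F.ker_boundaryMap_le_weylSpace k lam hw)
  rw [hw, Pi.zero_apply, map_zero, mul_zero, Complex.conj_ofReal, sub_self, zero_mul, zero_sub,
    neg_eq_zero, mul_eq_zero] at h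
  exact h.resolve_right (by simpa using hw0)

theorem exists_sub_smul_mem_of_eq_single (hν : F.IsConjugateDatum k ν)
    (hw : F.boundaryMap lam w = Pi.single k 1) (hx : x ∈ F.weylSpace k lam) :
    ∃ t : ℂ, x - t • w ∈ LinearMap.ker (F.boundaryMap lam) ⊓ LinearMap.ker (ν lam) := by
  refine ⟨F.boundaryMap lam x k, mem_ker_of_mem_weylSpace (k := k)
    (sub_mem hx (Submodule.smul_mem _ _ (mem_weylSpace_of_eq_single hw))) ?_, ?_⟩
  · rw [map_sub, map_smul, Pi.sub_apply, Pi.smul_apply, hw, Pi.single_eq_same, smul_eq_mul,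
      mul_one, sub_self]
  · rw [SetLike.mem_coe, LinearMap.mem_ker, map_sub, map_smul, conjugate_eq_mul hν hw hx,
      smul_eq_mul, sub_self]

theorem exists_sub_smul_mem_of_conjugate_ne_zero (hν : F.IsConjugateDatum k ν)
    (hw : F.boundaryMap lam w = 0) (hw0 : ν lam w ≠ 0) (hx : x ∈ F.weylSpace k lam) :
    ∃ t : ℂ, x - t • w ∈ LinearMap.ker (F.boundaryMap lam) ⊓ LinearMap.ker (ν lam) := by
  refine ⟨ν lam x / ν lam w, ?_, ?_⟩
  · exact sub_mem (mem_ker_of_mem_weylSpace hx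
      (boundaryMap_eq_zero_of_conjugate_ne_zero hν hw hw0 hx)) (Submodule.smul_mem _ _ hw)
  · rw [SetLike.mem_coe, LinearMap.mem_ker, map_sub, map_smul, smul_eq_mul, div_mul_cancel₀ _ hw0,
      sub_self]

theorem ker_eq_inf_of_eq_single (hν : F.IsConjugateDatum k ν)
    (hw : F.boundaryMap lam w = Pi.single k 1) :
    LinearMap.ker (F.boundaryMap lam) =
      LinearMap.ker (F.boundaryMap lam) ⊓ LinearMap.ker (ν lam) := by
  refine (inf_eq_left.2 fun x hx => ?_).symm
  rw [LinearMap.mem_ker, conjugate_eq_mul hν hw (F.ker_boundaryMap_le_weylSpace k lam hx),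
    LinearMap.mem_ker.1 hx, Pi.zero_apply, zero_mul]

theorem ker_eq_weylSpace_of_conjugate_ne_zero (hν : F.IsConjugateDatum k ν)
    (hw : F.boundaryMap lam w = 0) (hw0 : ν lam w ≠ 0) :
    LinearMap.ker (F.boundaryMap lam) = F.weylSpace k lam :=
  le_antisymm (F.ker_boundaryMap_le_weylSpace k lam) fun _ hx =>
    mem_ker_of_mem_weylSpace hx (boundaryMap_eq_zero_of_conjugate_ne_zero hν hw hw0 hx)

theorem finrank_weylSpace_of_eq_single (hν : F.IsConjugateDatum k ν)
    (hw : F.boundaryMap lam w = Pi.single k 1) : Module.finrank ℂ (F.weylSpace k lam) =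
      Module.finrank ℂ ↥(LinearMap.ker (F.boundaryMap lam) ⊓ LinearMap.ker (ν lam)) + 1 := by
  refine finrank_eq_finrank_add_one (inf_le_left.trans (F.ker_boundaryMap_le_weylSpace k lam))
    (mem_weylSpace_of_eq_single hw) (fun h => ?_)
    (fun x hx => exists_sub_smul_mem_of_eq_single hν hw hx)
  have h1 : F.boundaryMap lam w = 0 := h.1
  rw [hw] at h1
  have := congrFun h1 k
  simp at this

theorem finrank_weylSpace_of_conjugate_ne_zero (hν : F.IsConjugateDatum k ν)
    (hw : F.boundaryMap lam w = 0) (hw0 : ν lam w ≠ 0) :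
    Module.finrank ℂ (F.weylSpace k lam) =
      Module.finrank ℂ ↥(LinearMap.ker (F.boundaryMap lam) ⊓ LinearMap.ker (ν lam)) + 1 :=
  finrank_eq_finrank_add_one (inf_le_left.trans (F.ker_boundaryMap_le_weylSpace k lam))
    (F.ker_boundaryMap_le_weylSpace k lam hw) (fun h => hw0 h.2)
    (fun _ hx => exists_sub_smul_mem_of_conjugate_ne_zero hν hw hw0 hx)

end Conjugate

variable {j : ι} {s : ℝ}

theorem outer_ker_inf_eq_bot (F : (P.outerPart j s).FundamentalSystem) (z : ℂ) :
    LinearMap.ker (F.boundaryMap z) ⊓ LinearMap.ker outerDatum = ⊥ := by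
  rw [eq_bot_iff]
  rintro y ⟨h1, h2⟩
  have e1 : y (Sum.inl 0) = 0 := by
    rw [← F.outer_boundaryMap_inr z y 0, LinearMap.mem_ker.1 h1]
    rfl
  have e2 : y (Sum.inr 0) = 0 := neg_eq_zero.1 h2
  rw [Submodule.mem_bot]
  funext l
  rcases l with l | l
  · rw [Subsingleton.elim l 0, e1, Pi.zero_apply]
  · rw [Subsingleton.elim l 0, e2, Pi.zero_apply]

/-- The restriction of a fundamental system to the inner part. -/
def toInner (F : P.FundamentalSystem) (h : P.IsCut j s) : (P.innerPart j s).FundamentalSystem :=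
  have hm : ∀ i, Icc ((P.innerPart j s).left i) ((P.innerPart j s).right i) ⊆
    Icc (P.left i) (P.right i) := fun i => Icc_subset_Icc le_rfl (h.inner_right_le i)
  { c := F.c
    dc := F.dc
    s := F.s
    ds := F.ds
    c_ac := fun i z => (F.c_ac i z).mono le_rfl (h.inner_right_le i) (h.left_lt_inner_right i).le
    dc_ac := fun i z => (F.dc_ac i z).mono le_rfl (h.inner_right_le i) (h.left_lt_inner_right i).le
    s_ac := fun i z => (F.s_ac i z).mono le_rfl (h.inner_right_le i) (h.left_lt_inner_right i).le
    ds_ac := fun i z => (F.ds_ac i z).mono le_rfl (h.inner_right_le i) (h.left_lt_inner_right i).le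
    c_left := F.c_left
    dc_left := F.dc_left
    s_left := F.s_left
    ds_left := F.ds_left
    c_diff := fun i x hx => F.c_diff i x (hm i hx)
    dc_diff := fun i x hx => F.dc_diff i x (hm i hx)
    s_diff := fun i x hx => F.s_diff i x (hm i hx)
    ds_diff := fun i x hx => F.ds_diff i x (hm i hx) }

theorem toInner_sol (F : P.FundamentalSystem) (h : P.IsCut j s) (z : ℂ) (x : ι ⊕ ι → ℂ) :
    (F.toInner h).sol z x = F.sol z x := rfl

theorem toInner_der (F : P.FundamentalSystem) (h : P.IsCut j s) (z : ℂ) (x : ι ⊕ ι → ℂ) :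
    (F.toInner h).der z x = F.der z x := rfl

/-- The data of a solution at the cutting point. -/
def cutData (F : P.FundamentalSystem) (j : ι) (s : ℝ) (z : ℂ) :
    (ι ⊕ ι → ℂ) →ₗ[ℂ] (Fin 1 ⊕ Fin 1 → ℂ) where
  toFun x := Sum.elim (fun _ => F.sol z x j s) (fun _ => F.der z x j s)
  map_add' x y := by
    rw [F.sol_add, F.der_add]
    funext l
    rcases l with l | l <;> rfl
  map_smul' a x := by
    rw [F.sol_smul, F.der_smul]
    funext l
    rcases l with l | l <;> rfl

theorem boundaryMap_inl_of_isCut (h : P.IsCut j s) (F : P.FundamentalSystem) (z : ℂ)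
    (x : ι ⊕ ι → ℂ) (i : ι) : F.boundaryMap z x (Sum.inl i) =
      P.β₁ i i * F.sol z x i (P.right i) + P.β₂ i i * F.der z x i (P.right i) := by
  have e1 : P.β₁ = Matrix.diagonal fun i => P.β₁ i i := h.diag_β₁.diagonal_diag.symm
  have e2 : P.β₂ = Matrix.diagonal fun i => P.β₂ i i := h.diag_β₂.diagonal_diag.symm
  rw [F.boundaryMap_apply, trace, Sum.elim_inl, Pi.add_apply, e1, e2, Matrix.mulVec_diagonal,
    Matrix.mulVec_diagonal]
  simp only [Matrix.diagonal_apply_eq]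

theorem boundaryMap_cut_edge (h : P.IsCut j s) (F : P.FundamentalSystem)
    (F₁ : (P.outerPart j s).FundamentalSystem) (z : ℂ) (x : ι ⊕ ι → ℂ) :
    F.boundaryMap z x (Sum.inl j) = F₁.boundaryMap z (F.cutData j s z x) (Sum.inl 0) := by
  have hd : (P.outerPart j s).IsTwiceDiff (fun _ => F.sol z x j) (fun _ => F.der z x j)
      (fun i t => (((P.outerPart j s).V i t : ℂ) - z) * F.sol z x j t) := fun i =>
    ⟨(F.isTwiceDiff z x j).1.mono h.mem.1.le le_rfl h.mem.2.le,
      (F.isTwiceDiff z x j).2.mono h.mem.1.le le_rfl h.mem.2.le⟩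
  have e := F₁.eq_sol h.outerPart_regular hd 0 (P.right j) ⟨h.mem.2.le, le_rfl⟩
  have hi : initial (P.outerPart j s) (fun _ => F.sol z x j) (fun _ => F.der z x j) =
      F.cutData j s z x := rfl
  rw [hi] at e
  rw [F.boundaryMap_inl_of_isCut h, F₁.outer_boundaryMap_inl, ← e.1, ← e.2]

theorem boundaryMap_eq_toInner (h : P.IsCut j s) (F : P.FundamentalSystem) (z : ℂ)
    (x : ι ⊕ ι → ℂ) {l : ι ⊕ ι} (hl : l ≠ Sum.inl j) :
    F.boundaryMap z x l = (F.toInner h).boundaryMap z x l := by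
  rcases l with i | i
  · have hi : i ≠ j := fun e => hl (by rw [e])
    rw [F.boundaryMap_inl_of_isCut h, (F.toInner h).inner_boundaryMap_of_ne h z x hi,
      toInner_sol, toInner_der]
  · rw [F.boundaryMap_inr, (F.toInner h).boundaryMap_inr]
    rfl

/-- Gluing: `toInner` keeps the initial data, so the same `x` describes the solution on `Ω` and on
`Ω₂`, and its continuation to `Ω₁` has initial data `cutData`. -/
theorem mem_ker_boundaryMap_iff (h : P.IsCut j s) (F : P.FundamentalSystem)
    (F₁ : (P.outerPart j s).FundamentalSystem) (z : ℂ) (x : ι ⊕ ι → ℂ) :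
    x ∈ LinearMap.ker (F.boundaryMap z) ↔ x ∈ (F.toInner h).weylSpace (Sum.inl j) z ∧
      F.cutData j s z x ∈ F₁.weylSpace (Sum.inr 0) z := by
  have h1 : F.cutData j s z x ∈ F₁.weylSpace (Sum.inr 0) z ↔ F.boundaryMap z x (Sum.inl j) = 0 := by
    rw [F.boundaryMap_cut_edge h F₁, mem_weylSpace]
    constructor
    · exact fun h => h _ (by simp)
    · intro h l hl
      rcases l with l | l
      · rw [Subsingleton.elim l 0]
        exact h
      · exact absurd (by rw [Subsingleton.elim l 0]) hl
  rw [h1, LinearMap.mem_ker, mem_weylSpace]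
  constructor
  · intro h0
    refine ⟨fun l hl => ?_, by rw [h0]; rfl⟩
    rw [← F.boundaryMap_eq_toInner h z x hl, h0, Pi.zero_apply]
  · rintro ⟨h2, h3⟩
    funext l
    rcases eq_or_ne l (Sum.inl j) with rfl | hl
    · exact h3
    · rw [F.boundaryMap_eq_toInner h z x hl, h2 l hl, Pi.zero_apply]

theorem cutData_eq_zero (h : P.IsCut j s) (F : P.FundamentalSystem) {z : ℂ} {x : ι ⊕ ι → ℂ}
    (hx : x ∈ LinearMap.ker ((F.toInner h).boundaryMap z) ⊓
      LinearMap.ker ((F.toInner h).innerDatum z)) : F.cutData j s z x = 0 := by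
  have e1 : F.sol z x j s = 0 := by
    rw [← F.toInner_sol h, ← (F.toInner h).inner_boundaryMap_cut h, LinearMap.mem_ker.1 hx.1]
    rfl
  have e2 : F.der z x j s = 0 := hx.2
  funext l
  rcases l with l | l
  · exact e1
  · exact e2

/-- Modulo solutions with zero data at `s`, the space is spanned by `w`, so only the continuation of
`w` to `Ω₁` has to be tested. The next lemma is the opposite case. -/
theorem ker_boundaryMap_eq_weylSpace (h : P.IsCut j s) (F : P.FundamentalSystem)
    (F₁ : (P.outerPart j s).FundamentalSystem) {z : ℂ} {w : ι ⊕ ι → ℂ}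
    (hdec : ∀ x ∈ (F.toInner h).weylSpace (Sum.inl j) z, ∃ t : ℂ, x - t • w ∈
      LinearMap.ker ((F.toInner h).boundaryMap z) ⊓ LinearMap.ker ((F.toInner h).innerDatum z))
    (hw : F.cutData j s z w ∈ F₁.weylSpace (Sum.inr 0) z) :
    LinearMap.ker (F.boundaryMap z) = (F.toInner h).weylSpace (Sum.inl j) z := by
  ext x
  rw [F.mem_ker_boundaryMap_iff h F₁]
  refine ⟨fun hx => hx.1, fun hx => ⟨hx, ?_⟩⟩
  obtain ⟨t, ht⟩ := hdec x hx
  have h0 := F.cutData_eq_zero h ht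
  rw [map_sub, map_smul, sub_eq_zero] at h0
  rw [h0]
  exact Submodule.smul_mem _ t hw

theorem ker_boundaryMap_eq_inf (h : P.IsCut j s) (F : P.FundamentalSystem)
    (F₁ : (P.outerPart j s).FundamentalSystem) {z : ℂ} {w : ι ⊕ ι → ℂ}
    (hdec : ∀ x ∈ (F.toInner h).weylSpace (Sum.inl j) z, ∃ t : ℂ, x - t • w ∈
      LinearMap.ker ((F.toInner h).boundaryMap z) ⊓ LinearMap.ker ((F.toInner h).innerDatum z))
    (hw : F.cutData j s z w ∉ F₁.weylSpace (Sum.inr 0) z) :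
    LinearMap.ker (F.boundaryMap z) = LinearMap.ker ((F.toInner h).boundaryMap z) ⊓
      LinearMap.ker ((F.toInner h).innerDatum z) := by
  ext x
  rw [F.mem_ker_boundaryMap_iff h F₁]
  constructor
  · rintro ⟨hx, hx1⟩
    obtain ⟨t, ht⟩ := hdec x hx
    have h0 := F.cutData_eq_zero h ht
    rw [map_sub, map_smul, sub_eq_zero] at h0
    rw [h0] at hx1
    have ht0 : t = 0 := by
      by_contra ht0
      exact hw ((Submodule.smul_mem_iff _ ht0).1 hx1)
    rwa [ht0, zero_smul, sub_zero] at ht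
  · intro hx
    refine ⟨(F.toInner h).ker_boundaryMap_le_weylSpace _ _ hx.1, ?_⟩
    rw [F.cutData_eq_zero h hx]
    exact Submodule.zero_mem _

end FundamentalSystem

variable {j : ι} {s : ℝ}

/-- The default values at eigenvalues are harmless: they occur only at isolated points, and
meromorphic orders depend only on punctured neighbourhoods. -/
theorem twoSidedMap_eventuallyEq (h : P.IsCut j s) (F₁ : (P.outerPart j s).FundamentalSystem)
    (F₂ : (P.innerPart j s).FundamentalSystem) (z : ℂ) :
    P.twoSidedMap j s =ᶠ[𝓝[≠] z]
      F₁.weylFunction (Sum.inr 0) (fun _ => FundamentalSystem.outerDatum) +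
        F₂.weylFunction (Sum.inl j) F₂.innerDatum := by
  filter_upwards [F₁.eventually_ker_boundaryMap_eq_bot h.outerPart_regular z,
    F₂.eventually_ker_boundaryMap_eq_bot h.innerPart_regular z] with w h1 h2
  rw [twoSidedMap, M₁_eq h F₁ h1, M₂_eq h F₂ h2, mul_one, mul_one, Pi.add_apply]

section Sum

variable (F₁ : (P.outerPart j s).FundamentalSystem)
  (F₂ : (P.innerPart j s).FundamentalSystem)

theorem weylSum_meromorphicAt (h : P.IsCut j s) (z : ℂ) :
    MeromorphicAt (F₁.weylFunction (Sum.inr 0) (fun _ => FundamentalSystem.outerDatum) +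
      F₂.weylFunction (Sum.inl j) F₂.innerDatum) z :=
  (F₁.weylFunction_meromorphicAt h.outerPart_regular (F₁.isConjugateDatum_outer h) z).add
    (F₂.weylFunction_meromorphicAt h.innerPart_regular (F₂.isConjugateDatum_inner h) z)

theorem weylSum_im_mul_neg (h : P.IsCut j s) {z : ℂ} (hz : z.im ≠ 0) :
    z.im * ((F₁.weylFunction (Sum.inr 0) (fun _ => FundamentalSystem.outerDatum) +
      F₂.weylFunction (Sum.inl j) F₂.innerDatum) z).im < 0 := by
  obtain ⟨x, -, -, hx, ex⟩ := FundamentalSystem.exists_weyl_solution h.outerPart_regular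
    (F₁.isConjugateDatum_outer h) hz
  obtain ⟨y, -, -, hy, ey⟩ := FundamentalSystem.exists_weyl_solution h.innerPart_regular
    (F₂.isConjugateDatum_inner h) hz
  rw [Pi.add_apply, Complex.add_im, ex, ey]
  have : 0 < z.im ^ 2 := by positivity
  nlinarith [mul_pos this (pow_pos hx 2), mul_pos this (pow_pos hy 2)]

theorem weylSum_order_ne_top (h : P.IsCut j s) (z : ℂ) :
    meromorphicOrderAt (F₁.weylFunction (Sum.inr 0) (fun _ => FundamentalSystem.outerDatum) +
      F₂.weylFunction (Sum.inl j) F₂.innerDatum) z ≠ ⊤ := by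
  intro htop
  rw [meromorphicOrderAt_eq_top_iff] at htop
  have h1 := (tendsto_vertical z).eventually htop
  -- The vertical half-line meets the real axis at most once; elsewhere the sum has nonzero
  -- imaginary part.
  have h2 : ∀ᶠ y : ℝ in 𝓝[>] 0, y ≠ -z.im := by
    rcases eq_or_ne (-z.im) 0 with h0 | h0
    · filter_upwards [self_mem_nhdsWithin] with y hy
      rw [h0]
      exact ne_of_gt hy
    · exact nhdsWithin_le_nhds (eventually_ne_nhds h0.symm)
  obtain ⟨y, hy1, hy2⟩ := (h1.and h2).exists
  have hz : (z + y * Complex.I).im ≠ 0 := by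
    have e : (z + y * Complex.I).im = z.im + y := by simp
    rw [e]
    intro h0
    exact hy2 (by linarith)
  have h3 := weylSum_im_mul_neg F₁ F₂ h hz
  rw [hy1, Complex.zero_im, mul_zero] at h3
  exact lt_irrefl _ h3

set_option maxHeartbeats 1000000 in
theorem finrank_ker_boundaryMap_eq (h : P.IsCut j s) (F : P.FundamentalSystem) (lam : ℝ) :
    (Module.finrank ℂ (LinearMap.ker (F.boundaryMap lam)) : ℤ) =
      Module.finrank ℂ (LinearMap.ker (F₁.boundaryMap lam)) +
      Module.finrank ℂ (LinearMap.ker ((F.toInner h).boundaryMap lam)) +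
      (meromorphicOrderAt (F₁.weylFunction (Sum.inr 0) (fun _ => FundamentalSystem.outerDatum) +
        (F.toInner h).weylFunction (Sum.inl j) (F.toInner h).innerDatum) lam).untop₀ := by
  set F₂ := F.toInner h with hF₂
  have hν₁ := F₁.isConjugateDatum_outer h
  have hν₂ := F₂.isConjugateDatum_inner h
  have hmer := weylSum_meromorphicAt F₁ F₂ h lam
  have htop := weylSum_order_ne_top F₁ F₂ h lam
  have him : ∀ z : ℂ, 0 < z.im →
      ((F₁.weylFunction (Sum.inr 0) (fun _ => FundamentalSystem.outerDatum) +
        F₂.weylFunction (Sum.inl j) F₂.innerDatum) z).im ≤ 0 := fun z hz =>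
    (neg_of_mul_neg_right (weylSum_im_mul_neg F₁ F₂ h hz.ne') hz.le).le
  have him₁ : ∀ z : ℂ, 0 < z.im →
      (F₁.weylFunction (Sum.inr 0) (fun _ => FundamentalSystem.outerDatum) z).im ≤ 0 :=
    fun z hz => by
    obtain ⟨x, -, -, -, e⟩ := FundamentalSystem.exists_weyl_solution h.outerPart_regular hν₁ hz.ne'
    rw [e]
    exact neg_nonpos.2 (by positivity)
  have him₂ : ∀ z : ℂ, 0 < z.im → (F₂.weylFunction (Sum.inl j) F₂.innerDatum z).im ≤ 0 :=
    fun z hz => by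
    obtain ⟨x, -, -, -, e⟩ := FundamentalSystem.exists_weyl_solution h.innerPart_regular hν₂ hz.ne'
    rw [e]
    exact neg_nonpos.2 (by positivity)
  have himy : ∀ y : ℝ, 0 < y → 0 < ((lam : ℂ) + y * Complex.I).im := fun y hy => by simpa using hy
  have hbot : Module.finrank ℂ ↥(LinearMap.ker (F₁.boundaryMap lam) ⊓
      LinearMap.ker FundamentalSystem.outerDatum) = 0 := by
    rw [F₁.outer_ker_inf_eq_bot, finrank_bot]
  have hcut : ∀ w, F.cutData j s lam w (Sum.inl 0) = F₂.boundaryMap lam w (Sum.inl j) := fun w => by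
    rw [F₂.inner_boundaryMap_cut h]
    rfl
  have hcut' : ∀ w, F.cutData j s lam w (Sum.inr 0) = F₂.innerDatum lam w := fun w => rfl
  rcases hν₁.exists_ne lam with ⟨w₁, hw₁⟩ | ⟨w₁, hw₁, hw₁'⟩ <;>
    rcases hν₂.exists_ne lam with ⟨w₂, hw₂⟩ | ⟨w₂, hw₂, hw₂'⟩
  -- Both unit problems are solvable: neither Dirichlet condition at `s` costs a dimension, and the
  -- order is 1 or 0 according to whether the limits cancel.
  · have hdec := fun x hx =>
      FundamentalSystem.exists_sub_smul_mem_of_eq_single (x := x) hν₂ hw₂ hx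
    have hr₁ := congrArg (fun S : Submodule ℂ _ => Module.finrank ℂ S)
      (FundamentalSystem.ker_eq_inf_of_eq_single hν₁ hw₁)
    have hr₂ := congrArg (fun S : Submodule ℂ _ => Module.finrank ℂ S)
      (FundamentalSystem.ker_eq_inf_of_eq_single hν₂ hw₂)
    simp only [hbot] at hr₁
    have hlim := (FundamentalSystem.weylFunction_tendsto h.outerPart_regular hν₁ hw₁).add
      (FundamentalSystem.weylFunction_tendsto h.innerPart_regular hν₂ hw₂)
    have hd : F.cutData j s lam w₂ (Sum.inl 0) = 1 := by rw [hcut, hw₂, Pi.single_eq_same]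
    have hd₁ : w₁ (Sum.inl 0) = 1 := by
      rw [← F₁.outer_boundaryMap_inr lam w₁ 0, hw₁, Pi.single_eq_same]
    have ho₁ : FundamentalSystem.outerDatum w₁ = -w₁ (Sum.inr 0) := rfl
    -- `w₂` arrives at `s` with data `(1, m₂)` and `w₁` starts there with `(1, -m₁)`; they fit
    -- together exactly when `m₁ + m₂ = 0`.
    by_cases hm : FundamentalSystem.outerDatum w₁ + F₂.innerDatum lam w₂ = 0
    · have hmem : F.cutData j s lam w₂ ∈ F₁.weylSpace (Sum.inr 0) lam := by
        have : F.cutData j s lam w₂ = w₁ := by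
          funext l
          rcases l with l | l
          · rw [Subsingleton.elim l 0, hd, hd₁]
          · rw [Subsingleton.elim l 0, hcut']
            rw [ho₁] at hm
            linear_combination hm
        rw [this]
        exact FundamentalSystem.mem_weylSpace_of_eq_single hw₁
      rw [hm] at hlim
      rw [order_eq_one_of_tendsto hmer htop him hlim, F.ker_boundaryMap_eq_weylSpace h F₁ hdec hmem,
        FundamentalSystem.finrank_weylSpace_of_eq_single hν₂ hw₂, hr₁, hr₂]
      simp
    · have hmem : F.cutData j s lam w₂ ∉ F₁.weylSpace (Sum.inr 0) lam := fun hmem => by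
        have := FundamentalSystem.conjugate_eq_mul hν₁ hw₁ hmem
        rw [F₁.outer_boundaryMap_inr, hd, one_mul] at this
        have e : FundamentalSystem.outerDatum (F.cutData j s lam w₂) = -F₂.innerDatum lam w₂ := rfl
        rw [e] at this
        exact hm (by rw [← this, neg_add_cancel])
      rw [order_eq_zero_of_tendsto hm hlim, F.ker_boundaryMap_eq_inf h F₁ hdec hmem, hr₁, ← hr₂]
      simp
  -- Pole on the inner side only: the inner eigenfunction `w₂` does not continue, so `dim K = 0 +
  -- (dim K + 1) - 1`.
  · have hdec := fun x hx =>
      FundamentalSystem.exists_sub_smul_mem_of_conjugate_ne_zero (x := x) hν₂ hw₂ hw₂' hx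
    have hr₁ := congrArg (fun S : Submodule ℂ _ => Module.finrank ℂ S)
      (FundamentalSystem.ker_eq_inf_of_eq_single hν₁ hw₁)
    simp only [hbot] at hr₁
    have hmem : F.cutData j s lam w₂ ∉ F₁.weylSpace (Sum.inr 0) lam := fun hmem => by
      have := FundamentalSystem.conjugate_eq_mul hν₁ hw₁ hmem
      rw [F₁.outer_boundaryMap_inr, hcut, hw₂, Pi.zero_apply, zero_mul] at this
      exact hw₂' (neg_eq_zero.1 this)
    obtain ⟨c, hc, hle⟩ := FundamentalSystem.weylFunction_pole h.innerPart_regular hν₂ hw₂ hw₂'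
    have hr₂ := (congrArg (fun S : Submodule ℂ _ => Module.finrank ℂ S)
      (FundamentalSystem.ker_eq_weylSpace_of_conjugate_ne_zero hν₂ hw₂ hw₂')).trans
      (FundamentalSystem.finrank_weylSpace_of_conjugate_ne_zero hν₂ hw₂ hw₂')
    have hE := congrArg (fun S : Submodule ℂ _ => Module.finrank ℂ S)
      (F.ker_boundaryMap_eq_inf h F₁ hdec hmem)
    rw [order_eq_neg_one_of_le hmer htop him hc fun y hy => ?_, hr₁, hr₂, hE, ← hF₂]
    · simp
    · rw [Pi.add_apply, Complex.add_im]
      linarith [hle y hy, him₁ _ (himy y hy)]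
  -- Pole on the outer side only: the value at `s` is forced to be zero on `Ω₁`, which excludes
  -- `w₂`, so `dim K = 1 + dim K - 1`.
  · have hdec := fun x hx =>
      FundamentalSystem.exists_sub_smul_mem_of_eq_single (x := x) hν₂ hw₂ hx
    have hr₂ := congrArg (fun S : Submodule ℂ _ => Module.finrank ℂ S)
      (FundamentalSystem.ker_eq_inf_of_eq_single hν₂ hw₂)
    have hmem : F.cutData j s lam w₂ ∉ F₁.weylSpace (Sum.inr 0) lam := fun hmem => by
      have := FundamentalSystem.boundaryMap_eq_zero_of_conjugate_ne_zero hν₁ hw₁ hw₁' hmem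
      rw [F₁.outer_boundaryMap_inr, hcut, hw₂, Pi.single_eq_same] at this
      exact one_ne_zero this
    obtain ⟨c, hc, hle⟩ := FundamentalSystem.weylFunction_pole h.outerPart_regular hν₁ hw₁ hw₁'
    rw [order_eq_neg_one_of_le hmer htop him hc fun y hy => ?_,
      F.ker_boundaryMap_eq_inf h F₁ hdec hmem, ← hr₂,
      FundamentalSystem.ker_eq_weylSpace_of_conjugate_ne_zero hν₁ hw₁ hw₁',
      FundamentalSystem.finrank_weylSpace_of_conjugate_ne_zero hν₁ hw₁ hw₁', hbot]
    · simp
    · rw [Pi.add_apply, Complex.add_im]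
      linarith [hle y hy, him₂ _ (himy y hy)]
  -- Poles on both sides: the two Dirichlet eigenfunctions glue after scaling, so `dim K + 1 = 1 +
  -- (dim K + 1) - 1`.
  · have hdec := fun x hx =>
      FundamentalSystem.exists_sub_smul_mem_of_conjugate_ne_zero (x := x) hν₂ hw₂ hw₂' hx
    have hmem : F.cutData j s lam w₂ ∈ F₁.weylSpace (Sum.inr 0) lam := by
      have hd₁ : w₁ (Sum.inl 0) = 0 := by
        rw [← F₁.outer_boundaryMap_inr lam w₁ 0, hw₁, Pi.zero_apply]
      have ho₁ : w₁ (Sum.inr 0) ≠ 0 := fun h0 => hw₁' (neg_eq_zero.2 h0)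
      have : F.cutData j s lam w₂ = (F₂.innerDatum lam w₂ / w₁ (Sum.inr 0)) • w₁ := by
        funext l
        rcases l with l | l
        · rw [Subsingleton.elim l 0, hcut, hw₂, Pi.zero_apply, Pi.smul_apply, hd₁, smul_zero]
        · rw [Subsingleton.elim l 0, hcut', Pi.smul_apply, smul_eq_mul, div_mul_cancel₀ _ ho₁]
      rw [this]
      exact Submodule.smul_mem _ _ (F₁.ker_boundaryMap_le_weylSpace _ _ hw₁)
    obtain ⟨c, hc, hle⟩ := FundamentalSystem.weylFunction_pole h.innerPart_regular hν₂ hw₂ hw₂'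
    have hr₂ := congrArg (fun S : Submodule ℂ _ => Module.finrank ℂ S)
      (FundamentalSystem.ker_eq_weylSpace_of_conjugate_ne_zero hν₂ hw₂ hw₂')
    have hE := congrArg (fun S : Submodule ℂ _ => Module.finrank ℂ S)
      (F.ker_boundaryMap_eq_weylSpace h F₁ hdec hmem)
    rw [order_eq_neg_one_of_le hmer htop him hc fun y hy => ?_, hE, ← hF₂, hr₂,
      FundamentalSystem.ker_eq_weylSpace_of_conjugate_ne_zero hν₁ hw₁ hw₁',
      FundamentalSystem.finrank_weylSpace_of_conjugate_ne_zero hν₁ hw₁ hw₁', hbot]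
    · simp
    · rw [Pi.add_apply, Complex.add_im]
      linarith [hle y hy, him₁ _ (himy y hy)]

end Sum

end StarData

/-! ### The global counting formula -/

theorem finsum_Iic_eq_sum {Λ : ℝ} {f : ℝ → ℕ} {S : Finset ℝ} (hS : ∀ μ ∈ S, μ ≤ Λ)
    (h : ∀ μ ≤ Λ, f μ ≠ 0 → μ ∈ S) : ∑ᶠ μ ∈ Iic Λ, f μ = ∑ μ ∈ S, f μ :=
  finsum_mem_eq_sum_of_inter_support_eq _ <| by
    ext μ
    exact ⟨fun hμ => ⟨h μ hμ.1 hμ.2, hμ.2⟩, fun hμ => ⟨hS μ hμ.1, hμ.2⟩⟩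

namespace StarData

variable {ι : Type*} [Fintype ι] [DecidableEq ι] {P : StarData ι} {j : ι} {s : ℝ}

theorem SelfAdjointBC.isCut (hbc : P.SelfAdjointBC) (hlt : ∀ i, P.left i < P.right i)
    (hV : ∀ i, IntegrableOn (P.V i) (Ioo (P.left i) (P.right i)))
    (hs : s ∈ Ioo (P.left j) (P.right j)) : P.IsCut j s where
  regular :=
    { lt := hlt
      integrable := fun i => (intervalIntegrable_iff_integrableOn_Ioo_of_le (hlt i).le).2 (hV i)
      lagrangian_α := IsLagrangian.of_rank hbc.rank_α hbc.symm_α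
      lagrangian_β := IsLagrangian.of_rank hbc.rank_β hbc.symm_β }
  diag_β₁ := hbc.diag_β₁
  diag_β₂ := hbc.diag_β₂
  mem := hs

namespace IsCut

theorem meromorphicAt_twoSidedMap (h : P.IsCut j s) (z : ℂ) :
    MeromorphicAt (P.twoSidedMap j s) z := by
  obtain ⟨F₁⟩ := h.outerPart_regular.nonempty_fundamentalSystem
  obtain ⟨F₂⟩ := h.innerPart_regular.nonempty_fundamentalSystem
  exact (weylSum_meromorphicAt F₁ F₂ h z).congr (twoSidedMap_eventuallyEq h F₁ F₂ z).symm

theorem order_twoSidedMap_ne_top (h : P.IsCut j s) (z : ℂ) :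
    meromorphicOrderAt (P.twoSidedMap j s) z ≠ ⊤ := by
  obtain ⟨F₁⟩ := h.outerPart_regular.nonempty_fundamentalSystem
  obtain ⟨F₂⟩ := h.innerPart_regular.nonempty_fundamentalSystem
  rw [meromorphicOrderAt_congr (twoSidedMap_eventuallyEq h F₁ F₂ z)]
  exact weylSum_order_ne_top F₁ F₂ h z

theorem finrank_eigenspace_eq (h : P.IsCut j s) (μ : ℝ) :
    (Module.finrank ℂ (eigenspace P.operator μ) : ℤ) =
      Module.finrank ℂ (eigenspace (P.outerPart j s).operator μ) +
      Module.finrank ℂ (eigenspace (P.innerPart j s).operator μ) +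
      (meromorphicOrderAt (P.twoSidedMap j s) μ).untop₀ := by
  obtain ⟨F⟩ := h.regular.nonempty_fundamentalSystem
  obtain ⟨F₁⟩ := h.outerPart_regular.nonempty_fundamentalSystem
  rw [F.finrank_eigenspace h.regular, F₁.finrank_eigenspace h.outerPart_regular,
    (F.toInner h).finrank_eigenspace h.innerPart_regular,
    meromorphicOrderAt_congr (twoSidedMap_eventuallyEq h F₁ (F.toInner h) μ)]
  exact finrank_ker_boundaryMap_eq F₁ h F μ

theorem outerPart_uniquelySolvable (h : P.IsCut j s) {z : ℂ}
    (hz : z ∈ resolventSet (P.outerPart j s).operator) (f : ℂ) :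
    (P.outerPart j s).UniquelySolvable z (outerValue f) ∧
      P.M₁ j s z f = P.M₁ j s z 1 * f := by
  obtain ⟨F⟩ := h.outerPart_regular.nonempty_fundamentalSystem
  have hk := (F.eigenspace_eq_bot_iff h.outerPart_regular z).1
    (eigenspace_eq_bot_of_mem_resolventSet hz)
  refine ⟨F.uniquelySolvable h.outerPart_regular hk _, ?_⟩
  rw [M₁_eq h F hk f, M₁_eq h F hk 1, mul_one]

theorem innerPart_uniquelySolvable (h : P.IsCut j s) {z : ℂ}
    (hz : z ∈ resolventSet (P.innerPart j s).operator) (f : ℂ) :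
    (P.innerPart j s).UniquelySolvable z (innerValue j f) ∧
      P.M₂ j s z f = P.M₂ j s z 1 * f := by
  obtain ⟨F⟩ := h.innerPart_regular.nonempty_fundamentalSystem
  have hk := (F.eigenspace_eq_bot_iff h.innerPart_regular z).1
    (eigenspace_eq_bot_of_mem_resolventSet hz)
  refine ⟨F.uniquelySolvable h.innerPart_regular hk _, ?_⟩
  rw [M₂_eq h F hk f, M₂_eq h F hk 1, mul_one]

/-- Zeros and poles need no separate finiteness argument: where all three eigenspaces vanish, the
local identity forces order zero. -/
theorem exists_finset_support (h : P.IsCut j s) (Λ : ℝ) : ∃ S : Finset ℝ, (∀ μ ∈ S, μ ≤ Λ) ∧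
    ∀ μ ≤ Λ, μ ∉ S → Module.finrank ℂ (eigenspace P.operator μ) = 0 ∧
      Module.finrank ℂ (eigenspace (P.outerPart j s).operator μ) = 0 ∧
      Module.finrank ℂ (eigenspace (P.innerPart j s).operator μ) = 0 ∧
      (meromorphicOrderAt (P.twoSidedMap j s) μ).untop₀ = 0 := by
  classical
  have h0 := (h.regular.finitelyManyEigenvalues Λ).1
  have h1 := (h.outerPart_regular.finitelyManyEigenvalues Λ).1
  have h2 := (h.innerPart_regular.finitelyManyEigenvalues Λ).1
  refine ⟨h0.toFinset ∪ h1.toFinset ∪ h2.toFinset, fun μ hμ => ?_, fun μ hμ hn => ?_⟩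
  · simp only [Finset.mem_union, Finite.mem_toFinset, mem_ofPred_eq] at hμ
    rcases hμ with (hμ | hμ) | hμ <;> exact hμ.1
  · simp only [Finset.mem_union, Finite.mem_toFinset, mem_ofPred_eq, hμ, true_and, not_or,
      not_not] at hn
    have e0 : Module.finrank ℂ (eigenspace P.operator μ) = 0 := by rw [hn.1.1, finrank_bot]
    have e1 : Module.finrank ℂ (eigenspace (P.outerPart j s).operator μ) = 0 := by
      rw [hn.1.2, finrank_bot]
    have e2 : Module.finrank ℂ (eigenspace (P.innerPart j s).operator μ) = 0 := by
      rw [hn.2, finrank_bot]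
    have := h.finrank_eigenspace_eq μ
    exact ⟨e0, e1, e2, by omega⟩

theorem finite_order_ne_zero (h : P.IsCut j s) (Λ : ℝ) :
    {μ : ℝ | μ ≤ Λ ∧ meromorphicOrderAt (P.twoSidedMap j s) (μ : ℂ) ≠ 0}.Finite := by
  obtain ⟨S, -, hS⟩ := h.exists_finset_support Λ
  refine S.finite_toSet.subset fun μ hμ => by_contra fun hn => hμ.2 ?_
  rw [← WithTop.coe_untop₀_of_ne_top (h.order_twoSidedMap_ne_top μ), (hS μ hμ.1 hn).2.2.2]
  rfl

theorem eigenvalueCount_eq (h : P.IsCut j s) (Λ : ℝ) :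
    (eigenvalueCount P.operator Λ : ℤ) =
      eigenvalueCount (P.outerPart j s).operator Λ + eigenvalueCount (P.innerPart j s).operator Λ +
      ((zeroCount (P.twoSidedMap j s) Λ : ℤ) - poleCount (P.twoSidedMap j s) Λ) := by
  obtain ⟨S, hΛ, hS⟩ := h.exists_finset_support Λ
  rw [eigenvalueCount, eigenvalueCount, eigenvalueCount, zeroCount, poleCount,
    finsum_Iic_eq_sum hΛ fun μ hμ hf => by_contra fun hn => hf (hS μ hμ hn).1,
    finsum_Iic_eq_sum hΛ fun μ hμ hf => by_contra fun hn => hf (hS μ hμ hn).2.1,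
    finsum_Iic_eq_sum hΛ fun μ hμ hf => by_contra fun hn => hf (hS μ hμ hn).2.2.1,
    finsum_Iic_eq_sum hΛ fun μ hμ hf => by_contra fun hn =>
      hf (by rw [zeroOrder, (hS μ hμ hn).2.2.2]; rfl),
    finsum_Iic_eq_sum hΛ fun μ hμ hf => by_contra fun hn =>
      hf (by rw [poleOrder, (hS μ hμ hn).2.2.2]; rfl)]
  push_cast
  rw [← Finset.sum_add_distrib, ← Finset.sum_sub_distrib, ← Finset.sum_add_distrib]
  refine Finset.sum_congr rfl fun μ _ => ?_
  -- Zero order minus pole order is the meromorphic order itself, so the summands agree by the local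
  -- identity.
  rw [h.finrank_eigenspace_eq μ, zeroOrder, poleOrder, Int.toNat_sub_toNat_neg]

end IsCut

end StarData

end QuantumStar

theorem mainTheorem2 {n : ℕ} (ℓ : Fin n → ℝ) (hℓ : ∀ i, 0 < ℓ i)
    (V : Fin n → ℝ → ℝ)
    (hV : ∀ i, MeasureTheory.IntegrableOn (V i) (Set.Ioo 0 (ℓ i)))
    (α₁ α₂ β₁ β₂ : Matrix (Fin n) (Fin n) ℂ)
    (P : QuantumStar.StarData (Fin n)) (hP : P = ⟨fun _ => 0, ℓ, V, α₁, α₂, β₁, β₂⟩)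
    (hbc : P.SelfAdjointBC)
    (j : Fin n) (s : ℝ) (hs : s ∈ Set.Ioo 0 (ℓ j)) :
    -- the one-sided maps are well defined and linear on the resolvent sets
    (∀ z ∈ QuantumStar.resolventSet (P.outerPart j s).operator, ∀ f : ℂ,
      (P.outerPart j s).UniquelySolvable z (QuantumStar.StarData.outerValue f) ∧
      P.M₁ j s z f = P.M₁ j s z 1 * f) ∧
    (∀ z ∈ QuantumStar.resolventSet (P.innerPart j s).operator, ∀ f : ℂ,
      (P.innerPart j s).UniquelySolvable z (QuantumStar.StarData.innerValue j f) ∧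
      P.M₂ j s z f = P.M₂ j s z 1 * f) ∧
    -- their sum is a meromorphic function on the plane, not identically zero
    (∀ z : ℂ, MeromorphicAt (P.twoSidedMap j s) z ∧
      meromorphicOrderAt (P.twoSidedMap j s) z ≠ ⊤) ∧
    -- all the numbers are finite, and they satisfy the counting formula
    ∀ Λ : ℝ,
      QuantumStar.FinitelyManyEigenvalues P.operator Λ ∧
      QuantumStar.FinitelyManyEigenvalues (P.outerPart j s).operator Λ ∧
      QuantumStar.FinitelyManyEigenvalues (P.innerPart j s).operator Λ ∧
      {μ : ℝ | μ ≤ Λ ∧ meromorphicOrderAt (P.twoSidedMap j s) (μ : ℂ) ≠ 0}.Finite ∧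
      (QuantumStar.eigenvalueCount P.operator Λ : ℤ) =
        QuantumStar.eigenvalueCount (P.outerPart j s).operator Λ +
        QuantumStar.eigenvalueCount (P.innerPart j s).operator Λ +
        ((QuantumStar.zeroCount (P.twoSidedMap j s) Λ : ℤ) -
          QuantumStar.poleCount (P.twoSidedMap j s) Λ) := by
  subst hP
  have h := hbc.isCut (j := j) (s := s) hℓ hV hs
  exact ⟨fun z hz f => h.outerPart_uniquelySolvable hz f,
    fun z hz f => h.innerPart_uniquelySolvable hz f,
    fun z => ⟨h.meromorphicAt_twoSidedMap z, h.order_twoSidedMap_ne_top z⟩,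
    fun Λ => ⟨h.regular.finitelyManyEigenvalues Λ, h.outerPart_regular.finitelyManyEigenvalues Λ,
      h.innerPart_regular.finitelyManyEigenvalues Λ, h.finite_order_ne_zero Λ,
      h.eigenvalueCount_eq Λ⟩⟩
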